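/- **Setting.** Let $\Omega\subset\mathbb R^2$ be a bounded domain with $C^\infty$ boundary, with $0\in\Omega$ and $x\in\Omega\iff -x\in\Omega$. Let $G(x,y)=\frac1{2\pi}\ln\frac1{|x-y|}+H(x,y)$ be the Green function of $-\Delta$ in $\Omega$ with zero Dirichlet data, $H$ its regular part, and $h(x)=H(x,x)$. For $u\in C^2(\mathbb R^2)$ let $Pu\in C^2(\Omega)\cap C(\overline\Omega)$ be the solution of $\Delta Pu=\Delta u$ in $\Omega$, $Pu=0$ on $\partial\Omega$. For $\alpha\ge 2$, $\delta>0$ put $$U_{\alpha,\delta}(x)=\ln\frac{2\alpha^2\delta^\alpha}{(\delta^\alpha+|x|^\alpha)^2},\qquad v_\alpha=U_{\alpha,1},\qquad \mathcal V_\alpha(y)=v_\alpha(y)+(\alpha-2)\ln|y|,$$ $$\varphi^0(v)=\frac{v^2}2,\qquad \varphi^1(v,w)=vw-\frac{v^3}3-\frac{w^2}2-\frac{v^4}8+\frac{v^2w}2 .$$ Let $w^0_\alpha,w^1_\alpha$ be the radial $C^2$ solutions on $\mathbb R^2$ of $$\Delta w^0_\alpha+|y|^{\alpha-2}e^{v_\alpha}w^0_\alpha=|y|^{\alpha-2}e^{v_\alpha}\varphi^0(\mathcal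 V_\alpha),\qquad \Delta w^1_\alpha+|y|^{\alpha-2}e^{v_\alpha}w^1_\alpha=|y|^{\alpha-2}e^{v_\alpha}\varphi^1(\mathcal V_\alpha,w^0_\alpha)$$ such that $w^\ell_\alpha(y)=C^\ell_\alpha\ln|y|+O(|y|^{-1})$ as $|y|\to\infty$, for some constants $C^\ell_\alpha$, $\ell=0,1$. **Parameters.** Let $k\ge1$ and $K>0$. For $p>1$ consider parameters $\alpha_j,\delta_j,\tau_j$ ($1\le j\le k$) that solve the system $$\begin{cases} \alpha_1=2,\\ \alpha_j=2-\sum_{1\le i<j}\frac{\tau_i}{\tau_j}(-1)^{i-j}\Big(2\alpha_i-\frac{C^0_{\alpha_i}}p-\frac{C^1_{\alpha_i}}{p^2}\Big), & 2\le j\le k,\\ -\Big(\alpha_k-\frac{C^0_{\alpha_k}}p-\frac{C^1_{\alpha_k}}{p^2}+2\Big)\ln\delta_k+c_k=p,\\ -\Big(\alpha_j-\frac{C^0_{\alpha_j}}p-\frac{C^1_{\alpha_j}}{p^2}+2\Big)\ln\delta_j-2\sum_{j<i\le k}\frac{\tau_i}{\tau_j}(-1)^{i-j}\Big(\alpha_i-\frac{C^0_{\alpha_i}}{2p}-\frac{C^1_{\alpha_i}}{2p^2}\Big)\ln\delta_i+c_j=p,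 & 1\le j\le k-1,\\ p^p\,\tau_j^{p-1}\delta_j^2=1, & 1\le j\le k, \end{cases}$$ where $$c_j=4\pi h(0)\sum_{i=1}^k(-1)^{i-j}\frac{\tau_i}{\tau_j}\Big(\alpha_i-\frac{C^0_{\alpha_i}}{2p}-\frac{C^1_{\alpha_i}}{2p^2}\Big)-\ln(2\alpha_j^2)+\sum_{i>j}(-1)^{i-j}\frac{\tau_i}{\tau_j}\Big(\frac{w^0_{\alpha_i}(0)}p+\frac{w^1_{\alpha_i}(0)}{p^2}\Big),$$ and that satisfy * (A1) $2=\alpha_1<\alpha_2<\dots<\alpha_k\le K$; * (A2) $\delta_i=C_ie^{-b_ip}$ with $K^{-1}\le C_i\le K$ and $K^{-1}\le b_k<b_{k-1}<\dots<b_1\le K$; * (A3) $0<\tau_i\le K/p$ and $K^{-1}\le\tau_i/\tau_j\le K$ for all $i,j$. **Approximate solution and norm.** Let $$\mathcal U_p=\sum_{i=1}^k(-1)^{i-1}\tau_i\,P\Big(U_{\alpha_i,\delta_i}+\frac{w^0_{\alpha_i}(\cdot/\delta_i)}p+\frac{w^1_{\alpha_i}(\cdot/\delta_i)}{p^2}\Big),\qquad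 \mathcal R_p=\Delta\,\mathcal U_p+|\mathcal U_p|^{p-1}\mathcal U_p .$$ With $\varepsilon_j=\tau_{j+1}/(\tau_j+\tau_{j+1})$ and $r_j=\delta_j^{\varepsilon_j}\delta_{j+1}^{1-\varepsilon_j}$ for $1\le j\le k-1$, let $A_j=\{x\in\Omega: r_{j-1}\le|x|<r_j\}$ for $1\le j\le k$, where the lower bound is dropped for $j=1$ and the upper bound is dropped for $j=k$. For $0<\eta<1$ put $$\rho_p(x)=\sum_{j=1}^k\frac{\delta_j^{2+\eta}+|x|^{2+\eta}}{\delta_j^\eta}\,\chi_{A_j}(x),\qquad \|f\|_{\rho_p}=\|\rho_p f\|_{L^\infty(\Omega)} .$$ **Proposition.** For every such $\Omega$, every $k\ge1$, $\eta\in(0,1)$ and $K>0$ there are $C>0$ and $p_0>1$ such that for all $p\ge p_0$ and all parameters as above $$\|\mathcal R_p\|_{\rho_p}\le\frac C{p^4}.$$ -/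

import Mathlib

open Set Filter Topology MeasureTheory
open scoped ContDiff

noncomputable section

namespace LaneEmdenTower

/-- The Euclidean plane. -/
abbrev Plane : Type := EuclideanSpace ℝ (Fin 2)

/-- The (classical) Laplacian of a real function on the plane. -/
def lap (u : Plane → ℝ) : Plane → ℝ := Laplacian.laplacian u

/-! ### The domain, its Green function and the projection -/

/-- `C^∞` boundary: near each of its boundary points, `Ω` is the sublevel set `{f < 0}` of a smooth
function `f` whose differential does not vanish at that point. -/
def HasSmoothBoundary (Ω : Set Plane) : Prop :=
  ∀ x ∈ frontier Ω, ∃ (s : Set Plane) (f : Plane → ℝ), IsOpen s ∧ x ∈ s ∧ ContDiffOn ℝ ∞ f s ∧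
    fderiv ℝ f x ≠ 0 ∧ Ω ∩ s = {y | y ∈ s ∧ f y < 0}

/-- Smooth bounded planar domains containing the origin and symmetric with respect to it. -/
structure IsSymmetricSmoothDomain (Ω : Set Plane) : Prop where
  isOpen : IsOpen Ω
  isConnected : IsConnected Ω
  isBounded : Bornology.IsBounded Ω
  smooth : HasSmoothBoundary Ω
  zero_mem : (0 : Plane) ∈ Ω
  symm : ∀ x, x ∈ Ω ↔ -x ∈ Ω

/-- `G(x,y) = (1/2π) ln (1/|x-y|) + H(x,y)`. -/
def greenOf (H : Plane → Plane → ℝ) (x y : Plane) : ℝ :=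
  1 / (2 * Real.pi) * Real.log (1 / ‖x - y‖) + H x y

/-- `H` is the regular part of the Dirichlet Green function `G = greenOf H` of `Ω`. As
`(1/2π) ln (1/|x-y|)` is the fundamental solution of `-Δ`, the equation `-Δ_x G(·,y) = δ_y` says
that `H(·,y)` is harmonic in `Ω`; the boundary condition is `G(x,y) = 0` for `x ∈ ∂Ω`. -/
def IsGreenRegularPart (Ω : Set Plane) (H : Plane → Plane → ℝ) : Prop :=
  ∀ y ∈ Ω, InnerProductSpace.HarmonicOnNhd (fun x => H x y) Ω ∧
    ContinuousOn (fun x => H x y) (closure Ω) ∧ ∀ x ∈ frontier Ω, greenOf H x y = 0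

/-- The Robin function `h(x) = H(x,x)`. -/
def robin (H : Plane → Plane → ℝ) (x : Plane) : ℝ := H x x

/-- `v = P u`: the function with `Δ v = Δ u` in `Ω` and `v = 0` on `∂Ω`. -/
structure IsProjection (Ω : Set Plane) (u v : Plane → ℝ) : Prop where
  contDiffOn : ContDiffOn ℝ 2 v Ω
  continuousOn : ContinuousOn v (closure Ω)
  lap_eq : ∀ x ∈ Ω, lap v x = lap u x
  boundary : ∀ x ∈ frontier Ω, v x = 0

/-! ### The bubbles and the correction profiles -/

/-- `U_{α,δ}(x) = ln (2 α² δ^α / (δ^α + |x|^α)²)`. -/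
def bubble (α δ : ℝ) (x : Plane) : ℝ :=
  Real.log (2 * α ^ 2 * δ ^ α / (δ ^ α + ‖x‖ ^ α) ^ 2)

/-- `v_α = U_{α,1}`. -/
def bubbleOne (α : ℝ) (y : Plane) : ℝ := Real.log (2 * α ^ 2 / (1 + ‖y‖ ^ α) ^ 2)

/-- The mass `|y|^{α-2} e^{v_α(y)}`. -/
def mass (α : ℝ) (y : Plane) : ℝ := ‖y‖ ^ (α - 2) * Real.exp (bubbleOne α y)

/-- `V_α(y) = v_α(y) + ln |y|^{α-2}`. At `y = 0` it occurs only multiplied by `mass α 0`, which is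
zero for `α > 2`, while for `α = 2` the logarithmic term is absent. -/
def bigV (α : ℝ) (y : Plane) : ℝ := bubbleOne α y + (α - 2) * Real.log ‖y‖

/-- `φ⁰(v) = v²/2`. -/
def phi0 (v : ℝ) : ℝ := v ^ 2 / 2

/-- `φ¹(v,w) = v w - v³/3 - w²/2 - v⁴/8 + v² w/2`. -/
def phi1 (v w : ℝ) : ℝ := v * w - v ^ 3 / 3 - w ^ 2 / 2 - v ^ 4 / 8 + v ^ 2 * w / 2

/-- `w` is a radial `C²` solution of `Δ w + |y|^{α-2} e^{v_α} w = |y|^{α-2} e^{v_α} f` on `ℝ²` with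
`w(y) = c ln |y| + O(1/|y|)` as `|y| → ∞`. -/
structure IsCorrection (α : ℝ) (f w : Plane → ℝ) (c : ℝ) : Prop where
  contDiff : ContDiff ℝ 2 w
  radial : ∀ x y : Plane, ‖x‖ = ‖y‖ → w x = w y
  eq : ∀ y, lap w y + mass α y * w y = mass α y * f y
  asymp : (fun y => w y - c * Real.log ‖y‖) =O[Bornology.cobounded Plane] fun y => ‖y‖⁻¹

/-! ### The parameters of the tower

All families are indexed by `i = 1, …, k`; values at other indices play no role. -/

/-- Singularity coefficients `α_i`, concentration parameters `δ_i`, coefficients `τ_i`, correction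
profiles `w⁰_{α_i}`, `w¹_{α_i}` and their logarithmic growth rates `C⁰_{α_i}`, `C¹_{α_i}`. -/
structure Tower where
  α : ℕ → ℝ
  δ : ℕ → ℝ
  τ : ℕ → ℝ
  w0 : ℕ → Plane → ℝ
  w1 : ℕ → Plane → ℝ
  C0 : ℕ → ℝ
  C1 : ℕ → ℝ

namespace Tower

variable (T : Tower)

/-- `w⁰_{α_i}`, `w¹_{α_i}`, `C⁰_{α_i}`, `C¹_{α_i}` are the correction profiles and the growth rates
that belong to `α_i`. -/
def HasCorrections (k : ℕ) : Prop :=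
  ∀ i ∈ Finset.Icc 1 k,
    IsCorrection (T.α i) (fun y => phi0 (bigV (T.α i) y)) (T.w0 i) (T.C0 i) ∧
    IsCorrection (T.α i) (fun y => phi1 (bigV (T.α i) y) (T.w0 i y)) (T.w1 i) (T.C1 i)

/-- `α_i^{(w)}`, defined by `2 α_i^{(w)} = 2 α_i - C⁰_{α_i}/p - C¹_{α_i}/p²`. -/
def αw (p : ℝ) (i : ℕ) : ℝ := (2 * T.α i - T.C0 i / p - T.C1 i / p ^ 2) / 2

/-- The constants `c_j`; note that `(-1)^{i-j} = (-1)^{i+j}`. -/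
def c (k : ℕ) (h0 p : ℝ) (j : ℕ) : ℝ :=
  4 * Real.pi * h0 * ∑ i ∈ Finset.Icc 1 k, (-1) ^ (i + j) * (T.τ i / T.τ j) * T.αw p i
    - Real.log (2 * T.α j ^ 2)
    + ∑ i ∈ Finset.Ioc j k, (-1) ^ (i + j) * (T.τ i / T.τ j) *
        (T.w0 i 0 / p + T.w1 i 0 / p ^ 2)

/-- The nonlinear system for `(α_j, δ_j, τ_j)`, `j = 1, …, k`; `h0 = h(0)`. -/
structure SolvesSystem (k : ℕ) (h0 p : ℝ) : Prop where
  alpha_one : T.α 1 = 2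
  alpha : ∀ j ∈ Finset.Icc 2 k,
    T.α j = 2 - ∑ i ∈ Finset.Ico 1 j, T.τ i / T.τ j * (-1) ^ (i + j) *
      (2 * T.α i - T.C0 i / p - T.C1 i / p ^ 2)
  delta_last :
    -(T.α k - T.C0 k / p - T.C1 k / p ^ 2 + 2) * Real.log (T.δ k) + T.c k h0 p k = p
  delta : ∀ j ∈ Finset.Ico 1 k,
    -(T.α j - T.C0 j / p - T.C1 j / p ^ 2 + 2) * Real.log (T.δ j)
      - 2 * ∑ i ∈ Finset.Ioc j k, T.τ i / T.τ j * (-1) ^ (i + j) *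
          (T.α i - T.C0 i / (2 * p) - T.C1 i / (2 * p ^ 2)) * Real.log (T.δ i)
      + T.c k h0 p j = p
  tau : ∀ j ∈ Finset.Icc 1 k, p ^ p * T.τ j ^ (p - 1) * T.δ j ^ 2 = 1

/-- The standing bounds on the parameters, with constant `K`:
`2 = α_1 < … < α_k ≤ K`; `δ_i = C_i e^{-b_i p}` with `1/K ≤ C_i ≤ K` and
`1/K ≤ b_k < … < b_1 ≤ K`; `0 < τ_i ≤ K/p` and `1/K ≤ τ_i/τ_j ≤ K`. -/
structure Admissible (k : ℕ) (K p : ℝ) : Prop where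
  alpha_one : T.α 1 = 2
  alpha_lt : ∀ i ∈ Finset.Ico 1 k, T.α i < T.α (i + 1)
  alpha_le : T.α k ≤ K
  delta : ∃ C b : ℕ → ℝ,
    (∀ i ∈ Finset.Icc 1 k, T.δ i = C i * Real.exp (-(b i * p)) ∧ K⁻¹ ≤ C i ∧ C i ≤ K) ∧
    (∀ i ∈ Finset.Ico 1 k, b (i + 1) < b i) ∧ K⁻¹ ≤ b k ∧ b 1 ≤ K
  tau_pos : ∀ i ∈ Finset.Icc 1 k, 0 < T.τ i
  tau_le : ∀ i ∈ Finset.Icc 1 k, T.τ i ≤ K / p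
  tau_ratio : ∀ i ∈ Finset.Icc 1 k, ∀ j ∈ Finset.Icc 1 k,
    K⁻¹ ≤ T.τ i / T.τ j ∧ T.τ i / T.τ j ≤ K

/-! ### The approximate solution, the annuli, the weight and the error -/

/-- `U_{α_i,δ_i}(x) + w⁰_{α_i}(x/δ_i)/p + w¹_{α_i}(x/δ_i)/p²`. -/
def corrected (p : ℝ) (i : ℕ) (x : Plane) : ℝ :=
  bubble (T.α i) (T.δ i) x + T.w0 i ((T.δ i)⁻¹ • x) / p + T.w1 i ((T.δ i)⁻¹ • x) / p ^ 2

/-- `U` is the approximate solution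
`U_p = ∑_{i=1}^k (-1)^{i-1} τ_i P(U_{α_i,δ_i} + w⁰_{α_i,δ_i}/p + w¹_{α_i,δ_i}/p²)`. -/
def IsApproxSolution (Ω : Set Plane) (k : ℕ) (p : ℝ) (U : Plane → ℝ) : Prop :=
  ∃ PU : ℕ → Plane → ℝ, (∀ i ∈ Finset.Icc 1 k, IsProjection Ω (T.corrected p i) (PU i)) ∧
    U = fun x => ∑ i ∈ Finset.Icc 1 k, (-1) ^ (i - 1) * T.τ i * PU i x

/-- `ε_j = τ_{j+1} / (τ_j + τ_{j+1})`. -/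
def ε (j : ℕ) : ℝ := T.τ (j + 1) / (T.τ j + T.τ (j + 1))

/-- The radius `δ_j^{ε_j} δ_{j+1}^{1-ε_j}` that separates `A_j` from `A_{j+1}`. -/
def radius (j : ℕ) : ℝ := T.δ j ^ T.ε j * T.δ (j + 1) ^ (1 - T.ε j)

/-- The shrinking annulus `A_j`: no inner radius if `j = 1`, no outer radius if `j = k`. -/
def annulus (Ω : Set Plane) (k j : ℕ) : Set Plane :=
  {x | x ∈ Ω ∧ (1 < j → T.radius (j - 1) ≤ ‖x‖) ∧ (j < k → ‖x‖ < T.radius j)}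

/-- `ρ_p = ∑_j ρ_j χ_{A_j}` with `ρ_j(x) = (δ_j^{2+η} + |x|^{2+η}) / δ_j^η`. -/
def weight (Ω : Set Plane) (k : ℕ) (η : ℝ) (x : Plane) : ℝ :=
  ∑ j ∈ Finset.Icc 1 k, (T.annulus Ω k j).indicator
    (fun x => (T.δ j ^ (2 + η) + ‖x‖ ^ (2 + η)) / T.δ j ^ η) x

/-- `‖f‖_{ρ_p} = ‖ρ_p f‖_{L^∞(Ω)}`, with values in `[0,∞]`. -/
def weightedNorm (Ω : Set Plane) (k : ℕ) (η : ℝ) (f : Plane → ℝ) : ENNReal :=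
  eLpNorm (fun x => T.weight Ω k η x * f x) ⊤ (volume.restrict Ω)

end Tower

/-- `g_p(t) = |t|^{p-1} t`. -/
def g (p t : ℝ) : ℝ := |t| ^ (p - 1) * t

/-- The error `R = Δ U + g_p(U)` of an approximate solution `U`. -/
def errorOf (p : ℝ) (U : Plane → ℝ) (x : Plane) : ℝ := lap U x + g p (U x)

end LaneEmdenTower

end

/-! In the annulus `A_j`, written in `y = x / δ_j`, the parameter system is exactly what cancels
every constant and every logarithm contributed by the other bubbles and by the boundary. There `U_p
= (-1)^(j-1) τ_j (p + X)` with `X = 𝒱 + w⁰/p + w¹/p² + E`, the profiles being those of `α_j` at `y`,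
and `E` bounded everywhere and `O(p⁻³)` close to the bubble (`SolvesSystem.sum_leading`,
`exists_expansion`, `exists_error_bound`). Since `(τ_j p)^p = τ_j / δ_j²`, the nonlinearity equals
`± τ_j δ_j⁻² |1 + X/p|^(p-1) (1 + X/p)`. Expanding, `(1 + X/p)^p = e^𝒱 (1 + (w⁰ - φ⁰)/p + (w¹ -
φ¹)/p²) + …` (`rpow_expansion`), and the equations for `w⁰, w¹` say that the negative Laplacian of
the `j`-th corrected bubble is `δ_j⁻²` times the same expression
(`norm_sq_mul_lap_correctedBubble`). What is left is of order `p⁻³` in the weighted norm, and the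
prefactor `τ_j = O(1/p)` makes it `p⁻⁴`.

The work lies in uniformity.

Profiles. In the variable `σ = α ln |y|` the linearised equation no longer contains `α`, and its
homogeneous solutions are `prof` and `σ prof - 2`. Variation of constants then bounds the profiles
and their growth rates independently of `α` (`linearised_bounds`, `exists_profileBounds`). A maximum
principle on the punctured domain transfers the expansions at infinity to the projections
(`projection_expansion`).

Own bubble. The Taylor expansion is legitimate only where the logarithmic size `L` satisfies `L^4 ≤
p`. Beyond that, the weight times `e^𝒱` decays like `e^(-L)`, while `p^3 < L^12`, so crude bounds
suffice (`exists_own_term_bound`). They need `p + 𝒱` bounded below on all of `A_j`. This holds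
because the separating radii are the places where `p + 𝒱` vanishes to leading order (`slope_upper`,
`slope_lower`).

Other bubbles. Combining consecutive equations of the system gives gaps of order `p` between the `ln
δ_j`, a fixed factor between `τ_j` and `τ_{j+1}`, and `α_{j+1} - 2 ≈ (τ_j / τ_{j+1}) (α_j + 2)`
(`exists_spaced`). Hence `ε_j` stays below `1/2` by a fixed margin and `4 (1 - ε_j) ≤ α_{j+1} ε_j`,
which makes the foreign bubbles exponentially small in the weighted norm (`exponent_le`,
`exists_other_bound`). -/

noncomputable section

namespace LaneEmdenTower

/-! ### The Laplacian in polar coordinates -/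

/-- The quarter turn of the plane. -/
def quarterTurn (y : Plane) : Plane := !₂[-(y 1), y 0]

lemma lap_eq_fderiv_fderiv (u : Plane → ℝ) (y : Plane) :
    lap u y = fderiv ℝ (fderiv ℝ u) y (EuclideanSpace.single 0 1) (EuclideanSpace.single 0 1) +
      fderiv ℝ (fderiv ℝ u) y (EuclideanSpace.single 1 1) (EuclideanSpace.single 1 1) := by
  unfold lap
  rw [InnerProductSpace.laplacian_eq_iteratedFDeriv_orthonormalBasis u
    (EuclideanSpace.basisFun (Fin 2) ℝ)]
  simp [iteratedFDeriv_two_apply]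

/-- A vector and its quarter turn are orthogonal of equal length, so together they compute `‖z‖²`
times the trace of the Hessian. -/
lemma norm_sq_mul_lap (u : Plane → ℝ) (y z : Plane) :
    ‖z‖ ^ 2 * lap u y = fderiv ℝ (fderiv ℝ u) y z z +
      fderiv ℝ (fderiv ℝ u) y (quarterTurn z) (quarterTurn z) := by
  rw [lap_eq_fderiv_fderiv]
  set B := fderiv ℝ (fderiv ℝ u) y
  have h1 : z = z 0 • EuclideanSpace.single 0 1 + z 1 • EuclideanSpace.single 1 1 := by
    ext i; fin_cases i <;> simp
  have h2 : quarterTurn z =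
      (-(z 1)) • EuclideanSpace.single 0 1 + z 0 • EuclideanSpace.single 1 1 := by
    ext i; fin_cases i <;> simp [quarterTurn]
  have h3 : ‖z‖ ^ 2 = z 0 ^ 2 + z 1 ^ 2 := by
    rw [EuclideanSpace.norm_sq_eq]; simp
  rw [h2, h3]
  conv_rhs => rw [h1]
  simp
  ring

lemma ContDiffAt.hasFDerivAt_fderiv {u : Plane → ℝ} {y : Plane} (hu : ContDiffAt ℝ 2 u y) :
    HasFDerivAt (fderiv ℝ u) (fderiv ℝ (fderiv ℝ u) y) y := by
  have : ContDiffAt ℝ 1 (fderiv ℝ u) y := hu.fderiv_right (by norm_num)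
  exact (this.differentiableAt (by norm_num)).hasFDerivAt

/-- The second derivative of a `C²` function along a curve. -/
lemma hasDerivAt_fderiv_curve {u : Plane → ℝ} {γ γ' : ℝ → Plane} {t : ℝ} {a : Plane}
    (hu : ContDiffAt ℝ 2 u (γ t)) (hγ : HasDerivAt γ (γ' t) t) (hγ' : HasDerivAt γ' a t) :
    HasDerivAt (fun s => fderiv ℝ u (γ s) (γ' s))
      (fderiv ℝ (fderiv ℝ u) (γ t) (γ' t) (γ' t) + fderiv ℝ u (γ t) a) t := by
  have h1 := (ContDiffAt.hasFDerivAt_fderiv hu).comp_hasDerivAt t hγ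
  exact h1.clm_apply hγ'

lemma hasDerivAt_exp_smul (e : Plane) (s : ℝ) :
    HasDerivAt (fun s => Real.exp s • e) (Real.exp s • e) s :=
  (Real.hasDerivAt_exp s).smul_const e

lemma hasDerivAt_comp_exp_smul {u : Plane → ℝ} {e : Plane} {s : ℝ}
    (hu : DifferentiableAt ℝ u (Real.exp s • e)) :
    HasDerivAt (fun s => u (Real.exp s • e)) (fderiv ℝ u (Real.exp s • e) (Real.exp s • e)) s :=
  hu.hasFDerivAt.comp_hasDerivAt s (hasDerivAt_exp_smul e s)

lemma norm_rotate (y : Plane) (θ : ℝ) :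
    ‖Real.cos θ • y + Real.sin θ • quarterTurn y‖ = ‖y‖ := by
  have : ‖Real.cos θ • y + Real.sin θ • quarterTurn y‖ ^ 2 = ‖y‖ ^ 2 := by
    rw [EuclideanSpace.norm_sq_eq, EuclideanSpace.norm_sq_eq]
    simp [quarterTurn]
    linear_combination (y 0 ^ 2 + y 1 ^ 2) * Real.sin_sq_add_cos_sq θ
  exact (sq_eq_sq₀ (norm_nonneg _) (norm_nonneg _)).1 this

/-- For a radial function, `|y|² Δu` is the second derivative in the variable `ln |y|`. -/
lemma hasDerivAt_radial {u : Plane → ℝ} (hr : ∀ x y : Plane, ‖x‖ = ‖y‖ → u x = u y)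
    {e : Plane} {s : ℝ} (hu : ContDiffAt ℝ 2 u (Real.exp s • e)) :
    HasDerivAt (fun s => fderiv ℝ u (Real.exp s • e) (Real.exp s • e))
      (‖Real.exp s • e‖ ^ 2 * lap u (Real.exp s • e)) s := by
  have h1 := hasDerivAt_fderiv_curve hu (hasDerivAt_exp_smul e s) (hasDerivAt_exp_smul e s)
  set y := Real.exp s • e with hy
  rw [norm_sq_mul_lap u y y]
  convert h1 using 1
  congr 1
  -- A radial function is constant along this rotation. Its vanishing second derivative at `θ = 0`,
  -- where the acceleration is `-y`, identifies the tangential part of the Hessian with the radial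
  -- first derivative.
  let γ : ℝ → Plane := fun θ => Real.cos θ • y + Real.sin θ • quarterTurn y
  let γ' : ℝ → Plane := fun θ => (-Real.sin θ) • y + Real.cos θ • quarterTurn y
  have hγ : ∀ θ, HasDerivAt γ (γ' θ) θ := fun θ =>
    ((Real.hasDerivAt_cos θ).smul_const y).add ((Real.hasDerivAt_sin θ).smul_const _)
  have hγ' : HasDerivAt γ' (-y) 0 := by
    refine (((Real.hasDerivAt_sin 0).neg.smul_const y).add
      ((Real.hasDerivAt_cos 0).smul_const (quarterTurn y))).congr_deriv ?_
    simp
  have e0 : γ 0 = y := by simp [γ]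
  have e1 : γ' 0 = quarterTurn y := by simp [γ']
  have h2 := hasDerivAt_fderiv_curve (u := u) (γ := γ) (γ' := γ') (t := 0) (by rwa [e0]) (hγ 0) hγ'
  have h3 : (fun θ => fderiv ℝ u (γ θ) (γ' θ)) =ᶠ[𝓝 0] fun _ => (0 : ℝ) := by
    have hc : ContDiffAt ℝ 2 u (γ 0) := by rwa [e0]
    have := (hγ 0).continuousAt.eventually (hc.eventually (by norm_num))
    filter_upwards [this] with θ hθ
    have h4 := (hθ.differentiableAt (by norm_num)).hasFDerivAt.comp_hasDerivAt θ (hγ θ)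
    have h5 : u ∘ γ = fun _ => u y := by
      funext θ
      exact hr _ _ (norm_rotate y θ)
    rw [h5] at h4
    exact h4.unique (hasDerivAt_const _ _)
  have h6 := h2.unique ((hasDerivAt_const (0 : ℝ) (0 : ℝ)).congr_of_eventuallyEq h3)
  rw [e0, e1] at h6
  simp at h6
  linarith

/-- Computation of the Laplacian of a radial function from its derivatives in `ln |y|`. -/
lemma lap_of_hasDerivAt {u : Plane → ℝ} (hr : ∀ x y : Plane, ‖x‖ = ‖y‖ → u x = u y)
    {y : Plane} (hu : ContDiffAt ℝ 2 u y) {φ φ' : ℝ → ℝ} {l : ℝ}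
    (h0 : ∀ s, u (Real.exp s • y) = φ s) (h1 : ∀ s, HasDerivAt φ (φ' s) s)
    (h2 : HasDerivAt φ' l 0) : ‖y‖ ^ 2 * lap u y = l := by
  have hu' : ContDiffAt ℝ 2 u (Real.exp 0 • y) := by simpa using hu
  have h3 := hasDerivAt_radial hr hu'
  have h4 : (fun s => fderiv ℝ u (Real.exp s • y) (Real.exp s • y)) =ᶠ[𝓝 0] φ' := by
    have := (hasDerivAt_exp_smul y 0).continuousAt.eventually (hu'.eventually (by norm_num))
    filter_upwards [this] with s hs
    have h5 := hasDerivAt_comp_exp_smul (hs.differentiableAt (by norm_num))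
    have h6 : (fun s => u (Real.exp s • y)) = φ := funext h0
    rw [h6] at h5
    exact h5.unique (h1 s)
  have h7 := h3.unique (h2.congr_of_eventuallyEq h4)
  simpa using h7

/-! ### The maximum principle with an isolated bounded singularity -/

/-- A positive second derivative along a line would make the critical point a local minimum as well,
hence the function locally constant on that line, contradicting positivity. -/
lemma IsLocalMax.fderiv_fderiv_nonpos {v : Plane → ℝ} {x : Plane} (h : IsLocalMax v x)
    (hv : ContDiffAt ℝ 2 v x) (e : Plane) : fderiv ℝ (fderiv ℝ v) x e e ≤ 0 := by
  by_contra! hpos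
  let γ : ℝ → Plane := fun t => x + t • e
  have hγ : ∀ t, HasDerivAt γ e t := fun t => by
    refine (((hasDerivAt_id t).smul_const e).const_add x).congr_deriv ?_
    simp
  have e0 : γ 0 = x := by simp [γ]
  have hx : ContDiffAt ℝ 2 v (γ 0) := by rwa [e0]
  have h1 : deriv (fun t => v (γ t)) =ᶠ[𝓝 0] fun t => fderiv ℝ v (γ t) e := by
    filter_upwards [(hγ 0).continuousAt.eventually (hx.eventually (by norm_num))] with t ht
    exact ((ht.differentiableAt (by norm_num)).hasFDerivAt.comp_hasDerivAt t (hγ t)).deriv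
  have h2 := hasDerivAt_fderiv_curve (γ' := fun _ => e) hx (hγ 0) (hasDerivAt_const 0 e)
  rw [e0, map_zero, add_zero] at h2
  have h3 : deriv (deriv fun t => v (γ t)) 0 = fderiv ℝ (fderiv ℝ v) x e e := by
    rw [h1.deriv_eq, h2.deriv]
  have hmax : IsLocalMax (fun t => v (γ t)) 0 := by
    have : ∀ᶠ y in 𝓝 (γ 0), v y ≤ v (γ 0) := by rw [e0]; exact h
    exact (hγ 0).continuousAt.eventually this
  have hmin : IsLocalMin (fun t => v (γ t)) 0 :=
    isLocalMin_of_deriv_deriv_pos (by rw [h3]; exact hpos) hmax.deriv_eq_zero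
      ((hx.continuousAt.comp (hγ 0).continuousAt))
  have h4 : (fun t => v (γ t)) =ᶠ[𝓝 0] fun _ => v (γ 0) := by
    filter_upwards [hmax, hmin] with t h5 h6 using le_antisymm h5 h6
  have h5 : deriv (deriv fun t => v (γ t)) 0 = 0 := by
    rw [h4.deriv.deriv_eq]; simp
  rw [h5] at h3
  linarith

lemma IsLocalMax.lap_nonpos {v : Plane → ℝ} {x : Plane} (h : IsLocalMax v x)
    (hv : ContDiffAt ℝ 2 v x) : lap v x ≤ 0 := by
  rw [lap_eq_fderiv_fderiv]
  exact add_nonpos (IsLocalMax.fderiv_fderiv_nonpos h hv _)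
    (IsLocalMax.fderiv_fderiv_nonpos h hv _)

lemma lap_add {u v : Plane → ℝ} {x : Plane} (hu : ContDiffAt ℝ 2 u x) (hv : ContDiffAt ℝ 2 v x) :
    lap (fun y => u y + v y) x = lap u x + lap v x := hu.laplacian_add hv

lemma lap_const_mul {u : Plane → ℝ} {x : Plane} (c : ℝ) (hu : ContDiffAt ℝ 2 u x) :
    lap (fun y => c * u y) x = c * lap u x := InnerProductSpace.laplacian_smul c hu

lemma lap_sum {ι : Type*} (s : Finset ι) {u : ι → Plane → ℝ} {x : Plane}
    (hu : ∀ i ∈ s, ContDiffAt ℝ 2 (u i) x) :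
    lap (fun y => ∑ i ∈ s, u i y) x = ∑ i ∈ s, lap (u i) x := by
  classical
  induction s using Finset.induction_on with
  | empty => simp [lap, InnerProductSpace.laplacian_const]
  | insert a s ha ih =>
    simp only [Finset.sum_insert ha]
    rw [lap_add (hu a (Finset.mem_insert_self a s))
      (ContDiffAt.sum fun i hi => hu i (Finset.mem_insert_of_mem hi)),
      ih fun i hi => hu i (Finset.mem_insert_of_mem hi)]

lemma log_norm_exp_smul {y : Plane} (hy : y ≠ 0) (s : ℝ) :
    Real.log ‖Real.exp s • y‖ = s + Real.log ‖y‖ := by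
  rw [norm_smul, Real.norm_eq_abs, abs_of_pos (Real.exp_pos s),
    Real.log_mul (Real.exp_ne_zero s) (norm_ne_zero_iff.2 hy), Real.log_exp]

lemma contDiffAt_log_norm {x : Plane} (hx : x ≠ 0) :
    ContDiffAt ℝ 2 (fun y : Plane => Real.log ‖y‖) x :=
  (contDiffAt_norm ℝ hx).log (norm_ne_zero_iff.2 hx)

lemma lap_log_norm {x : Plane} (hx : x ≠ 0) : lap (fun y : Plane => Real.log ‖y‖) x = 0 := by
  have h := lap_of_hasDerivAt (u := fun y : Plane => Real.log ‖y‖) (fun a b h => by simp [h])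
    (contDiffAt_log_norm hx) (φ := fun s => s + Real.log ‖x‖) (φ' := fun _ => 1) (l := 0)
    (log_norm_exp_smul hx) (fun s => (hasDerivAt_id s).add_const _) (hasDerivAt_const _ _)
  have : ‖x‖ ^ 2 ≠ 0 := pow_ne_zero _ (norm_ne_zero_iff.2 hx)
  simpa [hx] using h

lemma lap_norm_sq {x : Plane} (hx : x ≠ 0) : lap (fun y : Plane => ‖y‖ ^ 2) x = 4 := by
  have hd : ∀ s : ℝ, HasDerivAt (fun s => Real.exp (2 * s)) (2 * Real.exp (2 * s)) s := fun s => by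
    refine ((hasDerivAt_id s).const_mul 2).exp.congr_deriv ?_
    simp; ring
  have h := lap_of_hasDerivAt (u := fun y : Plane => ‖y‖ ^ 2) (fun a b h => by simp [h])
    (contDiff_norm_sq ℝ).contDiffAt (y := x) (φ := fun s => Real.exp (2 * s) * ‖x‖ ^ 2)
    (φ' := fun s => 2 * Real.exp (2 * s) * ‖x‖ ^ 2) (l := 2 * (2 * Real.exp (2 * 0)) * ‖x‖ ^ 2)
    (fun s => by
      rw [norm_smul, Real.norm_eq_abs, abs_of_pos (Real.exp_pos s), mul_pow, ← Real.exp_nat_mul]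
      simp)
    (fun s => (hd s).mul_const _) (((hd 0).const_mul 2).mul_const _)
  have : ‖x‖ ^ 2 ≠ 0 := pow_ne_zero _ (norm_ne_zero_iff.2 hx)
  apply mul_left_cancel₀ this
  rw [h]; simp; ring

/-- The maximum principle for bounded functions that are harmonic in `Ω ∖ {0}`. -/
lemma le_of_harmonic_punctured {Ω : Set Plane} (hO : IsOpen Ω) (hb : Bornology.IsBounded Ω)
    {u : Plane → ℝ} (hc : ContinuousOn u (closure Ω))
    (h2 : ∀ x ∈ Ω, x ≠ 0 → ContDiffAt ℝ 2 u x) (hl : ∀ x ∈ Ω, x ≠ 0 → lap u x = 0) {M : ℝ}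
    (hM : ∀ x ∈ frontier Ω, u x ≤ M) {x : Plane} (hx : x ∈ Ω) (hx0 : x ≠ 0) : u x ≤ M := by
  have hK : IsCompact (closure Ω) := hb.isCompact_closure
  obtain ⟨B, hB⟩ := hK.exists_bound_of_continuousOn hc
  obtain ⟨D, hD1, hD⟩ : ∃ D : ℝ, 1 ≤ D ∧ ∀ z ∈ closure Ω, ‖z‖ ≤ D := by
    obtain ⟨D, hD⟩ := hK.exists_bound_of_continuousOn (f := fun z : Plane => z) continuousOn_id
    exact ⟨max D 1, le_max_right _ _, fun z hz => (hD z hz).trans (le_max_left _ _)⟩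
  -- The perturbation `ε (‖y‖² + log ‖y‖)` plays two roles: its logarithm keeps a maximum away from
  -- the puncture, and its Laplacian `4ε > 0` excludes an interior maximum. The maximum is therefore
  -- attained on the frontier.
  have hmain : ∀ ε : ℝ, 0 < ε →
      u x + ε * (‖x‖ ^ 2 + Real.log ‖x‖) ≤ M + ε * (D ^ 2 + Real.log D) := by
    intro ε hε
    set v : Plane → ℝ := fun y => u y + ε * (‖y‖ ^ 2 + Real.log ‖y‖) with hv
    have hlog : Tendsto (fun r : ℝ => B + ε * (D ^ 2 + Real.log r)) (𝓝[>] 0) atBot := by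
      refine tendsto_atBot_add_const_left _ _ ?_
      refine Tendsto.const_mul_atBot hε ?_
      exact tendsto_atBot_add_const_left _ _ Real.tendsto_log_nhdsGT_zero
    have hxpos : 0 < ‖x‖ := norm_pos_iff.2 hx0
    obtain ⟨r, ⟨hr1, hr2⟩, hr0⟩ : ∃ r : ℝ, (B + ε * (D ^ 2 + Real.log r) < v x ∧ r < ‖x‖) ∧ 0 < r :=
      (((hlog.eventually (eventually_lt_atBot (v x))).and
        (nhdsWithin_le_nhds (eventually_lt_nhds hxpos))).and self_mem_nhdsWithin).exists
    set S : Set Plane := closure Ω ∩ {y | r ≤ ‖y‖}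
    have hS : IsCompact S := hK.inter_right (isClosed_le continuous_const continuous_norm)
    have hxS : x ∈ S := ⟨subset_closure hx, hr2.le⟩
    have hne : ∀ y ∈ S, y ≠ 0 := fun y hy => norm_pos_iff.1 (hr0.trans_le hy.2)
    have hvc : ContinuousOn v S := by
      refine (hc.mono inter_subset_left).add (continuousOn_const.mul
        ((continuous_norm.pow 2).continuousOn.add ?_))
      exact continuous_norm.continuousOn.log fun y hy => norm_ne_zero_iff.2 (hne y hy)
    obtain ⟨z, hzS, hz⟩ := hS.exists_isMaxOn ⟨x, hxS⟩ hvc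
    have hxz : v x ≤ v z := hz hxS
    have hz0 := hne z hzS
    have hzpos : 0 < ‖z‖ := norm_pos_iff.2 hz0
    have hznorm := hD z hzS.1
    have hsq : ‖z‖ ^ 2 ≤ D ^ 2 := pow_le_pow_left₀ (norm_nonneg z) hznorm 2
    refine hxz.trans ?_
    by_cases hzf : z ∈ frontier Ω
    · have := Real.log_le_log hzpos hznorm
      have h3 := hM z hzf
      have h4 : ε * (‖z‖ ^ 2 + Real.log ‖z‖) ≤ ε * (D ^ 2 + Real.log D) :=
        mul_le_mul_of_nonneg_left (by linarith) hε.le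
      exact add_le_add h3 h4
    have hzO : z ∈ Ω := by
      by_contra hzO
      exact hzf ⟨hzS.1, by rwa [hO.interior_eq]⟩
    rcases eq_or_lt_of_le (show r ≤ ‖z‖ from hzS.2) with hzr | hzr
    · exfalso
      have h3 : u z ≤ B := (le_abs_self _).trans (hB z hzS.1)
      have h4 : ε * (‖z‖ ^ 2 + Real.log ‖z‖) ≤ ε * (D ^ 2 + Real.log r) := by
        rw [← hzr] at hsq ⊢
        exact mul_le_mul_of_nonneg_left (by linarith) hε.le
      have : v z ≤ B + ε * (D ^ 2 + Real.log r) := add_le_add h3 h4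
      linarith
    · exfalso
      have hloc : IsLocalMax v z := by
        filter_upwards [hO.mem_nhds hzO, continuous_norm.continuousAt.eventually
          (eventually_gt_nhds hzr)] with y hy1 hy2
        exact hz ⟨subset_closure hy1, hy2.le⟩
      have hn := (contDiff_norm_sq ℝ (E := Plane) (n := 2)).contDiffAt (x := z)
      have hw : ContDiffAt ℝ 2 (fun y : Plane => ‖y‖ ^ 2 + Real.log ‖y‖) z :=
        hn.add (contDiffAt_log_norm hz0)
      have hεw : ContDiffAt ℝ 2 (fun y : Plane => ε * (‖y‖ ^ 2 + Real.log ‖y‖)) z :=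
        contDiffAt_const.mul hw
      have h3 := IsLocalMax.lap_nonpos hloc ((h2 z hzO hz0).add hεw)
      rw [hv, lap_add (h2 z hzO hz0) hεw, lap_const_mul ε hw,
        lap_add hn (contDiffAt_log_norm hz0), hl z hzO hz0, lap_norm_sq hz0,
        lap_log_norm hz0] at h3
      linarith
  by_contra! hcon
  set Q := (D ^ 2 + Real.log D) - (‖x‖ ^ 2 + Real.log ‖x‖)
  have h5 : 0 < u x - M := sub_pos.2 hcon
  -- This `ε` is so small that `ε Q` is at most half of the supposed excess `u x - M`.
  have h6 := hmain ((u x - M) / (2 * (|Q| + 1))) (by positivity)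
  have h7 : u x - M ≤ (u x - M) / (2 * (|Q| + 1)) * Q := by
    simp only [Q]; nlinarith
  have h8 : (u x - M) / (2 * (|Q| + 1)) * Q ≤ (u x - M) / 2 := by
    rw [div_mul_eq_mul_div, div_le_div_iff₀ (by positivity) (by norm_num)]
    have := le_abs_self Q
    nlinarith
  linarith

lemma abs_le_of_harmonic_punctured {Ω : Set Plane} (hO : IsOpen Ω) (hb : Bornology.IsBounded Ω)
    {u : Plane → ℝ} (hc : ContinuousOn u (closure Ω))
    (h2 : ∀ x ∈ Ω, x ≠ 0 → ContDiffAt ℝ 2 u x) (hl : ∀ x ∈ Ω, x ≠ 0 → lap u x = 0) {M : ℝ}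
    (hM : ∀ x ∈ frontier Ω, |u x| ≤ M) {x : Plane} (hx : x ∈ Ω) (hx0 : x ≠ 0) : |u x| ≤ M := by
  refine abs_le'.2 ⟨le_of_harmonic_punctured hO hb hc h2 hl
    (fun z hz => (le_abs_self _).trans (hM z hz)) hx hx0, ?_⟩
  have := le_of_harmonic_punctured (u := fun y => (-1) * u y) hO hb (continuousOn_const.mul hc)
    (fun z hz hz0 => contDiffAt_const.mul (h2 z hz hz0))
    (fun z hz hz0 => by rw [lap_const_mul _ (h2 z hz hz0), hl z hz hz0, mul_zero]) (M := M)
    (fun z hz => by linarith [neg_le_abs (u z), hM z hz]) hx hx0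
  linarith

/-! ### The linearised equation on the line

In the variable `σ = α ln |y|` the equation for the correction profiles becomes
`u'' + 2 κ u = 2 κ f` with `κ = kern`, whatever `α` is. -/

/-- `e^σ / (1 + e^σ)²`. -/
def kern (σ : ℝ) : ℝ := Real.exp σ / (1 + Real.exp σ) ^ 2

/-- `tanh (σ/2)`, a solution of the homogeneous equation. -/
def prof (σ : ℝ) : ℝ := 1 - 2 / (1 + Real.exp σ)

lemma kern_pos (σ : ℝ) : 0 < kern σ := by unfold kern; positivity

lemma kern_le (σ : ℝ) : kern σ ≤ Real.exp (-|σ|) := by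
  unfold kern
  have h := Real.exp_pos σ
  rw [div_le_iff₀ (by positivity)]
  rcases le_total 0 σ with hs | hs
  · rw [abs_of_nonneg hs, Real.exp_neg, inv_mul_eq_div, le_div_iff₀ h]
    nlinarith
  · rw [abs_of_nonpos hs, neg_neg]
    nlinarith [mul_pos h h, mul_pos h (mul_pos h h)]

lemma hasDerivAt_log_one_add_exp (σ : ℝ) :
    HasDerivAt (fun σ => Real.log (1 + Real.exp σ)) (1 - 1 / (1 + Real.exp σ)) σ := by
  have h : 0 < 1 + Real.exp σ := by positivity
  refine (((Real.hasDerivAt_exp σ).const_add 1).log h.ne').congr_deriv ?_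
  field_simp
  ring

lemma hasDerivAt_inv_one_add_exp (σ : ℝ) :
    HasDerivAt (fun σ => 1 / (1 + Real.exp σ)) (-kern σ) σ := by
  have h : 0 < 1 + Real.exp σ := by positivity
  refine (((hasDerivAt_const σ 1)).div ((Real.hasDerivAt_exp σ).const_add 1) h.ne').congr_deriv ?_
  unfold kern
  field_simp
  ring

lemma hasDerivAt_prof (σ : ℝ) : HasDerivAt prof (2 * kern σ) σ := by
  have h := ((hasDerivAt_inv_one_add_exp σ).const_mul 2).const_sub 1
  refine (h.congr_deriv (by ring)).congr_of_eventuallyEq (Eventually.of_forall fun s => ?_)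
  unfold prof; ring

lemma hasDerivAt_kern (σ : ℝ) : HasDerivAt kern (-(kern σ * prof σ)) σ := by
  have h : 0 < 1 + Real.exp σ := by positivity
  refine ((Real.hasDerivAt_exp σ).div (((Real.hasDerivAt_exp σ).const_add 1).pow 2)
    (pow_ne_zero 2 h.ne')).congr_deriv ?_
  unfold kern prof
  simp
  field_simp
  ring

/-- The left side is the Wronskian of the two homogeneous solutions `prof` and `σ prof - 2`; being
`1`, it allows division-free variation of constants. -/
lemma prof_sq_add (σ : ℝ) : prof σ ^ 2 + 4 * kern σ = 1 := by
  have h : 0 < 1 + Real.exp σ := by positivity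
  unfold kern prof
  field_simp
  ring

lemma abs_prof_le (σ : ℝ) : |prof σ| ≤ 1 := by
  rw [← sq_le_one_iff_abs_le_one]
  linarith [prof_sq_add σ, kern_pos σ]

lemma abs_prof_sub_one_le {σ : ℝ} : |prof σ - 1| ≤ 2 * Real.exp (-σ) := by
  have h := Real.exp_pos σ
  have : prof σ - 1 = -(2 / (1 + Real.exp σ)) := by unfold prof; ring
  rw [this, abs_neg, abs_of_nonneg (by positivity), Real.exp_neg, div_le_iff₀ (by positivity)]
  field_simp
  linarith

lemma abs_prof_add_one_le {σ : ℝ} : |prof σ + 1| ≤ 2 * Real.exp σ := by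
  have h := Real.exp_pos σ
  have : prof σ + 1 = 2 * Real.exp σ / (1 + Real.exp σ) := by unfold prof; field_simp; ring
  rw [this, abs_of_nonneg (by positivity), div_le_iff₀ (by positivity)]
  nlinarith

/-! Functions whose derivative decays exponentially -/

/-- Adding or subtracting the primitive `B / b * exp (b s)` of the derivative bound makes `F`
monotone or antitone; comparison with the limit at `-∞` follows without integration. -/
lemma abs_sub_le_of_deriv_exp_atBot {F F' : ℝ → ℝ} {B b L : ℝ} (hb : 0 < b)
    (hF : ∀ s, HasDerivAt F (F' s) s) (hF' : ∀ s ≤ 0, |F' s| ≤ B * Real.exp (b * s))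
    (hL : Tendsto F atBot (𝓝 L)) {s : ℝ} (hs : s ≤ 0) :
    |F s - L| ≤ B / b * Real.exp (b * s) := by
  have he : ∀ s, HasDerivAt (fun s => B / b * Real.exp (b * s)) (B * Real.exp (b * s)) s :=
    fun s => by
    refine (((hasDerivAt_id s).const_mul b).exp.const_mul (B / b)).congr_deriv ?_
    simp; field_simp
  have htend : Tendsto (fun s => B / b * Real.exp (b * s)) atBot (𝓝 0) := by
    have : Tendsto (fun s => Real.exp (b * s)) atBot (𝓝 0) :=
      Real.tendsto_exp_atBot.comp (tendsto_id.const_mul_atBot hb)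
    simpa using this.const_mul (B / b)
  have hmono : MonotoneOn (fun s => F s + B / b * Real.exp (b * s)) (Iic 0) := by
    refine monotoneOn_of_hasDerivWithinAt_nonneg (convex_Iic 0)
      (fun s _ => ((hF s).add (he s)).continuousAt.continuousWithinAt)
      (fun s _ => ((hF s).add (he s)).hasDerivWithinAt) fun s hs => ?_
    have := neg_le_abs (F' s)
    have := hF' s (mem_Iic.1 (interior_subset hs))
    linarith
  have hanti : AntitoneOn (fun s => F s - B / b * Real.exp (b * s)) (Iic 0) := by
    refine antitoneOn_of_hasDerivWithinAt_nonpos (convex_Iic 0)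
      (fun s _ => ((hF s).sub (he s)).continuousAt.continuousWithinAt)
      (fun s _ => ((hF s).sub (he s)).hasDerivWithinAt) fun s hs => ?_
    have := le_abs_self (F' s)
    have := hF' s (mem_Iic.1 (interior_subset hs))
    linarith
  have h1 : L + 0 ≤ F s + B / b * Real.exp (b * s) := by
    refine le_of_tendsto (hL.add htend) ?_
    filter_upwards [eventually_le_atBot s] with t ht
    exact hmono (ht.trans hs) hs ht
  have h2 : F s - B / b * Real.exp (b * s) ≤ L - 0 := by
    refine ge_of_tendsto (hL.sub htend) ?_
    filter_upwards [eventually_le_atBot s] with t ht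
    exact hanti (ht.trans hs) hs ht
  rw [abs_le]
  constructor <;> linarith

/-- The same barriers on the other half-line, where the existence of the limit is part of the
conclusion. -/
lemma exists_abs_sub_le_of_deriv_exp_atTop {F F' : ℝ → ℝ} {B b : ℝ} (hb : 0 < b)
    (hF : ∀ s, HasDerivAt F (F' s) s) (hF' : ∀ s, 0 ≤ s → |F' s| ≤ B * Real.exp (-(b * s))) :
    ∃ L, ∀ s, 0 ≤ s → |F s - L| ≤ B / b * Real.exp (-(b * s)) := by
  have hB : 0 ≤ B := by
    have := (abs_nonneg _).trans (hF' 0 le_rfl)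
    simpa using this
  have he : ∀ s, HasDerivAt (fun s => B / b * Real.exp (-(b * s))) (-(B * Real.exp (-(b * s)))) s :=
    fun s => by
    refine (((hasDerivAt_id s).const_mul b).neg.exp.const_mul (B / b)).congr_deriv ?_
    simp; field_simp
  have hanti : AntitoneOn (fun s => F s + B / b * Real.exp (-(b * s))) (Ici 0) := by
    refine antitoneOn_of_hasDerivWithinAt_nonpos (convex_Ici 0)
      (fun s _ => ((hF s).add (he s)).continuousAt.continuousWithinAt)
      (fun s _ => ((hF s).add (he s)).hasDerivWithinAt) fun s hs => ?_
    have := le_abs_self (F' s)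
    have := hF' s (mem_Ici.1 (interior_subset hs))
    linarith
  have hmono : MonotoneOn (fun s => F s - B / b * Real.exp (-(b * s))) (Ici 0) := by
    refine monotoneOn_of_hasDerivWithinAt_nonneg (convex_Ici 0)
      (fun s _ => ((hF s).sub (he s)).continuousAt.continuousWithinAt)
      (fun s _ => ((hF s).sub (he s)).hasDerivWithinAt) fun s hs => ?_
    have := neg_le_abs (F' s)
    have := hF' s (mem_Ici.1 (interior_subset hs))
    linarith
  have hpos : ∀ s, 0 ≤ B / b * Real.exp (-(b * s)) := fun s => by positivity
  -- the lower barriers are bounded above by every upper barrier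
  have hle : ∀ s t, 0 ≤ s → 0 ≤ t →
      F s - B / b * Real.exp (-(b * s)) ≤ F t + B / b * Real.exp (-(b * t)) := by
    intro s t hs ht
    have h1 := hmono hs (hs.trans (le_max_left s t)) (le_max_left s t)
    have h2 := hanti ht (ht.trans (le_max_right s t)) (le_max_right s t)
    have h3 := hpos (max s t)
    simp only at h1 h2
    linarith
  -- The limit is taken as the supremum of the increasing lower barrier, which every value of the
  -- upper barrier bounds from above.
  refine ⟨sSup ((fun s => F s - B / b * Real.exp (-(b * s))) '' Ici 0), fun s hs => ?_⟩
  have hbdd : BddAbove ((fun s => F s - B / b * Real.exp (-(b * s))) '' Ici 0) :=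
    ⟨F 0 + B / b * Real.exp (-(b * 0)), by rintro _ ⟨t, ht, rfl⟩; exact hle t 0 ht le_rfl⟩
  have h1 := le_csSup hbdd (mem_image_of_mem _ (show s ∈ Ici 0 from hs))
  have h2 : sSup ((fun s => F s - B / b * Real.exp (-(b * s))) '' Ici 0) ≤
      F s + B / b * Real.exp (-(b * s)) :=
    csSup_le ⟨_, mem_image_of_mem _ (show s ∈ Ici 0 from hs)⟩
      (by rintro _ ⟨t, ht, rfl⟩; exact hle t s ht hs)
  rw [abs_le]
  constructor <;> linarith

/-- Polynomials are dominated by exponentials. -/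
lemma exists_pow_mul_exp_le (n : ℕ) {b : ℝ} (hb : 0 < b) :
    ∃ M, 0 < M ∧ ∀ t : ℝ, 0 ≤ t → (1 + t) ^ n * Real.exp (-(b * t)) ≤ M := by
  refine ⟨n.factorial * (1 / b) ^ n * Real.exp b, by positivity, fun t ht => ?_⟩
  have h1 := Real.pow_div_factorial_le_exp (b * (1 + t)) (by positivity) n
  have h2 : (1 + t) ^ n = (1 / b) ^ n * (b * (1 + t)) ^ n := by
    rw [← mul_pow]; congr 1; field_simp
  have h3 : (b * (1 + t)) ^ n ≤ n.factorial * Real.exp (b * (1 + t)) := by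
    rw [div_le_iff₀ (by positivity)] at h1; linarith
  calc (1 + t) ^ n * Real.exp (-(b * t))
      ≤ (1 / b) ^ n * (n.factorial * Real.exp (b * (1 + t))) * Real.exp (-(b * t)) := by
        rw [h2]; gcongr
    _ = n.factorial * (1 / b) ^ n * (Real.exp (b * (1 + t)) * Real.exp (-(b * t))) := by ring
    _ = n.factorial * (1 / b) ^ n * Real.exp b := by rw [← Real.exp_add]; congr 2; ring

lemma eq_zero_of_tendsto_affine {A b : ℝ}
    (h : Tendsto (fun s : ℝ => A - b * s) atTop (𝓝 0)) : b = 0 ∧ A = 0 := by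
  have hb : b = 0 := by
    have h1 := h.mul tendsto_inv_atTop_zero
    have h2 : Tendsto (fun s : ℝ => A * s⁻¹ - b) atTop (𝓝 (A * 0 - b)) :=
      (tendsto_inv_atTop_zero.const_mul A).sub_const b
    have h3 : (fun s : ℝ => (A - b * s) * s⁻¹) =ᶠ[atTop] fun s => A * s⁻¹ - b := by
      filter_upwards [eventually_gt_atTop 0] with s hs
      field_simp
    have := tendsto_nhds_unique (h1.congr' h3) h2
    linarith
  subst hb
  refine ⟨rfl, ?_⟩
  simp only [zero_mul, sub_zero] at h
  exact tendsto_nhds_unique tendsto_const_nhds h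

/-- Bounds, uniform in the data, for the solution of the linearised equation on the line that is
bounded at `-∞` and asymptotic to a multiple of `σ` at `+∞`. -/
lemma linearised_bounds (n : ℕ) {N : ℝ} (hN : 0 ≤ N) : ∃ M, 0 < M ∧
    ∀ (f u u' : ℝ → ℝ) (c a : ℝ), (∀ s, |f s| ≤ N * (1 + |s|) ^ n) →
      (∀ s, HasDerivAt u (u' s) s) → (∀ s, HasDerivAt u' (2 * kern s * (f s - u s)) s) →
      Tendsto u atBot (𝓝 a) → Tendsto u' atBot (𝓝 0) →
      Tendsto (fun s => s * u' s) atBot (𝓝 0) → Tendsto (fun s => u s - c * s) atTop (𝓝 0) →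
      |c| ≤ M ∧ |a| ≤ M ∧ (∀ s ≤ 0, |u s - a| ≤ M * Real.exp (s / 2)) ∧
        ∀ s, 0 ≤ s → |u s - c * s| ≤ M * Real.exp (-(s / 2)) := by
  obtain ⟨P, hP0, hP⟩ := exists_pow_mul_exp_le (n + 1) (b := 1 / 4) (by norm_num)
  obtain ⟨Q, hQ0, hQ⟩ := exists_pow_mul_exp_le 1 (b := 1 / 4) (by norm_num)
  -- `P` absorbs the polynomial growth of `f` and of the homogeneous solutions at the cost of a
  -- quarter of the decay of `kern`. The rate `3/4` remains, and `B1 = B / (3/4)` bounds the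
  -- resulting tails. `Q` pays for a further factor `1 + |s|`, leaving the final rate `1/2`.
  set B := 4 * N * P with hB
  have hB0 : 0 ≤ B := by positivity
  set B1 := B / (3 / 4) with hB1
  have hB10 : 0 ≤ B1 := by positivity
  refine ⟨15 * B1 * Q + 6 * B1 + 1, by positivity, ?_⟩
  intro f u u' c a hf hu hu' hua hua' hsu' huc
  -- `I1` and `I2` are the Wronskians of `u` with `prof` and with `s prof - 2`. Their derivatives
  -- involve only `f`, and `u` is recovered from them through `hrep` because the Wronskian of the
  -- basis is `1`.
  set I1 : ℝ → ℝ := fun s => u s * (2 * kern s) - u' s * prof s with hI1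
  set I2 : ℝ → ℝ := fun s => u s * (prof s + s * (2 * kern s)) - u' s * (s * prof s - 2) with hI2
  have hd1 : ∀ s, HasDerivAt I1 (-(2 * kern s * f s * prof s)) s := fun s => by
    refine (((hu s).mul ((hasDerivAt_kern s).const_mul 2)).sub
      ((hu' s).mul (hasDerivAt_prof s))).congr_deriv ?_
    ring
  have hd2 : ∀ s, HasDerivAt I2 (-(2 * kern s * f s * (s * prof s - 2))) s := fun s => by
    refine (((hu s).mul ((hasDerivAt_prof s).add ((hasDerivAt_id s).mul
      ((hasDerivAt_kern s).const_mul 2)))).sub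
      ((hu' s).mul (((hasDerivAt_id s).mul (hasDerivAt_prof s)).sub_const 2))).congr_deriv ?_
    simp only [id, Pi.add_apply, Pi.mul_apply]
    ring
  have hrep : ∀ s, u s = prof s * I2 s - (s * prof s - 2) * I1 s := fun s => by
    simp only [hI1, hI2]
    linear_combination (-u s) * prof_sq_add s
  have hbd : ∀ s g, |g| ≤ 2 * (1 + |s|) →
      |-(2 * kern s * f s * g)| ≤ B * Real.exp (-(3 / 4 * |s|)) := fun s g hg => by
    have h1 := hP |s| (abs_nonneg s)
    rw [abs_neg, abs_mul, abs_mul, abs_mul, abs_two, abs_of_pos (kern_pos s)]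
    calc 2 * kern s * |f s| * |g|
        ≤ 2 * Real.exp (-|s|) * (N * (1 + |s|) ^ n) * (2 * (1 + |s|)) := by
          gcongr
          · exact kern_le s
          · exact hf s
      _ = 4 * N * ((1 + |s|) ^ (n + 1) * Real.exp (-|s|)) := by ring
      _ = 4 * N * ((1 + |s|) ^ (n + 1) * Real.exp (-(1 / 4 * |s|)) * Real.exp (-(3 / 4 * |s|))) := by
          rw [mul_assoc ((1 + |s|) ^ (n + 1)), ← Real.exp_add]; congr 3; ring
      _ ≤ 4 * N * (P * Real.exp (-(3 / 4 * |s|))) := by gcongr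
      _ = B * Real.exp (-(3 / 4 * |s|)) := by rw [hB]; ring
  have hg1 : ∀ s, |prof s| ≤ 2 * (1 + |s|) := fun s => by
    linarith [abs_prof_le s, abs_nonneg s]
  have hsp : ∀ s, |s * prof s - 2| ≤ 2 + |s| := fun s => by
    have h1 : |s * prof s| ≤ |s| := by
      rw [abs_mul]; exact mul_le_of_le_one_right (abs_nonneg s) (abs_prof_le s)
    have h2 := abs_sub (s * prof s) 2
    rw [abs_two] at h2
    linarith
  have hg2 : ∀ s, |s * prof s - 2| ≤ 2 * (1 + |s|) := fun s => by
    linarith [hsp s, abs_nonneg s]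
  have hneg : ∀ s : ℝ, s ≤ 0 → Real.exp (-(3 / 4 * |s|)) = Real.exp (3 / 4 * s) := fun s hs => by
    rw [abs_of_nonpos hs]; congr 1; ring
  have hpos : ∀ s : ℝ, 0 ≤ s → Real.exp (-(3 / 4 * |s|)) = Real.exp (-(3 / 4 * s)) :=
    fun s hs => by rw [abs_of_nonneg hs]
  -- limits at `-∞`
  have hk0 : Tendsto kern atBot (𝓝 0) := by
    refine squeeze_zero' (Eventually.of_forall fun s => (kern_pos s).le) ?_ Real.tendsto_exp_atBot
    filter_upwards [eventually_le_atBot 0] with s hs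
    simpa [abs_of_nonpos hs] using kern_le s
  have hsk0 : Tendsto (fun s => s * (2 * kern s)) atBot (𝓝 0) := by
    have h1 : Tendsto (fun s : ℝ => 2 * Q * Real.exp (3 / 4 * s)) atBot (𝓝 (2 * Q * 0)) :=
      (Real.tendsto_exp_atBot.comp
        (tendsto_id.const_mul_atBot (by norm_num : (0 : ℝ) < 3 / 4))).const_mul _
    rw [mul_zero] at h1
    refine squeeze_zero_norm' ?_ h1
    filter_upwards [eventually_le_atBot 0] with s hs
    have h2 := hQ |s| (abs_nonneg s)
    rw [Real.norm_eq_abs, abs_mul, abs_mul, abs_two, abs_of_pos (kern_pos s)]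
    calc |s| * (2 * kern s) ≤ (1 + |s|) ^ 1 * (2 * Real.exp (-|s|)) := by
          rw [pow_one]
          have := (kern_pos s).le
          refine mul_le_mul (by linarith) ?_ (by linarith) (by positivity)
          linarith [kern_le s]
      _ = 2 * ((1 + |s|) ^ 1 * Real.exp (-(1 / 4 * |s|)) * Real.exp (-(3 / 4 * |s|))) := by
          rw [mul_assoc ((1 + |s|) ^ 1), ← Real.exp_add, mul_left_comm]; congr 4; ring
      _ ≤ 2 * (Q * Real.exp (-(3 / 4 * |s|))) := by gcongr
      _ = 2 * Q * Real.exp (3 / 4 * s) := by rw [hneg s hs]; ring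
  have hp0 : Tendsto prof atBot (𝓝 (-1)) := by
    have h1 : Tendsto (fun s => 2 * Real.exp s) atBot (𝓝 (2 * 0)) :=
      Real.tendsto_exp_atBot.const_mul 2
    rw [mul_zero] at h1
    have h2 : Tendsto (fun s => prof s + 1) atBot (𝓝 0) :=
      squeeze_zero_norm (fun s => abs_prof_add_one_le) h1
    simpa using h2.sub_const 1
  have hL1 : Tendsto I1 atBot (𝓝 0) := by
    have := (hua.mul (hk0.const_mul 2)).sub (hua'.mul hp0)
    simpa using this
  have hL2 : Tendsto I2 atBot (𝓝 (-a)) := by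
    have := (hua.mul (hp0.add hsk0)).sub ((hsu'.mul hp0).sub (hua'.mul_const 2))
    simp only [mul_neg, mul_one, add_zero, zero_mul, neg_zero, sub_zero] at this
    refine this.congr fun s => ?_
    simp only [hI2]; ring
  have hA1 : ∀ s ≤ 0, |I1 s - 0| ≤ B1 * Real.exp (3 / 4 * s) := fun s hs =>
    abs_sub_le_of_deriv_exp_atBot (by norm_num) hd1
      (fun s hs => (hbd s _ (hg1 s)).trans_eq (by rw [hneg s hs])) hL1 hs
  have hA2 : ∀ s ≤ 0, |I2 s - (-a)| ≤ B1 * Real.exp (3 / 4 * s) := fun s hs =>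
    abs_sub_le_of_deriv_exp_atBot (by norm_num) hd2
      (fun s hs => (hbd s _ (hg2 s)).trans_eq (by rw [hneg s hs])) hL2 hs
  obtain ⟨J1, hJ1⟩ := exists_abs_sub_le_of_deriv_exp_atTop (b := 3 / 4) (B := B) (by norm_num) hd1
      (fun s hs => (hbd s _ (hg1 s)).trans_eq (by rw [hpos s hs]))
  obtain ⟨J2, hJ2⟩ := exists_abs_sub_le_of_deriv_exp_atTop (b := 3 / 4) (B := B) (by norm_num) hd2
      (fun s hs => (hbd s _ (hg2 s)).trans_eq (by rw [hpos s hs]))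
  rw [← hB1] at hJ1 hJ2
  -- the expansion at `+∞`
  set R : ℝ → ℝ := fun s => prof s * (I2 s - J2) + (prof s - 1) * J2 - s * prof s * (I1 s - J1)
    - s * (prof s - 1) * J1 + 2 * (I1 s - J1) with hR
  have hRu : ∀ s, u s - c * s = R s + ((J2 + 2 * J1) - (J1 + c) * s) := fun s => by
    rw [hrep s]; simp only [hR]; ring
  have hQ' : ∀ s, 0 ≤ s → (1 + s) * Real.exp (-(3 / 4 * s)) ≤ Q * Real.exp (-(s / 2)) :=
    fun s hs => by
    have h1 := hQ s hs
    rw [pow_one] at h1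
    calc (1 + s) * Real.exp (-(3 / 4 * s))
        = (1 + s) * Real.exp (-(1 / 4 * s)) * Real.exp (-(s / 2)) := by
          rw [mul_assoc, ← Real.exp_add]; congr 2; ring
      _ ≤ Q * Real.exp (-(s / 2)) := by gcongr
  have hRb : ∀ s, 0 ≤ s →
      |R s| ≤ (3 * B1 + 2 * |J1| + 2 * |J2|) * Q * Real.exp (-(s / 2)) := fun s hs => by
    have e1 : Real.exp (-s) ≤ Real.exp (-(3 / 4 * s)) := Real.exp_le_exp.2 (by linarith)
    have hp1 := (abs_prof_sub_one_le (σ := s)).trans (mul_le_mul_of_nonneg_left e1 zero_le_two)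
    have hp := abs_prof_le s
    have hj1 := hJ1 s hs
    have hj2 := hJ2 s hs
    set X := Real.exp (-(3 / 4 * s)) with hX
    have hX0 : 0 < X := Real.exp_pos _
    have t1 : |prof s * (I2 s - J2)| ≤ 1 * (B1 * X) := by rw [abs_mul]; gcongr
    have t2 : |(prof s - 1) * J2| ≤ 2 * X * |J2| := by rw [abs_mul]; gcongr
    have t3 : |s * prof s * (I1 s - J1)| ≤ s * 1 * (B1 * X) := by
      rw [abs_mul, abs_mul, abs_of_nonneg hs]; gcongr
    have t4 : |s * (prof s - 1) * J1| ≤ s * (2 * X) * |J1| := by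
      rw [abs_mul, abs_mul, abs_of_nonneg hs]; gcongr
    have t5 : |2 * (I1 s - J1)| ≤ 2 * (B1 * X) := by rw [abs_mul, abs_two]; gcongr
    have t : |R s| ≤ 1 * (B1 * X) + 2 * X * |J2| + s * 1 * (B1 * X) + s * (2 * X) * |J1|
        + 2 * (B1 * X) := by
      simp only [hR]
      rw [abs_le] at *
      constructor <;> linarith [t1.1, t1.2, t2.1, t2.2, t3.1, t3.2, t4.1, t4.2, t5.1, t5.2]
    calc |R s| ≤ _ := t
      _ ≤ (3 * B1 + 2 * |J1| + 2 * |J2|) * ((1 + s) * X) := by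
        have h1 := mul_nonneg (mul_nonneg hs hX0.le) (abs_nonneg J2)
        have h2 := mul_nonneg (mul_nonneg hs hX0.le) hB10
        have h3 := mul_nonneg hX0.le (abs_nonneg J1)
        linarith
      _ ≤ (3 * B1 + 2 * |J1| + 2 * |J2|) * (Q * Real.exp (-(s / 2))) := by
        exact mul_le_mul_of_nonneg_left (hQ' s hs) (by positivity)
      _ = _ := by ring
  have hexp0 : Tendsto (fun s : ℝ => Real.exp (-(s / 2))) atTop (𝓝 0) :=
    Real.tendsto_exp_neg_atTop_nhds_zero.comp (tendsto_id.atTop_div_const two_pos)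
  have hR0 : Tendsto R atTop (𝓝 0) := by
    have h1 := hexp0.const_mul ((3 * B1 + 2 * |J1| + 2 * |J2|) * Q)
    rw [mul_zero] at h1
    refine squeeze_zero_norm' ?_ h1
    filter_upwards [eventually_ge_atTop 0] with s hs using hRb s hs
  -- The prescribed behaviour at `+∞` allows no constant term, so both coefficients of the affine
  -- part vanish. This fixes `c = -J1` and ties `J2` to `J1`.
  obtain ⟨hc, hJ⟩ : J1 + c = 0 ∧ J2 + 2 * J1 = 0 := by
    apply eq_zero_of_tendsto_affine
    have h1 := huc.sub hR0
    rw [sub_zero] at h1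
    exact h1.congr fun s => by rw [hRu s]; ring
  -- bounds for the constants
  have z1 := hA1 0 le_rfl
  have z2 := hA2 0 le_rfl
  have z3 := hJ1 0 le_rfl
  have z4 := hJ2 0 le_rfl
  simp only [mul_zero, neg_zero, Real.exp_zero, mul_one, sub_zero] at z1 z2 z3 z4
  have b1 : |J1| ≤ 2 * B1 := by
    rw [abs_le] at *; constructor <;> linarith [z1.1, z1.2, z3.1, z3.2]
  have b2 : |J2| ≤ 4 * B1 := by
    rw [abs_le] at *; constructor <;> linarith [b1.1, b1.2]
  have b3 : |a| ≤ 6 * B1 := by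
    rw [abs_le] at *; constructor <;> linarith [b2.1, b2.2, z2.1, z2.2, z4.1, z4.2]
  have b4 : |c| ≤ 2 * B1 := by
    rw [abs_le] at *; constructor <;> linarith [b1.1, b1.2]
  have hBQ : 0 ≤ B1 * Q := by positivity
  refine ⟨by linarith, by linarith, fun s hs => ?_, fun s hs => ?_⟩
  · have e1 : Real.exp s ≤ Real.exp (3 / 4 * s) := Real.exp_le_exp.2 (by linarith)
    have hp1 := (abs_prof_add_one_le (σ := s)).trans (mul_le_mul_of_nonneg_left e1 zero_le_two)
    have hp := abs_prof_le s
    have hj1 := hA1 s hs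
    have hj2 := hA2 s hs
    have hq := hQ' (-s) (by linarith)
    rw [mul_neg, neg_neg, neg_div, neg_neg] at hq
    have hg := hsp s
    rw [abs_of_nonpos hs] at hg
    rw [sub_zero] at hj1
    set X := Real.exp (3 / 4 * s) with hX
    have hX0 : 0 < X := Real.exp_pos _
    have t1 : |prof s * (I2 s - (-a))| ≤ 1 * (B1 * X) := by rw [abs_mul]; gcongr
    have t2 : |(prof s + 1) * a| ≤ 2 * X * (6 * B1) := by rw [abs_mul]; gcongr
    have t3 : |(s * prof s - 2) * I1 s| ≤ (2 + -s) * (B1 * X) := by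
      rw [abs_mul]; exact mul_le_mul hg hj1 (abs_nonneg _) (by linarith)
    have t : |u s - a| ≤ 1 * (B1 * X) + 2 * X * (6 * B1) + (2 + -s) * (B1 * X) := by
      have : u s - a = prof s * (I2 s - (-a)) - (prof s + 1) * a - (s * prof s - 2) * I1 s := by
        rw [hrep s]; ring
      rw [this]
      rw [abs_le] at *
      constructor <;> linarith [t1.1, t1.2, t2.1, t2.2, t3.1, t3.2]
    calc |u s - a| ≤ _ := t
      _ ≤ 15 * B1 * ((1 + -s) * X) := by
        have h2 := mul_nonneg (mul_nonneg (neg_nonneg.2 hs) hX0.le) hB10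
        linarith
      _ ≤ 15 * B1 * (Q * Real.exp (s / 2)) := by gcongr
      _ = 15 * B1 * Q * Real.exp (s / 2) := by ring
      _ ≤ _ := by gcongr; linarith
  · rw [hRu s, hc, hJ, zero_mul, sub_zero, add_zero]
    refine (hRb s hs).trans ?_
    gcongr
    calc (3 * B1 + 2 * |J1| + 2 * |J2|) * Q ≤ (3 * B1 + 2 * (2 * B1) + 2 * (4 * B1)) * Q := by
          gcongr
      _ ≤ _ := by linarith

/-! ### Uniform bounds for the correction profiles -/

/-- The first basis vector of the plane. -/
def unitVec : Plane := EuclideanSpace.single 0 1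

lemma norm_unitVec : ‖unitVec‖ = 1 := by simp [unitVec]

lemma norm_exp_smul_unitVec (s : ℝ) : ‖Real.exp s • unitVec‖ = Real.exp s := by
  rw [norm_smul, norm_unitVec, mul_one, Real.norm_eq_abs, abs_of_pos (Real.exp_pos s)]

lemma norm_rpow_eq_exp {y : Plane} (hy : y ≠ 0) (α : ℝ) :
    ‖y‖ ^ α = Real.exp (α * Real.log ‖y‖) := by
  rw [Real.rpow_def_of_pos (norm_pos_iff.2 hy), mul_comm]

lemma norm_sq_eq_exp {y : Plane} (hy : y ≠ 0) : ‖y‖ ^ 2 = Real.exp (2 * Real.log ‖y‖) := by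
  rw [← norm_rpow_eq_exp hy, Real.rpow_two]

lemma bubbleOne_eq {α : ℝ} (hα : 0 < α) {y : Plane} (hy : y ≠ 0) :
    bubbleOne α y = Real.log (2 * α ^ 2) -
      2 * Real.log (1 + Real.exp (α * Real.log ‖y‖)) := by
  unfold bubbleOne
  rw [norm_rpow_eq_exp hy, Real.log_div (by positivity) (by positivity), Real.log_pow]
  norm_num

/-- This makes the leading term of `(1 + 𝒱/p)^p` equal to the mass in the equation of the bubble. -/
lemma exp_bigV {α : ℝ} {y : Plane} (hy : y ≠ 0) : Real.exp (bigV α y) = mass α y := by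
  unfold bigV mass
  rw [norm_rpow_eq_exp hy, Real.exp_add, mul_comm]

lemma norm_sq_mul_mass {α : ℝ} (hα : 0 < α) {y : Plane} (hy : y ≠ 0) :
    ‖y‖ ^ 2 * mass α y = 2 * α ^ 2 * kern (α * Real.log ‖y‖) := by
  unfold mass bubbleOne kern
  rw [norm_sq_eq_exp hy, norm_rpow_eq_exp hy, norm_rpow_eq_exp hy, Real.exp_log (by positivity),
    ← mul_assoc, ← Real.exp_add]
  rw [show 2 * Real.log ‖y‖ + (α - 2) * Real.log ‖y‖ = α * Real.log ‖y‖ by ring]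
  ring

lemma IsCorrection.lap_eq {α c : ℝ} {f w : Plane → ℝ} (h : IsCorrection α f w c) (y : Plane) :
    lap w y = mass α y * (f y - w y) := by linarith [h.eq y]

lemma tendsto_exp_smul_atBot {α : ℝ} (hα : 0 < α) :
    Tendsto (fun s : ℝ => Real.exp (s / α) • unitVec) atBot (𝓝 0) := by
  have : Tendsto (fun s : ℝ => Real.exp (s / α)) atBot (𝓝 0) :=
    Real.tendsto_exp_atBot.comp (tendsto_id.atBot_div_const hα)
  simpa using this.smul_const unitVec

/-- The constant comes from `linearised_bounds` applied to `w` along a ray with `σ = α ln ‖y‖`.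
Regularity at the origin supplies the conditions at `-∞`, and `2 ≤ α` turns the rates `exp (σ/2)`
near `0` and `exp (-σ/2)` near infinity into at most `‖y‖` and `‖y‖⁻¹`. -/
lemma IsCorrection.bounds (n : ℕ) (K : ℝ) {N : ℝ} (hN : 0 ≤ N) : ∃ M, 0 < M ∧
    ∀ (α c : ℝ) (f w : Plane → ℝ), 2 ≤ α → α ≤ K → IsCorrection α f w c →
      (∀ y, y ≠ 0 → |f y| ≤ N * (1 + |Real.log ‖y‖|) ^ n) →
      |c| ≤ M ∧ |w 0| ≤ M ∧ (∀ y, y ≠ 0 → ‖y‖ ≤ 1 → |w y - w 0| ≤ M * ‖y‖) ∧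
        ∀ y, 1 ≤ ‖y‖ → |w y - c * Real.log ‖y‖| ≤ M * ‖y‖⁻¹ := by
  obtain ⟨M, hM0, hM⟩ := linearised_bounds n hN
  refine ⟨M * (1 + |K|), by positivity, ?_⟩
  intro α c f w hα hαK hw hf
  have hα0 : 0 < α := by linarith
  set pt : ℝ → Plane := fun s => Real.exp (s / α) • unitVec with hpt
  have hpt0 : ∀ s, pt s ≠ 0 := fun s => by
    rw [← norm_pos_iff, hpt]; simp only; rw [norm_exp_smul_unitVec]; exact Real.exp_pos _
  have hlog : ∀ s, Real.log ‖pt s‖ = s / α := fun s => by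
    rw [hpt]; simp only; rw [norm_exp_smul_unitVec, Real.log_exp]
  set G : ℝ → ℝ := fun s => fderiv ℝ w (Real.exp s • unitVec) (Real.exp s • unitVec) with hG
  have hdiv : ∀ s : ℝ, HasDerivAt (fun s : ℝ => s / α) (1 / α) s := fun s =>
    (hasDerivAt_id s).div_const α
  have hd1 : ∀ s, HasDerivAt (fun s => w (pt s)) (G (s / α) * (1 / α)) s := fun s =>
    (hasDerivAt_comp_exp_smul (hw.contDiff.contDiffAt.differentiableAt (by norm_num))).comp s
      (hdiv s)
  have hd2 : ∀ s, HasDerivAt (fun s => G (s / α) * (1 / α))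
      (2 * kern s * (f (pt s) - w (pt s))) s := fun s => by
    refine (((hasDerivAt_radial hw.radial hw.contDiff.contDiffAt).comp s (hdiv s)).mul_const
      (1 / α)).congr_deriv ?_
    have h1 := norm_sq_mul_mass hα0 (hpt0 s)
    rw [hlog, mul_div_cancel₀ _ hα0.ne'] at h1
    change ‖pt s‖ ^ 2 * lap w (pt s) * (1 / α) * (1 / α) = _
    rw [hw.lap_eq, ← mul_assoc, h1]
    field_simp
  have hGeq : ∀ s, G s = Real.exp s * fderiv ℝ w (Real.exp s • unitVec) unitVec := fun s => by
    simp only [hG]; rw [map_smul, smul_eq_mul]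
  have hfd : Tendsto (fun s => fderiv ℝ w (pt s) unitVec) atBot (𝓝 (fderiv ℝ w 0 unitVec)) := by
    have h1 : Continuous fun y => fderiv ℝ w y unitVec :=
      (hw.contDiff.continuous_fderiv (by norm_num)).clm_apply continuous_const
    exact (h1.tendsto 0).comp (tendsto_exp_smul_atBot hα0)
  have he : Tendsto (fun s : ℝ => Real.exp (s / α)) atBot (𝓝 0) :=
    Real.tendsto_exp_atBot.comp (tendsto_id.atBot_div_const hα0)
  have hse : Tendsto (fun s : ℝ => s * Real.exp (s / α)) atBot (𝓝 0) := by
    have h1 := (Real.tendsto_pow_mul_exp_neg_atTop_nhds_zero 1).comp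
      (tendsto_neg_atBot_atTop.comp (tendsto_id.atBot_div_const hα0))
    have h2 := h1.const_mul (-α)
    rw [mul_zero] at h2
    refine h2.congr fun s => ?_
    simp only [Function.comp, id, pow_one, neg_neg]
    field_simp
  obtain ⟨b1, b2, b3, b4⟩ := hM (fun s => f (pt s)) (fun s => w (pt s))
    (fun s => G (s / α) * (1 / α)) (c / α) (w 0)
    (fun s => by
      refine (hf _ (hpt0 s)).trans ?_
      rw [hlog, abs_div, abs_of_pos hα0]
      have : |s| / α ≤ |s| := div_le_self (abs_nonneg s) (by linarith)
      gcongr)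
    hd1 hd2
    ((hw.contDiff.continuous.tendsto 0).comp (tendsto_exp_smul_atBot hα0))
    (by
      have := (he.mul hfd).mul_const (1 / α)
      rw [zero_mul, zero_mul] at this
      exact this.congr fun s => by rw [hGeq])
    (by
      have := (hse.mul hfd).mul_const (1 / α)
      rw [zero_mul, zero_mul] at this
      exact this.congr fun s => by rw [hGeq]; ring)
    (by
      have hcob : Tendsto pt atTop (Bornology.cobounded Plane) := by
        rw [← tendsto_norm_atTop_iff_cobounded]
        have : Tendsto (fun s : ℝ => Real.exp (s / α)) atTop atTop :=
          Real.tendsto_exp_atTop.comp (tendsto_id.atTop_div_const hα0)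
        exact this.congr fun s => (norm_exp_smul_unitVec _).symm
      have h1 := hw.asymp.comp_tendsto hcob
      have h2 : Tendsto ((fun y : Plane => ‖y‖⁻¹) ∘ pt) atTop (𝓝 0) :=
        tendsto_inv_atTop_zero.comp (tendsto_norm_cobounded_atTop.comp hcob)
      refine (h1.trans_tendsto h2).congr fun s => ?_
      simp only [Function.comp]
      rw [hlog]; ring)
  have hKK : K ≤ |K| := le_abs_self K
  have hMK : M ≤ M * (1 + |K|) := by
    have := mul_nonneg hM0.le (abs_nonneg K); linarith
  have hwy : ∀ y, y ≠ 0 → w y = w (pt (α * Real.log ‖y‖)) := fun y hy => by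
    apply hw.radial
    rw [hpt]; simp only
    rw [norm_exp_smul_unitVec, mul_div_cancel_left₀ _ hα0.ne', Real.exp_log (norm_pos_iff.2 hy)]
  have hlogc : ∀ y : Plane, c * Real.log ‖y‖ = c / α * (α * Real.log ‖y‖) := fun y => by
    field_simp
  refine ⟨?_, b2.trans hMK, fun y hy hy1 => ?_, fun y hy => ?_⟩
  · rw [abs_div, abs_of_pos hα0, div_le_iff₀ hα0] at b1
    refine b1.trans ?_
    gcongr; linarith
  · have hl : Real.log ‖y‖ ≤ 0 := Real.log_nonpos (norm_nonneg y) hy1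
    have h1 := b3 (α * Real.log ‖y‖) (mul_nonpos_of_nonneg_of_nonpos hα0.le hl)
    rw [hwy y hy]
    refine h1.trans ?_
    have h2 : Real.exp (α * Real.log ‖y‖ / 2) ≤ ‖y‖ := by
      conv_rhs => rw [← Real.exp_log (norm_pos_iff.2 hy)]
      exact Real.exp_le_exp.2 (by nlinarith)
    gcongr
  · have hy0 : y ≠ 0 := norm_pos_iff.1 (by linarith)
    have hl : 0 ≤ Real.log ‖y‖ := Real.log_nonneg hy
    have h1 := b4 (α * Real.log ‖y‖) (mul_nonneg hα0.le hl)
    rw [hwy y hy0, hlogc]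
    refine h1.trans ?_
    have h2 : Real.exp (-(α * Real.log ‖y‖ / 2)) ≤ ‖y‖⁻¹ := by
      rw [← Real.exp_log (inv_pos.2 (norm_pos_iff.2 hy0)), Real.log_inv]
      exact Real.exp_le_exp.2 (by nlinarith)
    gcongr

/-! ### Growth of `𝒱_α` and of the right-hand sides, uniformly in `α` -/

lemma abs_log_one_add_exp_le (t : ℝ) : |Real.log (1 + Real.exp t)| ≤ Real.log 2 + max t 0 := by
  have h0 := Real.exp_pos t
  rw [abs_of_nonneg (Real.log_nonneg (by linarith))]
  have h1 : 1 + Real.exp t ≤ 2 * Real.exp (max t 0) := by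
    have h2 : Real.exp t ≤ Real.exp (max t 0) := Real.exp_le_exp.2 (le_max_left _ _)
    have h3 : 1 ≤ Real.exp (max t 0) := Real.one_le_exp (le_max_right _ _)
    linarith
  calc Real.log (1 + Real.exp t) ≤ Real.log (2 * Real.exp (max t 0)) :=
        Real.log_le_log (by linarith) h1
    _ = _ := by rw [Real.log_mul (by norm_num) (Real.exp_ne_zero _), Real.log_exp]

/-- `𝒱_α` grows at most logarithmically. -/
lemma abs_bigV_le {α K : ℝ} (hα : 2 ≤ α) (hαK : α ≤ K) {y : Plane} (hy : y ≠ 0) :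
    |bigV α y| ≤ Real.log (2 * K ^ 2) + 2 + 2 * α * max (Real.log ‖y‖) 0 +
      (α - 2) * |Real.log ‖y‖| := by
  unfold bigV
  rw [bubbleOne_eq (by linarith) hy]
  have h1 := abs_log_one_add_exp_le (α * Real.log ‖y‖)
  have h2 : max (α * Real.log ‖y‖) 0 = α * max (Real.log ‖y‖) 0 := by
    rw [mul_max_of_nonneg _ _ (by linarith), mul_zero]
  rw [h2] at h1
  have h3 : |Real.log (2 * α ^ 2)| ≤ Real.log (2 * K ^ 2) := by
    rw [abs_of_nonneg (Real.log_nonneg (by nlinarith))]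
    apply Real.log_le_log (by positivity)
    gcongr
  have h4 := Real.log_two_lt_d9
  have h5 : |(α - 2) * Real.log ‖y‖| = (α - 2) * |Real.log ‖y‖| := by
    rw [abs_mul, abs_of_nonneg (by linarith)]
  have e1 := abs_le.1 h1
  have e2 := abs_le.1 h3
  have e3 := abs_le.1 h5.le
  rw [abs_le]
  constructor <;> linarith [e1.1, e1.2, e2.1, e2.2, e3.1, e3.2]

lemma abs_bigV_le_log {α K : ℝ} (hα : 2 ≤ α) (hαK : α ≤ K) {y : Plane} (hy : y ≠ 0) :
    |bigV α y| ≤ (Real.log (2 * K ^ 2) + 2 + 3 * K) * (1 + |Real.log ‖y‖|) := by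
  have h1 := abs_bigV_le hα hαK hy
  have h2 : max (Real.log ‖y‖) 0 ≤ |Real.log ‖y‖| := max_le (le_abs_self _) (abs_nonneg _)
  have h0 : 0 ≤ Real.log (2 * K ^ 2) := Real.log_nonneg (by nlinarith)
  have h3 := abs_nonneg (Real.log ‖y‖)
  set l := |Real.log ‖y‖|
  have hK : 0 ≤ K := by linarith
  have : 2 * α * max (Real.log ‖y‖) 0 ≤ 2 * K * l := by gcongr
  have : (α - 2) * l ≤ K * l := by gcongr; linarith
  nlinarith [mul_nonneg h0 h3]

lemma abs_phi0_le (v : ℝ) : |phi0 v| ≤ |v| ^ 2 := by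
  unfold phi0
  rw [abs_of_nonneg (by positivity), sq_abs]
  nlinarith [sq_nonneg v]

lemma abs_phi1_le {v w B : ℝ} (hB : 1 ≤ B) (hv : |v| ≤ B) (hw : |w| ≤ B) :
    |phi1 v w| ≤ 4 * B ^ 4 := by
  have hB0 : 0 ≤ B := by linarith
  have t1 : |v * w| ≤ B * B := by rw [abs_mul]; gcongr
  have t2 : |v ^ 3| ≤ B ^ 3 := by rw [abs_pow]; gcongr
  have t3 : |w ^ 2| ≤ B ^ 2 := by rw [abs_pow]; gcongr
  have t4 : |v ^ 4| ≤ B ^ 4 := by rw [abs_pow]; gcongr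
  have t5 : |v ^ 2 * w| ≤ B ^ 2 * B := by rw [abs_mul, abs_pow]; gcongr
  have p2 : B ^ 2 ≤ B ^ 4 := pow_le_pow_right₀ hB (by norm_num)
  have p3 : B ^ 3 ≤ B ^ 4 := pow_le_pow_right₀ hB (by norm_num)
  have p4 : 0 ≤ B ^ 4 := by positivity
  have e1 : B * B = B ^ 2 := by ring
  have e2 : B ^ 2 * B = B ^ 3 := by ring
  rw [e1] at t1
  rw [e2] at t5
  unfold phi1
  rw [abs_le] at *
  constructor <;> linarith [t1.1, t1.2, t2.1, t2.2, t3.1, t3.2, t4.1, t4.2, t5.1, t5.2]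

/-- The estimates that both correction profiles satisfy, with a common constant. -/
structure ProfileBounds (M : ℝ) (w : Plane → ℝ) (c : ℝ) : Prop where
  rate : |c| ≤ M
  zero : |w 0| ≤ M
  near : ∀ y, y ≠ 0 → ‖y‖ ≤ 1 → |w y - w 0| ≤ M * ‖y‖
  far : ∀ y, 1 ≤ ‖y‖ → |w y - c * Real.log ‖y‖| ≤ M * ‖y‖⁻¹

lemma ProfileBounds.mono {M M' : ℝ} {w : Plane → ℝ} {c : ℝ} (h : ProfileBounds M w c)
    (hM : M ≤ M') : ProfileBounds M' w c where
  rate := h.rate.trans hM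
  zero := h.zero.trans hM
  near y hy hy1 := (h.near y hy hy1).trans (by gcongr)
  far y hy := (h.far y hy).trans (by gcongr)

lemma ProfileBounds.abs_le {M : ℝ} {w : Plane → ℝ} {c : ℝ} (h : ProfileBounds M w c)
    {y : Plane} (hy : y ≠ 0) : |w y| ≤ 2 * M * (1 + max (Real.log ‖y‖) 0) := by
  have hM : 0 ≤ M := (abs_nonneg _).trans h.rate
  rcases le_total ‖y‖ 1 with hy1 | hy1
  · have h1 := h.near y hy hy1
    have h2 := h.zero
    have h3 : M * ‖y‖ ≤ M * 1 := by gcongr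
    have h4 : 0 ≤ M * max (Real.log ‖y‖) 0 := by positivity
    have h5 := abs_sub_abs_le_abs_sub (w y) (w 0)
    linarith
  · have h1 := h.far y hy1
    have hl : 0 ≤ Real.log ‖y‖ := Real.log_nonneg hy1
    have h3 : M * ‖y‖⁻¹ ≤ M * 1 := by gcongr; exact inv_le_one_of_one_le₀ hy1
    have h4 : |c * Real.log ‖y‖| ≤ M * Real.log ‖y‖ := by
      rw [abs_mul, abs_of_nonneg hl]; gcongr; exact h.rate
    have h5 := abs_sub_abs_le_abs_sub (w y) (c * Real.log ‖y‖)
    rw [max_eq_left hl]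
    have := mul_nonneg hM hl
    linarith

/-- A bootstrap: `φ⁰(𝒱)` grows like the square of the logarithm, which bounds `w⁰`; then `𝒱` and
`w⁰` both grow at most logarithmically and `φ¹` has degree four, which bounds `w¹`. -/
lemma exists_profileBounds (K : ℝ) : ∃ M, 1 ≤ M ∧ ∀ (α c0 c1 : ℝ) (w0 w1 : Plane → ℝ),
    2 ≤ α → α ≤ K → IsCorrection α (fun y => phi0 (bigV α y)) w0 c0 →
    IsCorrection α (fun y => phi1 (bigV α y) (w0 y)) w1 c1 →
    ProfileBounds M w0 c0 ∧ ProfileBounds M w1 c1 := by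
  -- For `K < 2` no `α` is admissible and the claim is vacuous.
  rcases lt_or_ge K 2 with hK | hK
  · exact ⟨1, le_rfl, fun α _ _ _ _ h1 h2 => by linarith⟩
  set A := Real.log (2 * K ^ 2) + 2 + 3 * K with hA
  have hA0 : 1 ≤ A := by
    have : 0 ≤ Real.log (2 * K ^ 2) := Real.log_nonneg (by nlinarith)
    linarith
  obtain ⟨M0, hM0, h0⟩ := IsCorrection.bounds 2 K (N := A ^ 2) (by positivity)
  obtain ⟨M1, hM1, h1⟩ := IsCorrection.bounds 4 K (N := 4 * (A + 2 * M0) ^ 4) (by positivity)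
  refine ⟨max (max M0 M1) 1, le_max_right _ _, fun α c0 c1 w0 w1 hα hαK hw0 hw1 => ?_⟩
  have hp0 : ProfileBounds M0 w0 c0 := by
    obtain ⟨b1, b2, b3, b4⟩ := h0 α c0 _ w0 hα hαK hw0 fun y hy => by
      refine (abs_phi0_le _).trans ?_
      rw [← mul_pow]
      exact pow_le_pow_left₀ (abs_nonneg _) (abs_bigV_le_log hα hαK hy) 2
    exact ⟨b1, b2, b3, b4⟩
  have hp1 : ProfileBounds M1 w1 c1 := by
    obtain ⟨b1, b2, b3, b4⟩ := h1 α c1 _ w1 hα hαK hw1 fun y hy => by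
      have hl := abs_nonneg (Real.log ‖y‖)
      have e1 := abs_bigV_le_log hα hαK hy
      have e2 := hp0.abs_le hy
      have e3 : max (Real.log ‖y‖) 0 ≤ |Real.log ‖y‖| := max_le (le_abs_self _) hl
      have e4 : 2 * M0 * (1 + max (Real.log ‖y‖) 0) ≤ 2 * M0 * (1 + |Real.log ‖y‖|) := by gcongr
      rw [← hA] at e1
      rw [mul_assoc, ← mul_pow]
      have e5 : 0 ≤ A * |Real.log ‖y‖| := by positivity
      have e6 : 0 ≤ M0 * |Real.log ‖y‖| := by positivity
      exact abs_phi1_le (by linarith) (by linarith) (by linarith)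
    exact ⟨b1, b2, b3, b4⟩
  exact ⟨hp0.mono ((le_max_left _ _).trans (le_max_left _ _)),
    hp1.mono ((le_max_right _ _).trans (le_max_left _ _))⟩

/-! ### The corrected bubbles and their projections -/

lemma log_norm_inv_smul {δ : ℝ} (hδ : 0 < δ) {x : Plane} (hx : x ≠ 0) :
    Real.log ‖δ⁻¹ • x‖ = Real.log ‖x‖ - Real.log δ := by
  rw [norm_smul, norm_inv, Real.norm_eq_abs, abs_of_pos hδ,
    Real.log_mul (inv_ne_zero hδ.ne') (norm_ne_zero_iff.2 hx), Real.log_inv]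
  ring

lemma bubble_eq {α δ : ℝ} (hα : 0 < α) (hδ : 0 < δ) {x : Plane} (hx : x ≠ 0) :
    bubble α δ x = Real.log (2 * α ^ 2) - α * Real.log δ -
      2 * Real.log (1 + Real.exp (α * (Real.log ‖x‖ - Real.log δ))) := by
  have h1 : δ ^ α + ‖x‖ ^ α =
      Real.exp (α * Real.log δ) * (1 + Real.exp (α * (Real.log ‖x‖ - Real.log δ))) := by
    rw [norm_rpow_eq_exp hx, Real.rpow_def_of_pos hδ, mul_add, ← Real.exp_add, mul_comm α]
    ring_nf
  unfold bubble
  have h2 : Real.log (Real.exp (α * Real.log δ) *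
      (1 + Real.exp (α * (Real.log ‖x‖ - Real.log δ)))) = α * Real.log δ +
      Real.log (1 + Real.exp (α * (Real.log ‖x‖ - Real.log δ))) := by
    rw [Real.log_mul (by positivity) (by positivity), Real.log_exp]
  rw [h1, Real.log_div (by positivity) (by positivity),
    Real.log_mul (by positivity) (by positivity), Real.log_rpow hδ, Real.log_pow, h2]
  push_cast
  ring

lemma continuous_bubble {α δ : ℝ} (hα : 0 < α) (hδ : 0 < δ) : Continuous (bubble α δ) := by
  have hpos : ∀ x : Plane, 0 < δ ^ α + ‖x‖ ^ α := fun x => by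
    have := Real.rpow_pos_of_pos hδ α
    positivity
  have h1 : Continuous fun x : Plane => δ ^ α + ‖x‖ ^ α :=
    continuous_const.add (continuous_norm.rpow_const fun _ => Or.inr hα.le)
  exact (continuous_const.div (h1.pow 2) fun x => pow_ne_zero 2 (hpos x).ne').log fun x =>
    (div_pos (by have := Real.rpow_pos_of_pos hδ α; positivity) (pow_pos (hpos x) 2)).ne'

lemma contDiffAt_bubble {α δ : ℝ} (hα : 0 < α) (hδ : 0 < δ) {x : Plane} (hx : x ≠ 0) :
    ContDiffAt ℝ 2 (bubble α δ) x := by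
  have hδα := Real.rpow_pos_of_pos hδ α
  have hpos : 0 < δ ^ α + ‖x‖ ^ α := by positivity
  have h1 : ContDiffAt ℝ 2 (fun x : Plane => δ ^ α + ‖x‖ ^ α) x :=
    contDiffAt_const.add ((contDiffAt_norm ℝ hx).rpow_const_of_ne (norm_ne_zero_iff.2 hx))
  exact (contDiffAt_const.div (h1.pow 2) (pow_ne_zero 2 hpos.ne')).log
    (div_pos (by positivity) (pow_pos hpos 2)).ne'

lemma norm_sq_mul_lap_bubble {α δ : ℝ} (hα : 0 < α) (hδ : 0 < δ) {x : Plane} (hx : x ≠ 0) :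
    ‖x‖ ^ 2 * lap (bubble α δ) x =
      -(2 * α ^ 2 * kern (α * (Real.log ‖x‖ - Real.log δ))) := by
  set l := Real.log ‖x‖ - Real.log δ with hl
  have hlin : ∀ s : ℝ, HasDerivAt (fun s => α * (s + l)) α s := fun s => by
    refine (((hasDerivAt_id s).add_const l).const_mul α).congr_deriv (by simp)
  refine lap_of_hasDerivAt (fun a b h => by simp [bubble, h]) (contDiffAt_bubble hα hδ hx)
    (φ := fun s => Real.log (2 * α ^ 2) - α * Real.log δ -
      2 * Real.log (1 + Real.exp (α * (s + l))))
    (φ' := fun s => -(2 * ((1 - 1 / (1 + Real.exp (α * (s + l)))) * α))) (fun s => ?_)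
    (fun s => ?_) ?_
  · have : Real.exp s • x ≠ 0 := smul_ne_zero (Real.exp_ne_zero s) hx
    rw [bubble_eq hα hδ this, log_norm_exp_smul hx, hl]
    ring_nf
  · exact (((hasDerivAt_log_one_add_exp (α * (s + l))).comp s (hlin s)).const_mul 2).const_sub _
  · refine (((((hasDerivAt_inv_one_add_exp (α * (0 + l))).comp 0 (hlin 0)).const_sub 1).mul_const
      α).const_mul 2).neg.congr_deriv ?_
    rw [zero_add]
    ring

lemma norm_sq_mul_lap_rescaled {w : Plane → ℝ} (hw : ContDiff ℝ 2 w)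
    (hr : ∀ x y : Plane, ‖x‖ = ‖y‖ → w x = w y) (b : ℝ) (x : Plane) :
    ‖x‖ ^ 2 * lap (fun x => w (b • x)) x = ‖b • x‖ ^ 2 * lap w (b • x) := by
  refine lap_of_hasDerivAt (u := fun x => w (b • x))
    (fun a b h => hr _ _ (by rw [norm_smul, norm_smul, h]))
    (hw.comp (contDiff_const_smul b)).contDiffAt
    (φ := fun s => w (Real.exp s • (b • x)))
    (φ' := fun s => fderiv ℝ w (Real.exp s • (b • x)) (Real.exp s • (b • x)))
    (fun s => by rw [smul_comm]) (fun s => ?_) ?_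
  · exact hasDerivAt_comp_exp_smul (hw.contDiffAt.differentiableAt (by norm_num))
  · have := hasDerivAt_radial (s := 0) (e := b • x) hr hw.contDiffAt
    simpa using this

/-- `U_{α,δ} + w⁰(·/δ)/p + w¹(·/δ)/p²`. -/
def correctedBubble (α δ p : ℝ) (w0 w1 : Plane → ℝ) (x : Plane) : ℝ :=
  bubble α δ x + w0 (δ⁻¹ • x) / p + w1 (δ⁻¹ • x) / p ^ 2

/-- The factor by which the corrections change the Laplacian of a bubble. -/
def correctionFactor (p v w0 w1 : ℝ) : ℝ :=
  1 + (w0 - phi0 v) / p + (w1 - phi1 v w0) / p ^ 2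

section CorrectedBubble

variable {α δ p c0 c1 : ℝ} {w0 w1 : Plane → ℝ}

lemma contDiffAt_correctedBubble (hα : 0 < α) (hδ : 0 < δ) (hw0 : ContDiff ℝ 2 w0)
    (hw1 : ContDiff ℝ 2 w1) {x : Plane} (hx : x ≠ 0) :
    ContDiffAt ℝ 2 (correctedBubble α δ p w0 w1) x :=
  ((contDiffAt_bubble hα hδ hx).add
    ((hw0.comp (contDiff_const_smul δ⁻¹)).contDiffAt.div_const p)).add
    ((hw1.comp (contDiff_const_smul δ⁻¹)).contDiffAt.div_const (p ^ 2))

lemma continuous_correctedBubble (hα : 0 < α) (hδ : 0 < δ) (hw0 : Continuous w0)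
    (hw1 : Continuous w1) : Continuous (correctedBubble α δ p w0 w1) :=
  ((continuous_bubble hα hδ).add ((hw0.comp (continuous_const_smul δ⁻¹)).div_const p)).add
    ((hw1.comp (continuous_const_smul δ⁻¹)).div_const (p ^ 2))

/-- The bubble and both rescaled corrections have Laplacians with the common factor `2 α² kern /
‖x‖²`, so only the scalar `correctionFactor` distinguishes the corrected bubble from the bare one.
-/
lemma norm_sq_mul_lap_correctedBubble (hα : 0 < α) (hδ : 0 < δ)
    (hw0 : IsCorrection α (fun y => phi0 (bigV α y)) w0 c0)
    (hw1 : IsCorrection α (fun y => phi1 (bigV α y) (w0 y)) w1 c1) {x : Plane} (hx : x ≠ 0) :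
    ‖x‖ ^ 2 * lap (correctedBubble α δ p w0 w1) x =
      -(2 * α ^ 2 * kern (α * (Real.log ‖x‖ - Real.log δ)) *
        correctionFactor p (bigV α (δ⁻¹ • x)) (w0 (δ⁻¹ • x)) (w1 (δ⁻¹ • x))) := by
  have hy : δ⁻¹ • x ≠ 0 := smul_ne_zero (inv_ne_zero hδ.ne') hx
  have e0 : ContDiffAt ℝ 2 (fun x => w0 (δ⁻¹ • x)) x :=
    (hw0.contDiff.comp (contDiff_const_smul δ⁻¹)).contDiffAt
  have e1 : ContDiffAt ℝ 2 (fun x => w1 (δ⁻¹ • x)) x :=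
    (hw1.contDiff.comp (contDiff_const_smul δ⁻¹)).contDiffAt
  have hB := contDiffAt_bubble hα hδ hx
  have h1 : correctedBubble α δ p w0 w1 = fun x =>
      (bubble α δ x + p⁻¹ * w0 (δ⁻¹ • x)) + (p ^ 2)⁻¹ * w1 (δ⁻¹ • x) := by
    funext x; unfold correctedBubble; ring
  have hm := norm_sq_mul_mass hα hy
  have l0 := norm_sq_mul_lap_rescaled hw0.contDiff hw0.radial δ⁻¹ x
  have l1 := norm_sq_mul_lap_rescaled hw1.contDiff hw1.radial δ⁻¹ x
  rw [hw0.lap_eq, ← mul_assoc, hm, log_norm_inv_smul hδ hx] at l0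
  rw [hw1.lap_eq, ← mul_assoc, hm, log_norm_inv_smul hδ hx] at l1
  rw [h1, lap_add (hB.add (contDiffAt_const.mul e0)) (contDiffAt_const.mul e1),
    lap_add hB (contDiffAt_const.mul e0), lap_const_mul _ e0, lap_const_mul _ e1]
  have l2 := norm_sq_mul_lap_bubble hα hδ hx
  unfold correctionFactor
  linear_combination l2 + p⁻¹ * l0 + (p ^ 2)⁻¹ * l1

/-- Expansion of the projection of a corrected bubble. -/
lemma projection_expansion {Ω : Set Plane} (hO : IsOpen Ω) (hb : Bornology.IsBounded Ω)
    (h0 : (0 : Plane) ∈ Ω) {H : Plane → Plane → ℝ} (hH : IsGreenRegularPart Ω H)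
    {d M : ℝ} (hd : 0 < d) (hdΩ : ∀ x ∈ frontier Ω, d ≤ ‖x‖) (hα : 2 ≤ α) (hδ : 0 < δ)
    (hδd : δ ≤ d) (hp : 1 ≤ p)
    (hw0 : IsCorrection α (fun y => phi0 (bigV α y)) w0 c0)
    (hw1 : IsCorrection α (fun y => phi1 (bigV α y) (w0 y)) w1 c1)
    (hb0 : ProfileBounds M w0 c0) (hb1 : ProfileBounds M w1 c1) {v : Plane → ℝ}
    (hv : IsProjection Ω (correctedBubble α δ p w0 w1) v) {x : Plane} (hx : x ∈ Ω) (hx0 : x ≠ 0) :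
    |v x - (correctedBubble α δ p w0 w1 x - Real.log (2 * α ^ 2) - α * Real.log δ +
      (c0 / p + c1 / p ^ 2) * Real.log δ +
      2 * Real.pi * (2 * α - c0 / p - c1 / p ^ 2) * H x 0)| ≤ (2 + 2 * M) / d * δ := by
  have hα0 : 0 < α := by linarith
  have hM : 0 ≤ M := (abs_nonneg _).trans hb0.rate
  obtain ⟨hharm, hcont, hbdry⟩ := hH 0 h0
  set A := 2 * Real.pi * (2 * α - c0 / p - c1 / p ^ 2) with hA
  set b := -Real.log (2 * α ^ 2) - α * Real.log δ + (c0 / p + c1 / p ^ 2) * Real.log δ with hb'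
  set h : Plane → ℝ := fun x => H x 0
  set B := correctedBubble α δ p w0 w1 with hBdef
  have hBc : ∀ z : Plane, z ≠ 0 → ContDiffAt ℝ 2 B z := fun z hz =>
    contDiffAt_correctedBubble hα0 hδ hw0.contDiff hw1.contDiff hz
  have hvc : ∀ z ∈ Ω, ContDiffAt ℝ 2 v z := fun z hz => hv.contDiffOn.contDiffAt (hO.mem_nhds hz)
  -- The projection minus the bubble is harmonic off the origin, and so are `h` and constants. Only
  -- the boundary values have to be estimated, and working off the origin avoids the regularity of
  -- `‖x‖^α` there.
  have key := abs_le_of_harmonic_punctured hO hb (M := (2 + 2 * M) / d * δ)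
    (u := fun z => (v z + (-1) * B z) + ((-A) * h z + (-b))) ?_ ?_ ?_ ?_ hx hx0
  · refine le_trans (le_of_eq ?_) key
    congr 1
    simp only [hb', h]
    ring
  · exact (hv.continuousOn.add (continuousOn_const.mul
      (continuous_correctedBubble hα0 hδ hw0.contDiff.continuous
        hw1.contDiff.continuous).continuousOn)).add
      ((continuousOn_const.mul hcont).add continuousOn_const)
  · intro z hz hz0
    exact ((hvc z hz).add (contDiffAt_const.mul (hBc z hz0))).add
      ((contDiffAt_const.mul (hharm z hz).1).add contDiffAt_const)
  · intro z hz hz0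
    rw [lap_add ((hvc z hz).add (contDiffAt_const.mul (hBc z hz0)))
      ((contDiffAt_const.mul (hharm z hz).1).add contDiffAt_const),
      lap_add (hvc z hz) (contDiffAt_const.mul (hBc z hz0)),
      lap_add (contDiffAt_const.mul (hharm z hz).1) contDiffAt_const,
      lap_const_mul _ (hBc z hz0), lap_const_mul _ (hharm z hz).1, hv.lap_eq z hz]
    have h1 : lap h z = 0 := (hharm z hz).2.self_of_nhds
    have h2 : lap (fun _ : Plane => -b) z = 0 := by
      unfold lap; rw [InnerProductSpace.laplacian_const]; rfl
    rw [h1, h2]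
    ring
  · intro z hz
    have hdz := hdΩ z hz
    have hzpos : 0 < ‖z‖ := hd.trans_le hdz
    have hz0 : z ≠ 0 := norm_pos_iff.1 hzpos
    have hpi := Real.pi_pos
    -- On the frontier the Green function vanishes, so `H z 0 = log ‖z‖ / (2π)`; the coefficient `A`
    -- is chosen to cancel the logarithmic growth of the corrected bubble.
    have hHz : A * h z = (2 * α - c0 / p - c1 / p ^ 2) * Real.log ‖z‖ := by
      have := hbdry z hz
      unfold greenOf at this
      rw [sub_zero, one_div ‖z‖, Real.log_inv] at this
      have e : h z = 1 / (2 * Real.pi) * Real.log ‖z‖ := by simp only [h]; linarith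
      rw [e, hA]
      field_simp
    set l := Real.log ‖z‖ - Real.log δ with hl
    have hratio : ‖δ⁻¹ • z‖⁻¹ = δ / ‖z‖ := by
      rw [norm_smul, norm_inv, Real.norm_eq_abs, abs_of_pos hδ, mul_inv, inv_inv]
      rfl
    have hge : 1 ≤ ‖δ⁻¹ • z‖ := by
      rw [norm_smul, norm_inv, Real.norm_eq_abs, abs_of_pos hδ, inv_mul_eq_div,
        one_le_div hδ]
      exact hδd.trans hdz
    have hl0 : 0 ≤ l := by
      rw [hl, ← log_norm_inv_smul hδ hz0]; exact Real.log_nonneg hge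
    have hexpl : Real.exp (-l) = δ / ‖z‖ := by
      rw [← hratio, hl, ← log_norm_inv_smul hδ hz0, Real.exp_neg, Real.exp_log (by linarith)]
    have hδz : δ / ‖z‖ ≤ δ / d := by gcongr
    have hp2 : 1 ≤ p ^ 2 := one_le_pow₀ hp
    have t0 : |(w0 (δ⁻¹ • z) - c0 * l) / p| ≤ M * (δ / d) := by
      have := hb0.far _ hge
      rw [hratio, log_norm_inv_smul hδ hz0] at this
      rw [abs_div, abs_of_pos (by linarith : 0 < p)]
      exact (div_le_self (abs_nonneg _) hp).trans (this.trans (by gcongr))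
    have t1 : |(w1 (δ⁻¹ • z) - c1 * l) / p ^ 2| ≤ M * (δ / d) := by
      have := hb1.far _ hge
      rw [hratio, log_norm_inv_smul hδ hz0] at this
      rw [abs_div, abs_of_pos (by linarith : 0 < p ^ 2)]
      exact (div_le_self (abs_nonneg _) hp2).trans (this.trans (by gcongr))
    have t2 : |2 * (Real.log (1 + Real.exp (α * l)) - α * l)| ≤ 2 * (δ / d) := by
      have e1 : Real.log (1 + Real.exp (α * l)) - α * l = Real.log (1 + Real.exp (-(α * l))) := by
        have : 1 + Real.exp (α * l) = Real.exp (α * l) * (1 + Real.exp (-(α * l))) := by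
          rw [mul_add, ← Real.exp_add]; simp; ring
        rw [this, Real.log_mul (Real.exp_ne_zero _) (by positivity), Real.log_exp]; ring
      have e2 : 0 ≤ Real.log (1 + Real.exp (-(α * l))) :=
        Real.log_nonneg (by linarith [Real.exp_pos (-(α * l))])
      have e3 : Real.log (1 + Real.exp (-(α * l))) ≤ Real.exp (-(α * l)) := by
        have := Real.log_le_sub_one_of_pos (x := 1 + Real.exp (-(α * l))) (by positivity)
        linarith
      have e4 : Real.exp (-(α * l)) ≤ Real.exp (-l) := Real.exp_le_exp.2 (by nlinarith)
      rw [e1, abs_of_nonneg (by linarith)]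
      linarith
    have e : (v z + (-1) * B z) + ((-A) * h z + (-b)) =
        2 * (Real.log (1 + Real.exp (α * l)) - α * l) - (w0 (δ⁻¹ • z) - c0 * l) / p -
          (w1 (δ⁻¹ • z) - c1 * l) / p ^ 2 := by
      rw [hv.boundary z hz, neg_mul A, hHz, hBdef, hb']
      unfold correctedBubble
      rw [bubble_eq hα0 hδ hz0, ← hl]
      simp only [hl]
      ring
    rw [e]
    have e' : (2 + 2 * M) / d * δ = 2 * (δ / d) + M * (δ / d) + M * (δ / d) := by ring
    rw [e']
    rw [abs_le] at *
    constructor <;> linarith [t0.1, t0.2, t1.1, t1.2, t2.1, t2.2]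

end CorrectedBubble

/-! ### Consequences of the system for the parameters -/

lemma monotone_of_lt_succ {k : ℕ} {a : ℕ → ℝ} (h : ∀ i ∈ Finset.Ico 1 k, a i ≤ a (i + 1))
    {i j : ℕ} (hi : 1 ≤ i) (hij : i ≤ j) (hj : j ≤ k) : a i ≤ a j := by
  induction j, hij using Nat.le_induction with
  | base => exact le_rfl
  | succ n hn ih =>
    exact (ih (by omega)).trans (h n (Finset.mem_Ico.2 ⟨by omega, by omega⟩))

namespace Tower

variable (T : Tower)

/-- Quantitative consequences of the system, with constants independent of `p`. -/
structure Spaced (k : ℕ) (p M c : ℝ) : Prop where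
  alpha_one : T.α 1 = 2
  alpha_ge : ∀ i ∈ Finset.Icc 1 k, 2 ≤ T.α i
  alpha_le : ∀ i ∈ Finset.Icc 1 k, T.α i ≤ M
  alpha_mono : ∀ i j, 1 ≤ i → i ≤ j → j ≤ k → T.α i ≤ T.α j
  alpha_succ : ∀ j ∈ Finset.Ico 1 k,
    |(T.α (j + 1) - 2) - T.τ j / T.τ (j + 1) * (T.α j + 2)| ≤ M / p
  delta_pos : ∀ i ∈ Finset.Icc 1 k, 0 < T.δ i
  log_le : ∀ i ∈ Finset.Icc 1 k, Real.log (T.δ i) ≤ -(c * p)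
  log_ge : ∀ i ∈ Finset.Icc 1 k, -(M * p) ≤ Real.log (T.δ i)
  gap : ∀ j ∈ Finset.Ico 1 k, c * p ≤ Real.log (T.δ (j + 1)) - Real.log (T.δ j)
  slope : ∀ j ∈ Finset.Ico 1 k, |(T.α j + 2) * (Real.log (T.δ (j + 1)) - Real.log (T.δ j)) -
    p * (1 + T.τ (j + 1) / T.τ j)| ≤ M
  slope_last : |(T.α k + 2) * Real.log (T.δ k) + p| ≤ M
  tau_pos : ∀ i ∈ Finset.Icc 1 k, 0 < T.τ i
  tau_le : ∀ i ∈ Finset.Icc 1 k, T.τ i ≤ M / p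
  tau_ratio : ∀ i ∈ Finset.Icc 1 k, ∀ j ∈ Finset.Icc 1 k, T.τ i / T.τ j ≤ M
  tau_succ : ∀ j ∈ Finset.Ico 1 k, (1 + c) * T.τ (j + 1) ≤ T.τ j
  aw_le : ∀ i ∈ Finset.Icc 1 k, |T.αw p i| ≤ M

variable {T}

/-- The growth rate `C⁰/p + C¹/p²`. -/
def rate (T : Tower) (p : ℝ) (i : ℕ) : ℝ := T.C0 i / p + T.C1 i / p ^ 2

lemma two_mul_aw (T : Tower) (p : ℝ) (i : ℕ) : 2 * T.αw p i = 2 * T.α i - T.rate p i := by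
  unfold αw rate; ring

/-- The equations for `δ_1, …, δ_k` in a common form. -/
lemma SolvesSystem.delta_eq {k : ℕ} {h0 p : ℝ} (h : T.SolvesSystem k h0 p) {j : ℕ}
    (hj : j ∈ Finset.Icc 1 k) :
    -(T.α j - T.rate p j + 2) * Real.log (T.δ j) - 2 * ∑ i ∈ Finset.Ioc j k,
      (-1) ^ (i + j) * (T.τ i / T.τ j) * T.αw p i * Real.log (T.δ i) + T.c k h0 p j = p := by
  obtain ⟨hj1, hjk⟩ := Finset.mem_Icc.1 hj
  rcases eq_or_lt_of_le hjk with rfl | hlt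
  · have := h.delta_last
    unfold rate
    rw [Finset.Ioc_self, Finset.sum_empty]
    linarith
  · have := h.delta j (Finset.mem_Ico.2 ⟨hj1, hlt⟩)
    have e : ∑ i ∈ Finset.Ioc j k,
        (-1) ^ (i + j) * (T.τ i / T.τ j) * T.αw p i * Real.log (T.δ i) =
        ∑ i ∈ Finset.Ioc j k, T.τ i / T.τ j * (-1) ^ (i + j) *
          (T.α i - T.C0 i / (2 * p) - T.C1 i / (2 * p ^ 2)) * Real.log (T.δ i) := by
      refine Finset.sum_congr rfl fun i _ => ?_
      have e1 : T.αw p i = T.α i - T.C0 i / (2 * p) - T.C1 i / (2 * p ^ 2) := by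
        unfold αw
        rw [mul_comm 2 p, mul_comm 2 (p ^ 2), ← div_div, ← div_div]; ring
      rw [e1]; ring
    rw [e]
    unfold rate
    linarith

lemma SolvesSystem.sum_lt {k : ℕ} {h0 p : ℝ} (h : T.SolvesSystem k h0 p) {j : ℕ}
    (hj : j ∈ Finset.Icc 1 k) :
    ∑ i ∈ Finset.Ico 1 j, (-1) ^ (i + j) * (T.τ i / T.τ j) * (2 * T.αw p i) = 2 - T.α j := by
  obtain ⟨hj1, hjk⟩ := Finset.mem_Icc.1 hj
  rcases eq_or_lt_of_le hj1 with rfl | hlt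
  · simp [h.alpha_one]
  · have := h.alpha j (Finset.mem_Icc.2 ⟨hlt, hjk⟩)
    have e : ∑ i ∈ Finset.Ico 1 j, (-1) ^ (i + j) * (T.τ i / T.τ j) * (2 * T.αw p i) =
        ∑ i ∈ Finset.Ico 1 j, T.τ i / T.τ j * (-1) ^ (i + j) *
          (2 * T.α i - T.C0 i / p - T.C1 i / p ^ 2) := by
      refine Finset.sum_congr rfl fun i _ => ?_
      rw [two_mul_aw]; unfold rate; ring
    rw [e]; linarith

/-- Consecutive relations: `τ_{j+1} (α_{j+1} - 2) = τ_j (α_j + 2 - C⁰/p - C¹/p²)`. -/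
lemma SolvesSystem.alpha_succ_eq {k : ℕ} {h0 p : ℝ} (h : T.SolvesSystem k h0 p)
    (hτ : ∀ i ∈ Finset.Icc 1 k, 0 < T.τ i) {j : ℕ} (hj : j ∈ Finset.Ico 1 k) :
    T.τ (j + 1) / T.τ j * (T.α (j + 1) - 2) = T.α j - T.rate p j + 2 := by
  obtain ⟨hj1, hjk⟩ := Finset.mem_Ico.1 hj
  have h1 := h.sum_lt (Finset.mem_Icc.2 ⟨hj1, hjk.le⟩)
  have h2 := h.sum_lt (j := j + 1) (Finset.mem_Icc.2 ⟨by omega, hjk⟩)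
  have t1 := (hτ j (Finset.mem_Icc.2 ⟨hj1, hjk.le⟩)).ne'
  have t2 := (hτ (j + 1) (Finset.mem_Icc.2 ⟨by omega, hjk⟩)).ne'
  rw [Finset.sum_Ico_succ_top hj1] at h2
  -- Passing from row `j` to row `j + 1` multiplies every coefficient by the same number `-τ_j /
  -- τ_{j+1}`, so a combination of two consecutive rows removes the sums.
  have e : ∑ i ∈ Finset.Ico 1 j, (-1) ^ (i + j) * (T.τ i / T.τ j) * (2 * T.αw p i) =
      -(T.τ (j + 1) / T.τ j) * ∑ i ∈ Finset.Ico 1 j,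
        (-1) ^ (i + (j + 1)) * (T.τ i / T.τ (j + 1)) * (2 * T.αw p i) := by
    rw [Finset.mul_sum]
    refine Finset.sum_congr rfl fun i _ => ?_
    rw [← add_assoc, pow_succ]
    field_simp
  have e3 : ((-1 : ℝ)) ^ (j + (j + 1)) = -1 := by
    rw [← add_assoc, pow_succ, ← two_mul, pow_mul]; simp
  rw [e3] at h2
  rw [e] at h1
  have h4 := two_mul_aw T p j
  have h5 : T.τ (j + 1) / T.τ j * (T.τ j / T.τ (j + 1)) = 1 := by field_simp
  linear_combination (T.τ (j + 1) / T.τ j) * h2 + h1 + h4 + (2 * T.αw p j) * h5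

/-- Row `j` plus `τ_{j+1} / τ_j` times row `j + 1` eliminates all scales beyond `j + 1`. By
`alpha_succ_eq` the two remaining logarithms have opposite coefficients, so only their difference
survives. -/
lemma SolvesSystem.slope_eq {k : ℕ} {h0 p : ℝ} (h : T.SolvesSystem k h0 p)
    (hτ : ∀ i ∈ Finset.Icc 1 k, 0 < T.τ i) {j : ℕ} (hj : j ∈ Finset.Ico 1 k) :
    (T.α j - T.rate p j + 2) * (Real.log (T.δ (j + 1)) - Real.log (T.δ j)) =
      p * (1 + T.τ (j + 1) / T.τ j) - T.c k h0 p j - T.τ (j + 1) / T.τ j * T.c k h0 p (j + 1) := by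
  obtain ⟨hj1, hjk⟩ := Finset.mem_Ico.1 hj
  have h1 := h.delta_eq (Finset.mem_Icc.2 ⟨hj1, hjk.le⟩)
  have h2 := h.delta_eq (j := j + 1) (Finset.mem_Icc.2 ⟨by omega, hjk⟩)
  have h3 := h.alpha_succ_eq hτ hj
  have t1 := (hτ j (Finset.mem_Icc.2 ⟨hj1, hjk.le⟩)).ne'
  have t2 := (hτ (j + 1) (Finset.mem_Icc.2 ⟨by omega, hjk⟩)).ne'
  have hI : Finset.Ioc j k = insert (j + 1) (Finset.Ioc (j + 1) k) := by
    ext i; simp only [Finset.mem_Ioc, Finset.mem_insert]; omega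
  have e : ∑ i ∈ Finset.Ioc (j + 1) k,
      (-1) ^ (i + j) * (T.τ i / T.τ j) * T.αw p i * Real.log (T.δ i) =
      -(T.τ (j + 1) / T.τ j) * ∑ i ∈ Finset.Ioc (j + 1) k,
        (-1) ^ (i + (j + 1)) * (T.τ i / T.τ (j + 1)) * T.αw p i * Real.log (T.δ i) := by
    rw [Finset.mul_sum]
    refine Finset.sum_congr rfl fun i _ => ?_
    rw [← add_assoc, pow_succ]
    field_simp
  have e3 : ((-1 : ℝ)) ^ (j + 1 + j) = -1 := by
    rw [add_right_comm, pow_succ, ← two_mul, pow_mul]; simp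
  rw [hI, Finset.sum_insert (by simp), e, e3] at h1
  have h4 := two_mul_aw T p (j + 1)
  set r := T.τ (j + 1) / T.τ j
  linear_combination h1 + r * h2 - Real.log (T.δ (j + 1)) * h3
    - r * Real.log (T.δ (j + 1)) * h4

lemma SolvesSystem.log_tau {k : ℕ} {h0 p : ℝ} (h : T.SolvesSystem k h0 p) (hp : 0 < p)
    {j : ℕ} (hj : j ∈ Finset.Icc 1 k) (hτ : 0 < T.τ j) (hδ : 0 < T.δ j) :
    p * Real.log p + (p - 1) * Real.log (T.τ j) + 2 * Real.log (T.δ j) = 0 := by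
  have h1 := congrArg Real.log (h.tau j hj)
  rw [Real.log_one, Real.log_mul (by positivity) (by positivity),
    Real.log_mul (by positivity) (by positivity), Real.log_rpow hp, Real.log_rpow hτ,
    Real.log_pow] at h1
  exact_mod_cast h1

lemma abs_neg_one_pow_mul (n : ℕ) (x : ℝ) : |(-1) ^ n * x| = |x| := by
  rw [abs_mul, abs_pow, abs_neg, abs_one, one_pow, one_mul]

/-- The constants `c_j` are bounded. -/
lemma abs_c_le {k : ℕ} {h0 p K M : ℝ} (hp : 1 ≤ p) (hM : 0 ≤ M) (hK : 0 ≤ K)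
    (hα : ∀ i ∈ Finset.Icc 1 k, 2 ≤ T.α i) (hαK : ∀ i ∈ Finset.Icc 1 k, T.α i ≤ K)
    (hτ : ∀ i ∈ Finset.Icc 1 k, ∀ j ∈ Finset.Icc 1 k, |T.τ i / T.τ j| ≤ K)
    (hw : ∀ i ∈ Finset.Icc 1 k, |T.w0 i 0| ≤ M ∧ |T.w1 i 0| ≤ M)
    (haw : ∀ i ∈ Finset.Icc 1 k, |T.αw p i| ≤ K + M) {j : ℕ} (hj : j ∈ Finset.Icc 1 k) :
    |T.c k h0 p j| ≤ 4 * Real.pi * |h0| * (k * (K * (K + M))) + Real.log (2 * K ^ 2) +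
      k * (K * (2 * M)) := by
  have hpi := Real.pi_pos
  have s1 : |∑ i ∈ Finset.Icc 1 k, (-1) ^ (i + j) * (T.τ i / T.τ j) * T.αw p i| ≤
      k * (K * (K + M)) := by
    refine (Finset.abs_sum_le_sum_abs _ _).trans ?_
    refine (Finset.sum_le_card_nsmul _ _ (K * (K + M)) fun i hi => ?_).trans (by simp)
    rw [mul_assoc, abs_neg_one_pow_mul, abs_mul]
    exact mul_le_mul (hτ i hi j hj) (haw i hi) (abs_nonneg _) hK
  have s2 : |∑ i ∈ Finset.Ioc j k, (-1) ^ (i + j) * (T.τ i / T.τ j) *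
      (T.w0 i 0 / p + T.w1 i 0 / p ^ 2)| ≤ k * (K * (2 * M)) := by
    refine (Finset.abs_sum_le_sum_abs _ _).trans ?_
    refine (Finset.sum_le_card_nsmul _ _ (K * (2 * M)) fun i hi => ?_).trans ?_
    · have hi' : i ∈ Finset.Icc 1 k := by
        rw [Finset.mem_Ioc] at hi; rw [Finset.mem_Icc] at hj ⊢; omega
      rw [mul_assoc, abs_neg_one_pow_mul, abs_mul]
      refine mul_le_mul (hτ i hi' j hj) ?_ (abs_nonneg _) hK
      refine (abs_add_le _ _).trans ?_
      obtain ⟨a1, a2⟩ := hw i hi'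
      have p2 : 1 ≤ p ^ 2 := one_le_pow₀ hp
      rw [abs_div, abs_div, abs_of_pos (by linarith : 0 < p), abs_of_pos (by linarith : 0 < p ^ 2)]
      linarith [div_le_self (abs_nonneg (T.w0 i 0)) hp, div_le_self (abs_nonneg (T.w1 i 0)) p2]
    · rw [nsmul_eq_mul]
      gcongr
      simp
  have s3 : |Real.log (2 * T.α j ^ 2)| ≤ Real.log (2 * K ^ 2) := by
    have h2 := hα j hj
    rw [abs_of_nonneg (Real.log_nonneg (by nlinarith))]
    apply Real.log_le_log (by positivity)
    have := hαK j hj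
    gcongr
  have s4 : |4 * Real.pi * h0 * ∑ i ∈ Finset.Icc 1 k,
      (-1) ^ (i + j) * (T.τ i / T.τ j) * T.αw p i| ≤
      4 * Real.pi * |h0| * (k * (K * (K + M))) := by
    rw [abs_mul, abs_mul, abs_of_pos (by positivity : 0 < 4 * Real.pi)]
    gcongr
  unfold c
  rw [abs_le] at *
  constructor <;> linarith [s2.1, s2.2, s3.1, s3.2, s4.1, s4.2]

end Tower

/-! ### Uniform separation of the scales -/

namespace Tower

set_option maxHeartbeats 1000000 in
/-- The system forces exponential separation of the scales and a definite decay of the `τ_j`. -/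
lemma exists_spaced (k : ℕ) (hk : 1 ≤ k) (h0 K Mw : ℝ) (hMw : 1 ≤ Mw) :
    ∃ M c p₀ : ℝ, 1 ≤ M ∧ 0 < c ∧ c ≤ 1 ∧ 1 < p₀ ∧ ∀ p : ℝ, p₀ ≤ p → ∀ T : Tower,
      (∀ i ∈ Finset.Icc 1 k, |T.C0 i| ≤ Mw ∧ |T.C1 i| ≤ Mw ∧ |T.w0 i 0| ≤ Mw ∧ |T.w1 i 0| ≤ Mw) →
      T.SolvesSystem k h0 p → T.Admissible k K p → T.Spaced k p M c := by
  rcases lt_or_ge K 2 with hK2 | hK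
  · refine ⟨1, 1, 2, le_rfl, one_pos, le_rfl, by norm_num, fun p _ T _ _ hA => ?_⟩
    exfalso
    have := monotone_of_lt_succ (fun i hi => (hA.alpha_lt i hi).le) le_rfl hk le_rfl
    linarith [hA.alpha_one, hA.alpha_le]
  have hK0 : 0 < K := by linarith
  have hpi := Real.pi_pos
  set Mc := 4 * Real.pi * |h0| * (k * (K * (K + Mw))) + Real.log (2 * K ^ 2) +
      k * (K * (2 * Mw)) with hMc
  have hlogK : 0 ≤ Real.log (2 * K ^ 2) := Real.log_nonneg (by nlinarith)
  have hMc0 : 0 ≤ Mc := by positivity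
  have hlK : 0 ≤ Real.log K := Real.log_nonneg (by linarith)
  set M := Mc * (1 + K) + 8 * K * Mw + 2 * K + Mw with hM
  set c := 1 / (4 * (K + 3)) with hc
  have hc0 : 0 < c := by positivity
  -- Past this threshold `2 Mw ≤ p` makes the growth rates at most `1`, `2 K log K ≤ p` makes the
  -- prefactors `C_i` harmless in `ln δ_i`, and `2 Mc (1 + K) ≤ p` leaves at least `p/2` on the
  -- right of `slope_eq`.
  refine ⟨M, c, 2 + 2 * Mw + 2 * K * Real.log K + 2 * (Mc * (1 + K)),
    ?_, hc0, ?_, ?_, ?_⟩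
  · have : 0 ≤ Mc * (1 + K) := by positivity
    have : 0 ≤ 8 * K * Mw := by positivity
    linarith
  · rw [hc, div_le_one (by positivity)]; linarith
  · have : 0 ≤ Mc * (1 + K) := by positivity
    have : 0 ≤ 2 * K * Real.log K := by positivity
    linarith
  intro p hp T hw hS hA
  have q1 : 0 ≤ Mc * (1 + K) := by positivity
  have q2 : 0 ≤ 2 * K * Real.log K := by positivity
  have q3 : 0 ≤ Mc * K := by positivity
  have q4 : 0 ≤ K * Mw := by positivity
  have hp2 : 2 ≤ p := by linarith
  have hp0 : 0 < p := by linarith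
  have hp1 : 1 ≤ p := by linarith
  have hlogp : Real.log K ≤ p := by
    have : Real.log K ≤ K * Real.log K := by nlinarith
    nlinarith
  have hαmono : ∀ i j, 1 ≤ i → i ≤ j → j ≤ k → T.α i ≤ T.α j := fun i j =>
    monotone_of_lt_succ (fun i hi => (hA.alpha_lt i hi).le)
  have hα2 : ∀ i ∈ Finset.Icc 1 k, 2 ≤ T.α i := fun i hi => by
    rw [Finset.mem_Icc] at hi
    exact hA.alpha_one ▸ hαmono 1 i le_rfl hi.1 hi.2
  have hαK : ∀ i ∈ Finset.Icc 1 k, T.α i ≤ K := fun i hi => by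
    rw [Finset.mem_Icc] at hi
    exact (hαmono i k hi.1 hi.2 le_rfl).trans hA.alpha_le
  obtain ⟨C, b, hCb, hb, hbk, hb1⟩ := hA.delta
  have hbmono : ∀ i j, 1 ≤ i → i ≤ j → j ≤ k → b j ≤ b i := fun i j h1 h2 h3 => by
    have := monotone_of_lt_succ (a := fun i => -b i) (fun i hi => neg_le_neg (hb i hi).le) h1 h2 h3
    exact neg_le_neg_iff.1 this
  have hδ0 : ∀ i ∈ Finset.Icc 1 k, 0 < T.δ i := fun i hi => by
    obtain ⟨e, e1, e2⟩ := hCb i hi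
    rw [e]
    have : 0 < C i := (inv_pos.2 hK0).trans_le e1
    positivity
  have hlog : ∀ i ∈ Finset.Icc 1 k, Real.log (T.δ i) = Real.log (C i) - b i * p := fun i hi => by
    obtain ⟨e, e1, e2⟩ := hCb i hi
    have : 0 < C i := (inv_pos.2 hK0).trans_le e1
    rw [e, Real.log_mul this.ne' (Real.exp_ne_zero _), Real.log_exp]
    ring
  have hlogC : ∀ i ∈ Finset.Icc 1 k, |Real.log (C i)| ≤ Real.log K := fun i hi => by
    obtain ⟨e, e1, e2⟩ := hCb i hi
    have hC : 0 < C i := (inv_pos.2 hK0).trans_le e1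
    have h1 := Real.log_le_log hC e2
    have h2 := Real.log_le_log (inv_pos.2 hK0) e1
    rw [Real.log_inv] at h2
    exact abs_le.2 ⟨h2, h1⟩
  have hcK : c ≤ 1 / (2 * K) := by
    rw [hc]; exact one_div_le_one_div_of_le (by positivity) (by linarith)
  have hlog_le : ∀ i ∈ Finset.Icc 1 k, Real.log (T.δ i) ≤ -(c * p) := fun i hi => by
    have h1 := (abs_le.1 (hlogC i hi)).2
    have hik := Finset.mem_Icc.1 hi
    have h2 : K⁻¹ * p ≤ b i * p := by
      have := hbk.trans (hbmono i k hik.1 hik.2 le_rfl)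
      gcongr
    have h3 : c * p ≤ 1 / (2 * K) * p := by gcongr
    have h4 : Real.log K ≤ 1 / (2 * K) * p := by
      rw [one_div, inv_mul_eq_div, le_div_iff₀ (by positivity)]; linarith
    have h5 : K⁻¹ * p = 2 * (1 / (2 * K) * p) := by field_simp
    rw [hlog i hi]; linarith
  have hlog_ge : ∀ i ∈ Finset.Icc 1 k, -(2 * K * p) ≤ Real.log (T.δ i) := fun i hi => by
    have h1 := (abs_le.1 (hlogC i hi)).1
    have hik := Finset.mem_Icc.1 hi
    have h2 : b i * p ≤ K * p := by
      have := (hbmono 1 i le_rfl hik.1 hik.2).trans hb1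
      gcongr
    rw [hlog i hi]
    nlinarith
  have hκ : ∀ i ∈ Finset.Icc 1 k, |T.rate p i| ≤ 2 * Mw / p := fun i hi => by
    obtain ⟨a1, a2, -, -⟩ := hw i hi
    unfold rate
    refine (abs_add_le _ _).trans ?_
    rw [abs_div, abs_div, abs_of_pos hp0, abs_of_pos (by positivity : 0 < p ^ 2)]
    have e1 : |T.C0 i| / p ≤ Mw / p := by gcongr
    have e2 : |T.C1 i| / p ^ 2 ≤ Mw / p := by
      gcongr
      nlinarith
    have e3 : 2 * Mw / p = Mw / p + Mw / p := by ring
    linarith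
  have hκ1 : ∀ i ∈ Finset.Icc 1 k, |T.rate p i| ≤ 1 := fun i hi =>
    (hκ i hi).trans (by rw [div_le_one hp0]; linarith)
  have haw : ∀ i ∈ Finset.Icc 1 k, |T.αw p i| ≤ K + Mw := fun i hi => by
    have h1 := two_mul_aw T p i
    have h2 := abs_le.1 (hκ1 i hi)
    have h3 := hα2 i hi
    have h4 := hαK i hi
    rw [abs_le]; constructor <;> linarith [h2.1, h2.2]
  have hτ := hA.tau_pos
  have hr : ∀ i ∈ Finset.Icc 1 k, ∀ j ∈ Finset.Icc 1 k, |T.τ i / T.τ j| ≤ K := fun i hi j hj => by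
    rw [abs_of_pos (div_pos (hτ i hi) (hτ j hj))]
    exact (hA.tau_ratio i hi j hj).2
  have hcb : ∀ j ∈ Finset.Icc 1 k, |T.c k h0 p j| ≤ Mc := fun j hj =>
    abs_c_le hp1 (by linarith) hK0.le hα2 hαK hr (fun i hi => (hw i hi).2.2) haw hj
  have hIco : ∀ j ∈ Finset.Ico 1 k, j ∈ Finset.Icc 1 k ∧ j + 1 ∈ Finset.Icc 1 k := fun j hj => by
    simp only [Finset.mem_Ico, Finset.mem_Icc] at *; omega
  have hcc : ∀ j ∈ Finset.Ico 1 k,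
      |T.c k h0 p j + T.τ (j + 1) / T.τ j * T.c k h0 p (j + 1)| ≤ Mc * (1 + K) := fun j hj => by
    obtain ⟨hj1, hj2⟩ := hIco j hj
    have e1 : |T.τ (j + 1) / T.τ j * T.c k h0 p (j + 1)| ≤ K * Mc := by
      rw [abs_mul]
      exact mul_le_mul (hr _ hj2 _ hj1) (hcb _ hj2) (abs_nonneg _) hK0.le
    have e2 := hcb j hj1
    have e3 := abs_add_le (T.c k h0 p j) (T.τ (j + 1) / T.τ j * T.c k h0 p (j + 1))
    linarith
  have hgap : ∀ j ∈ Finset.Ico 1 k, 2 * c * p ≤ Real.log (T.δ (j + 1)) - Real.log (T.δ j) :=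
    fun j hj => by
    obtain ⟨hj1, hj2⟩ := hIco j hj
    have h1 := hS.slope_eq hτ hj
    have h2 := abs_le.1 (hcc j hj)
    have h3 : 0 < T.τ (j + 1) / T.τ j := div_pos (hτ _ hj2) (hτ _ hj1)
    have h4 := abs_le.1 (hκ1 j hj1)
    have h5 := hα2 j hj1
    have h6 := hαK j hj1
    set G := Real.log (T.δ (j + 1)) - Real.log (T.δ j)
    have h7 : p / 2 ≤ (T.α j - T.rate p j + 2) * G := by
      rw [h1]
      have := mul_pos hp0 h3
      linarith [h2.2]
    have h8 : 0 < G := by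
      by_contra! hG
      have : (T.α j - T.rate p j + 2) * G ≤ 0 :=
        mul_nonpos_of_nonneg_of_nonpos (by linarith [h4.2]) hG
      linarith
    have h9 : (T.α j - T.rate p j + 2) * G ≤ (K + 3) * G := by
      exact mul_le_mul_of_nonneg_right (by linarith [h4.1]) h8.le
    -- This is the origin of `c = 1 / (4 (K + 3))`: the slope coefficient is at most `K + 3`. The
    -- gap obtained is twice the one that is recorded.
    have h10 : 2 * c * p = p / 2 / (K + 3) := by rw [hc]; field_simp; norm_num
    rw [h10, div_le_iff₀ (by positivity)]
    linarith
  -- The growth rates are `O(1/p)` and the logarithms of the scales `O(p)`, so dropping the rates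
  -- from the slopes costs only a constant.
  have hprod : ∀ i ∈ Finset.Icc 1 k, ∀ x, |x| ≤ 4 * K * p → |T.rate p i * x| ≤ 8 * K * Mw :=
    fun i hi x hx => by
    rw [abs_mul]
    calc |T.rate p i| * |x| ≤ 2 * Mw / p * (4 * K * p) :=
          mul_le_mul (hκ i hi) hx (abs_nonneg _) (by positivity)
      _ = 8 * K * Mw := by field_simp; norm_num
  have hKp : 0 ≤ K * p := by positivity
  have hcp : 0 ≤ c * p := by positivity
  have h2KM : 2 * K ≤ M := by linarith
  have hMcM : Mc ≤ Mc * (1 + K) := by linarith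
  refine
    { alpha_one := hA.alpha_one
      alpha_ge := hα2
      alpha_le := fun i hi => (hαK i hi).trans (by linarith)
      alpha_mono := hαmono
      alpha_succ := fun j hj => ?_
      delta_pos := hδ0
      log_le := hlog_le
      log_ge := fun i hi => (neg_le_neg (mul_le_mul_of_nonneg_right h2KM hp0.le)).trans
        (hlog_ge i hi)
      gap := fun j hj => le_trans (by linarith) (hgap j hj)
      slope := fun j hj => ?_
      slope_last := ?_
      tau_pos := hτ
      tau_le := fun i hi => (hA.tau_le i hi).trans (by gcongr; linarith)
      tau_ratio := fun i hi j hj => (hA.tau_ratio i hi j hj).2.trans (by linarith)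
      tau_succ := fun j hj => ?_
      aw_le := fun i hi => (haw i hi).trans (by linarith) }
  · obtain ⟨hj1, hj2⟩ := hIco j hj
    have h1 := hS.alpha_succ_eq hτ hj
    have t1 := (hτ _ hj1).ne'
    have t2 := (hτ _ hj2).ne'
    have h2 : T.α (j + 1) - 2 - T.τ j / T.τ (j + 1) * (T.α j + 2) =
        -(T.τ j / T.τ (j + 1) * T.rate p j) := by
      have : T.τ j / T.τ (j + 1) * (T.τ (j + 1) / T.τ j) = 1 := by field_simp
      linear_combination (T.τ j / T.τ (j + 1)) * h1 - (T.α (j + 1) - 2) * this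
    rw [h2, abs_neg, abs_mul]
    calc _ ≤ K * (2 * Mw / p) := mul_le_mul (hr _ hj1 _ hj2) (hκ j hj1) (abs_nonneg _) hK0.le
      _ = (2 * K * Mw) / p := by ring
      _ ≤ M / p := by gcongr; linarith
  · obtain ⟨hj1, hj2⟩ := hIco j hj
    have h1 := hS.slope_eq hτ hj
    have h2 := abs_le.1 (hcc j hj)
    have h3 := hprod j hj1 (Real.log (T.δ (j + 1)) - Real.log (T.δ j)) (by
      have a1 := hlog_le _ hj1
      have a2 := hlog_ge _ hj1
      have a3 := hlog_le _ hj2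
      have a4 := hlog_ge _ hj2
      rw [abs_le]; constructor <;> linarith)
    have h4 := abs_le.1 h3
    rw [abs_le]
    constructor <;> linarith [h2.1, h2.2, h4.1, h4.2]
  · have hk1 : k ∈ Finset.Icc 1 k := Finset.mem_Icc.2 ⟨hk, le_rfl⟩
    have h1 := hS.delta_eq hk1
    rw [Finset.Ioc_self, Finset.sum_empty] at h1
    have h2 := abs_le.1 (hcb k hk1)
    have h3 := hprod k hk1 (Real.log (T.δ k)) (by
      have a1 := hlog_le _ hk1
      have a2 := hlog_ge _ hk1
      rw [abs_le]; constructor <;> linarith)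
    have h4 := abs_le.1 h3
    rw [abs_le]
    constructor <;> linarith [h2.1, h2.2, h4.1, h4.2]
  · obtain ⟨hj1, hj2⟩ := hIco j hj
    have h1 := hS.log_tau hp0 hj1 (hτ _ hj1) (hδ0 _ hj1)
    have h2 := hS.log_tau hp0 hj2 (hτ _ hj2) (hδ0 _ hj2)
    have h3 := hgap j hj
    -- Subtracting the logarithms of the two equations `p^p τ^(p-1) δ² = 1` converts a gap of order
    -- `p` between the scales into a fixed ratio between the `τ`'s.
    have h4 : c ≤ Real.log (T.τ j) - Real.log (T.τ (j + 1)) := by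
      have h5 : (p - 1) * (Real.log (T.τ j) - Real.log (T.τ (j + 1))) =
          2 * (Real.log (T.δ (j + 1)) - Real.log (T.δ j)) := by linarith
      by_contra! hlt
      have : (p - 1) * (Real.log (T.τ j) - Real.log (T.τ (j + 1))) < (p - 1) * c := by
        exact mul_lt_mul_of_pos_left hlt (by linarith)
      linarith
    rw [← Real.log_div (hτ _ hj1).ne' (hτ _ hj2).ne',
      Real.le_log_iff_exp_le (div_pos (hτ _ hj1) (hτ _ hj2)), le_div_iff₀ (hτ _ hj2)] at h4
    have h6 := Real.add_one_le_exp c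
    exact (mul_le_mul_of_nonneg_right (by linarith) (hτ _ hj2).le).trans h4

end Tower

/-! ### The expansion of the nonlinearity -/

lemma abs_log_one_add_sub_le {u : ℝ} (hu : |u| ≤ 1 / 2) :
    |Real.log (1 + u) - (u - u ^ 2 / 2 + u ^ 3 / 3)| ≤ 2 * |u| ^ 4 := by
  have h1 := Real.abs_log_sub_add_sum_range_le (x := -u) (by rw [abs_neg]; linarith) 3
  simp only [Finset.sum_range_succ, Finset.sum_range_zero, abs_neg, sub_neg_eq_add] at h1
  norm_num at h1
  have h2 : |u| ^ 4 / (1 - |u|) ≤ 2 * |u| ^ 4 := by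
    rw [div_le_iff₀ (by linarith)]
    nlinarith [pow_nonneg (abs_nonneg u) 4]
  refine le_trans (le_of_eq ?_) (h1.trans h2)
  congr 1
  ring

lemma abs_exp_sub_le {θ : ℝ} (hθ : |θ| ≤ 1) :
    |Real.exp θ - (1 + θ + θ ^ 2 / 2)| ≤ |θ| ^ 3 := by
  have h1 := Real.exp_bound hθ (n := 3) (by norm_num)
  simp only [Finset.sum_range_succ, Finset.sum_range_zero] at h1
  norm_num [Nat.factorial] at h1
  have h2 := pow_nonneg (abs_nonneg θ) 3
  linarith

/-- The part of `p ln (1 + u)` that is of order `p⁻³`. -/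
lemma abs_log_remainder_le {a A V w1 E ξ R : ℝ} (ha0 : 0 < a) (ha1 : a ≤ 1) (hA : 1 ≤ A)
    (hV : |V| ≤ A) (hw1 : |w1| ≤ A) (hE : |E| ≤ A * a ^ 3) (hξb : |ξ| ≤ 3 * (A * a))
    (hR : |R| ≤ 512 * (A ^ 4 * a ^ 3)) :
    |E - V * (w1 * a ^ 2 + E) * a - ξ ^ 2 / 2 * a +
      ξ * (3 * V ^ 2 + 3 * V * ξ + ξ ^ 2) / 3 * a ^ 2 + R| ≤ 600 * (A ^ 4 * a ^ 3) := by
  have hA0 : 0 < A := by linarith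
  have hA14 : A ≤ A ^ 4 := by simpa using pow_le_pow_right₀ hA (show 1 ≤ 4 by norm_num)
  have hA24 : A ^ 2 ≤ A ^ 4 := pow_le_pow_right₀ hA (by norm_num)
  have hA34 : A ^ 3 ≤ A ^ 4 := pow_le_pow_right₀ hA (by norm_num)
  have f1 : |E| ≤ A ^ 4 * a ^ 3 := hE.trans (by gcongr)
  have f2 : |V * (w1 * a ^ 2 + E) * a| ≤ 2 * (A ^ 4 * a ^ 3) := by
    rw [abs_mul, abs_mul, abs_of_pos ha0]
    have g : |w1 * a ^ 2 + E| ≤ 2 * (A * a ^ 2) := by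
      have g1 : |w1 * a ^ 2| ≤ A * a ^ 2 := by
        rw [abs_mul, abs_of_pos (by positivity : 0 < a ^ 2)]; gcongr
      have g2 : A * a ^ 3 ≤ A * a ^ 2 :=
        mul_le_mul_of_nonneg_left (pow_le_pow_of_le_one ha0.le ha1 (by norm_num)) hA0.le
      have := abs_add_le (w1 * a ^ 2) E
      linarith
    calc |V| * |w1 * a ^ 2 + E| * a ≤ A * (2 * (A * a ^ 2)) * a := by gcongr
      _ = 2 * (A ^ 2 * a ^ 3) := by ring
      _ ≤ _ := by gcongr
  have f3 : |ξ ^ 2 / 2 * a| ≤ 5 * (A ^ 4 * a ^ 3) := by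
    rw [abs_mul, abs_div, abs_two, abs_pow, abs_of_pos ha0]
    calc |ξ| ^ 2 / 2 * a ≤ (3 * (A * a)) ^ 2 / 2 * a := by gcongr
      _ = 9 / 2 * (A ^ 2 * a ^ 3) := by ring
      _ ≤ 5 * (A ^ 2 * a ^ 3) := by gcongr; norm_num
      _ ≤ _ := by gcongr
  have f4 : |ξ * (3 * V ^ 2 + 3 * V * ξ + ξ ^ 2) / 3 * a ^ 2| ≤ 21 * (A ^ 4 * a ^ 3) := by
    have hξA : |ξ| ≤ 3 * A := by
      refine hξb.trans ?_
      gcongr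
      exact mul_le_of_le_one_right hA0.le ha1
    have g : |3 * V ^ 2 + 3 * V * ξ + ξ ^ 2| ≤ 21 * A ^ 2 := by
      have g0 : |V ^ 2| ≤ A ^ 2 := by rw [abs_pow]; gcongr
      have g1 : |V * ξ| ≤ 3 * A ^ 2 := by
        rw [abs_mul]
        calc |V| * |ξ| ≤ A * (3 * A) := by gcongr
          _ = _ := by ring
      have g2 : |ξ ^ 2| ≤ 9 * A ^ 2 := by
        rw [abs_pow]
        calc |ξ| ^ 2 ≤ (3 * A) ^ 2 := by gcongr
          _ = _ := by ring
      clear f1 f2 f3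
      rw [abs_le] at *
      constructor <;> linarith [g0.1, g0.2, g1.1, g1.2, g2.1, g2.2]
    rw [abs_mul, abs_div, abs_mul, abs_of_pos (by norm_num : (0 : ℝ) < 3),
      abs_of_pos (by positivity : 0 < a ^ 2)]
    calc |ξ| * |3 * V ^ 2 + 3 * V * ξ + ξ ^ 2| / 3 * a ^ 2
        ≤ 3 * (A * a) * (21 * A ^ 2) / 3 * a ^ 2 := by gcongr
      _ = 21 * (A ^ 3 * a ^ 3) := by ring
      _ ≤ _ := by gcongr
  have hAA : 0 ≤ A ^ 4 * a ^ 3 := by positivity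
  clear hV hw1 hE hξb hA14 hA24 hA34
  rw [abs_le] at *
  constructor <;> linarith [f2.1, f2.2, f3.1, f3.2, f4.1, f4.2, f1.1, f1.2, hR.1, hR.2]

/-- `T1`, `T2` and `s` are of order `a`, `a²` and `a³`, so in the second-order Taylor polynomial of
`exp` only `T1²` survives among the quadratic terms. -/
lemma abs_exp_sub_le_of_orders {a A T1 T2 s : ℝ} (ha0 : 0 < a) (hA : 1 ≤ A)
    (hAa : A * a ≤ 1 / 700) (hA2a : A ^ 2 * a ≤ 1 / 700) (hT1b : |T1| ≤ 2 * (A ^ 2 * a))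
    (hT2b : |T2| ≤ 3 * (A ^ 3 * a ^ 2)) (hsb : |s| ≤ 600 * (A ^ 4 * a ^ 3)) :
    |Real.exp (T1 + T2 + s) - (1 + T1 + T2 + T1 ^ 2 / 2)| ≤ 10 ^ 9 * (A ^ 6 * a ^ 3) := by
  have hA0 : 0 < A := by linarith
  obtain ⟨θ, hθ⟩ : ∃ θ, θ = T1 + T2 + s := ⟨_, rfl⟩
  have hT2s : |T2 + s| ≤ 603 * (A ^ 3 * a ^ 2) := by
    have : A ^ 4 * a ^ 3 ≤ A ^ 3 * a ^ 2 := by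
      calc A ^ 4 * a ^ 3 = A ^ 3 * a ^ 2 * (A * a) := by ring
        _ ≤ A ^ 3 * a ^ 2 * 1 := by gcongr; linarith
        _ = _ := mul_one _
    have := abs_add_le T2 s
    linarith
  have hA3A2 : A ^ 3 * a ^ 2 ≤ A ^ 2 * a * (1 / 700) := by
    calc A ^ 3 * a ^ 2 = A ^ 2 * a * (A * a) := by ring
      _ ≤ _ := by gcongr
  have hθb : |θ| ≤ 3 * (A ^ 2 * a) := by
    have e : θ = T1 + (T2 + s) := by rw [hθ]; ring
    have := abs_add_le T1 (T2 + s)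
    have : 0 ≤ A ^ 2 * a := by positivity
    rw [e]
    linarith
  have hθ1 : |θ| ≤ 1 := by linarith
  have hexp := abs_exp_sub_le hθ1
  -- The last summand is `(θ² - T1²) / 2`, factored so that its order `a³` is visible.
  have e : Real.exp θ - (1 + T1 + T2 + T1 ^ 2 / 2) =
      (Real.exp θ - (1 + θ + θ ^ 2 / 2)) + s + (T2 + s) * (T1 + θ) / 2 := by
    rw [hθ]; ring
  have i1 : |θ| ^ 3 ≤ 27 * (A ^ 6 * a ^ 3) := by
    calc |θ| ^ 3 ≤ (3 * (A ^ 2 * a)) ^ 3 := by gcongr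
      _ = _ := by ring
  have hA46 : A ^ 4 ≤ A ^ 6 := pow_le_pow_right₀ hA (by norm_num)
  have hA56 : A ^ 5 ≤ A ^ 6 := pow_le_pow_right₀ hA (by norm_num)
  have i2 : |s| ≤ 600 * (A ^ 6 * a ^ 3) := hsb.trans (by gcongr)
  have i3 : |(T2 + s) * (T1 + θ) / 2| ≤ 2000 * (A ^ 6 * a ^ 3) := by
    have j : |T1 + θ| ≤ 5 * (A ^ 2 * a) := by
      have := abs_add_le T1 θ; linarith
    rw [abs_div, abs_two, abs_mul]
    calc |T2 + s| * |T1 + θ| / 2 ≤ 603 * (A ^ 3 * a ^ 2) * (5 * (A ^ 2 * a)) / 2 := by gcongr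
      _ = 3015 / 2 * (A ^ 5 * a ^ 3) := by ring
      _ ≤ 2000 * (A ^ 6 * a ^ 3) := by gcongr; norm_num
  have hAA : 0 ≤ A ^ 6 * a ^ 3 := by positivity
  rw [← hθ, e]
  calc _ ≤ |Real.exp θ - (1 + θ + θ ^ 2 / 2) + s| + |(T2 + s) * (T1 + θ) / 2| := abs_add_le _ _
    _ ≤ |Real.exp θ - (1 + θ + θ ^ 2 / 2)| + |s| + |(T2 + s) * (T1 + θ) / 2| := by
      gcongr; exact abs_add_le _ _
    _ ≤ _ := by linarith

/-- Expansion of `(1 + v/p + w₀/p² + …)^p` up to the order `p⁻³`. -/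
lemma rpow_expansion {p A V w0 w1 E : ℝ} (hp : 1 ≤ p) (hA : 1 ≤ A) (hAp : 700 * A ^ 2 ≤ p)
    (hV : |V| ≤ A) (hw0 : |w0| ≤ A) (hw1 : |w1| ≤ A) (hE : |E| ≤ A / p ^ 3) :
    0 < 1 + (V + w0 / p + w1 / p ^ 2 + E) / p ∧
    |(1 + (V + w0 / p + w1 / p ^ 2 + E) / p) ^ p -
      Real.exp V * correctionFactor p V w0 w1| ≤ Real.exp V * (10 ^ 9 * A ^ 6 / p ^ 3) := by
  have hp0 : 0 < p := by linarith
  have hA0 : 0 < A := by linarith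
  obtain ⟨a, ha⟩ : ∃ a, a = p⁻¹ := ⟨_, rfl⟩
  have ha0 : 0 < a := by rw [ha]; positivity
  have hpa : p * a = 1 := by rw [ha]; field_simp
  have hA2a : A ^ 2 * a ≤ 1 / 700 := by
    rw [ha, ← div_eq_mul_inv, div_le_iff₀ hp0]; linarith
  have hA12 : A ≤ A ^ 2 := le_self_pow₀ hA (by norm_num)
  have hAa : A * a ≤ 1 / 700 := (mul_le_mul_of_nonneg_right hA12 ha0.le).trans hA2a
  have haA : a ≤ A * a := le_mul_of_one_le_left ha0.le hA
  have ha1 : a ≤ 1 := by linarith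
  have hE' : |E| ≤ A * a ^ 3 := by rw [ha, inv_pow, ← div_eq_mul_inv]; exact hE
  obtain ⟨ξ, hξ⟩ : ∃ ξ, ξ = w0 * a + w1 * a ^ 2 + E := ⟨_, rfl⟩
  have hX : V + w0 / p + w1 / p ^ 2 + E = V + ξ := by
    rw [hξ, ha, inv_pow]; ring
  have hξb : |ξ| ≤ 3 * (A * a) := by
    have ha2 : a ^ 2 ≤ a := pow_le_of_le_one ha0.le ha1 (by norm_num)
    have ha3 : a ^ 3 ≤ a := pow_le_of_le_one ha0.le ha1 (by norm_num)
    have e1 : |w0 * a| ≤ A * a := by rw [abs_mul, abs_of_pos ha0]; gcongr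
    have e2 : |w1 * a ^ 2| ≤ A * a := by
      rw [abs_mul, abs_of_pos (by positivity : 0 < a ^ 2)]; gcongr
    have e3 : |E| ≤ A * a := hE'.trans (by gcongr)
    rw [hξ]
    calc _ ≤ |w0 * a + w1 * a ^ 2| + |E| := abs_add_le _ _
      _ ≤ |w0 * a| + |w1 * a ^ 2| + |E| := by gcongr; exact abs_add_le _ _
      _ ≤ _ := by linarith
  have hXb : |V + ξ| ≤ 4 * A := by
    have := abs_add_le V ξ
    linarith
  obtain ⟨u, hu⟩ : ∃ u, u = (V + ξ) * a := ⟨_, rfl⟩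
  have hub : |u| ≤ 4 * (A * a) := by
    rw [hu, abs_mul, abs_of_pos ha0, ← mul_assoc]; gcongr
  have huX : (V + ξ) / p = u := by rw [hu, ha]; ring
  rw [hX, huX]
  have hpos : 0 < 1 + u := by
    have := (abs_le.1 hub).1; linarith
  refine ⟨hpos, ?_⟩
  obtain ⟨r, hr⟩ : ∃ r, r = Real.log (1 + u) - (u - u ^ 2 / 2 + u ^ 3 / 3) := ⟨_, rfl⟩
  have hrb : |p * r| ≤ 512 * (A ^ 4 * a ^ 3) := by
    have h1 := abs_log_one_add_sub_le (u := u) (by linarith)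
    rw [← hr] at h1
    rw [abs_mul, abs_of_pos hp0]
    calc p * |r| ≤ p * (2 * (4 * (A * a)) ^ 4) := by
          gcongr; exact h1.trans (by gcongr)
      _ = (p * a) * (512 * (A ^ 4 * a ^ 3)) := by ring
      _ = _ := by rw [hpa, one_mul]
  have hsb := abs_log_remainder_le ha0 ha1 hA hV hw1 hE' hξb hrb
  -- `T1` and `T2` are the terms of order `p⁻¹` and `p⁻²` in `p log (1 + u) - V`; `s` is everything
  -- of order `p⁻³`.
  obtain ⟨T1, hT1⟩ : ∃ T1, T1 = (w0 - V ^ 2 / 2) * a := ⟨_, rfl⟩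
  obtain ⟨T2, hT2⟩ : ∃ T2, T2 = (w1 - V * w0 + V ^ 3 / 3) * a ^ 2 := ⟨_, rfl⟩
  obtain ⟨s, hs⟩ : ∃ s, s = E - V * (w1 * a ^ 2 + E) * a - ξ ^ 2 / 2 * a +
    ξ * (3 * V ^ 2 + 3 * V * ξ + ξ ^ 2) / 3 * a ^ 2 + p * r := ⟨_, rfl⟩
  rw [← hs] at hsb
  have hlog : p * Real.log (1 + u) = V + (T1 + T2 + s) := by
    have h1 : Real.log (1 + u) = r + (u - u ^ 2 / 2 + u ^ 3 / 3) := by rw [hr]; ring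
    rw [h1, hs, hT1, hT2, hu]
    linear_combination ((V + ξ) - (V + ξ) ^ 2 * a / 2 + (V + ξ) ^ 3 * a ^ 2 / 3) * hpa + hξ
      - V * a * hξ
  -- This identity is the reason for the form of `φ⁰` and `φ¹`: they contain precisely the terms
  -- produced by the logarithm and then by the exponential.
  have hcf : correctionFactor p V w0 w1 = 1 + T1 + T2 + T1 ^ 2 / 2 := by
    unfold correctionFactor phi0 phi1
    rw [hT1, hT2, div_eq_mul_inv _ p, div_eq_mul_inv _ (p ^ 2), ← inv_pow, ← ha]
    ring
  have hT1b : |T1| ≤ 2 * (A ^ 2 * a) := by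
    rw [hT1, abs_mul, abs_of_pos ha0, ← mul_assoc]
    gcongr
    have e := abs_sub w0 (V ^ 2 / 2)
    have hV2 : |V ^ 2| ≤ A ^ 2 := by rw [abs_pow]; gcongr
    have : |V ^ 2 / 2| = |V ^ 2| / 2 := by rw [abs_div, abs_two]
    have : 0 ≤ |V ^ 2| := abs_nonneg _
    linarith
  have hT2b : |T2| ≤ 3 * (A ^ 3 * a ^ 2) := by
    rw [hT2, abs_mul, abs_of_pos (by positivity : 0 < a ^ 2), ← mul_assoc]
    gcongr
    have hA23 : A ^ 2 ≤ A ^ 3 := pow_le_pow_right₀ hA (by norm_num)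
    have hV3 : |V ^ 3| ≤ A ^ 3 := by rw [abs_pow]; gcongr
    have e1 : |V * w0| ≤ A ^ 2 := by rw [abs_mul, sq]; gcongr
    have e2 : |V ^ 3 / 3| ≤ A ^ 3 := by
      rw [abs_div, abs_of_pos (by norm_num : (0 : ℝ) < 3)]
      linarith [abs_nonneg (V ^ 3)]
    calc |w1 - V * w0 + V ^ 3 / 3| ≤ |w1 - V * w0| + |V ^ 3 / 3| := abs_add_le _ _
      _ ≤ |w1| + |V * w0| + |V ^ 3 / 3| := by gcongr; exact abs_sub _ _
      _ ≤ 3 * A ^ 3 := by linarith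
  have hfin := abs_exp_sub_le_of_orders ha0 hA hAa hA2a hT1b hT2b hsb
  have e2 : 10 ^ 9 * A ^ 6 / p ^ 3 = 10 ^ 9 * (A ^ 6 * a ^ 3) := by rw [ha, inv_pow]; ring
  rw [Real.rpow_def_of_pos hpos, mul_comm (Real.log _), hlog, Real.exp_add, hcf,
    ← mul_sub, abs_mul, abs_of_pos (Real.exp_pos V), e2]
  exact mul_le_mul_of_nonneg_left hfin (Real.exp_pos V).le

/-! ### The nonlinearity near and far from the core of a bubble -/

lemma abs_correctionFactor_le {p B V w0 w1 : ℝ} (hp : 1 ≤ p) (hB : 1 ≤ B) (hV : |V| ≤ B)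
    (hw0 : |w0| ≤ B) (hw1 : |w1| ≤ B) : |correctionFactor p V w0 w1| ≤ 8 * B ^ 4 := by
  have hp2 : 1 ≤ p ^ 2 := one_le_pow₀ hp
  have p1 : B ≤ B ^ 4 := by simpa using pow_le_pow_right₀ hB (show 1 ≤ 4 by norm_num)
  have p2 : B ^ 2 ≤ B ^ 4 := pow_le_pow_right₀ hB (by norm_num)
  have h0 : |phi0 V| ≤ B ^ 2 := (abs_phi0_le V).trans (by gcongr)
  have h1 := abs_phi1_le hB hV hw0
  have e0 : |(w0 - phi0 V) / p| ≤ 2 * B ^ 4 := by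
    rw [abs_div, abs_of_pos (by linarith : 0 < p)]
    refine (div_le_self (abs_nonneg _) hp).trans ((abs_sub _ _).trans ?_)
    linarith
  have e1 : |(w1 - phi1 V w0) / p ^ 2| ≤ 5 * B ^ 4 := by
    rw [abs_div, abs_of_pos (by linarith : 0 < p ^ 2)]
    refine (div_le_self (abs_nonneg _) hp2).trans ((abs_sub _ _).trans ?_)
    linarith
  unfold correctionFactor
  have := abs_add_le (1 + (w0 - phi0 V) / p) ((w1 - phi1 V w0) / p ^ 2)
  have := abs_add_le 1 ((w0 - phi0 V) / p)
  rw [abs_one] at this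
  linarith

lemma abs_rpow_sub_one_mul {p : ℝ} (hp : 1 < p) (t : ℝ) : |(|t| ^ (p - 1) * t)| = |t| ^ p := by
  rw [abs_mul, abs_of_nonneg (Real.rpow_nonneg (abs_nonneg t) _)]
  rcases eq_or_ne t 0 with rfl | ht
  · simp [Real.zero_rpow (by linarith : p ≠ 0)]
  · rw [Real.rpow_sub_one (abs_ne_zero.2 ht)]
    field_simp

/-- The nonlinearity is controlled by the exponential of its argument. -/
lemma abs_one_add_div_rpow_le {p X V M B : ℝ} (hp : 1 < p)
    (hpM : (M + B) * Real.exp (M + 1) ≤ p) (hX : |X - V| ≤ B) (hV : -p - M ≤ V) :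
    |1 + X / p| ^ p ≤ Real.exp B * Real.exp V + Real.exp (-((M + 1) * p)) := by
  have hp0 : 0 < p := by linarith
  have hXV := abs_le.1 hX
  rcases le_or_gt 0 (1 + X / p) with h | h
  · have h1 : 1 + X / p ≤ Real.exp (X / p) := by linarith [Real.add_one_le_exp (X / p)]
    have h2 : (1 + X / p) ^ p ≤ Real.exp X := by
      calc (1 + X / p) ^ p ≤ Real.exp (X / p) ^ p := Real.rpow_le_rpow h h1 hp0.le
        _ = Real.exp X := by rw [← Real.exp_mul, div_mul_cancel₀ _ hp0.ne']
    rw [abs_of_nonneg h, ← Real.exp_add]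
    have h3 : Real.exp X ≤ Real.exp (B + V) := Real.exp_le_exp.2 (by linarith)
    have := Real.exp_pos (-((M + 1) * p))
    linarith
  · have h1 : |1 + X / p| ≤ Real.exp (-(M + 1)) := by
      rw [abs_of_neg h, Real.exp_neg, ← one_div, le_div_iff₀ (Real.exp_pos _)]
      have e : -(1 + X / p) ≤ (M + B) / p := by
        rw [le_div_iff₀ hp0]
        have : -(1 + X / p) * p = -p - X := by field_simp; ring
        linarith
      calc -(1 + X / p) * Real.exp (M + 1) ≤ (M + B) / p * Real.exp (M + 1) := by gcongr
        _ = ((M + B) * Real.exp (M + 1)) / p := by ring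
        _ ≤ 1 := by rwa [div_le_one hp0]
    have h2 : |1 + X / p| ^ p ≤ Real.exp (-((M + 1) * p)) := by
      calc |1 + X / p| ^ p ≤ Real.exp (-(M + 1)) ^ p :=
            Real.rpow_le_rpow (abs_nonneg _) h1 hp0.le
        _ = _ := by rw [← Real.exp_mul]; congr 1; ring
    have := mul_pos (Real.exp_pos B) (Real.exp_pos V)
    linarith

/-- The error produced by a bubble in its own annulus. -/
lemma exists_own_term_bound {M c : ℝ} (hM : 1 ≤ M) (hc : 0 < c) : ∃ C p₀ : ℝ, 0 < C ∧ 1 < p₀ ∧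
    ∀ p V w0 w1 E L W : ℝ, p₀ ≤ p → 1 ≤ L → |V| ≤ M * L → |w0| ≤ M * L → |w1| ≤ M * L →
      |E| ≤ M → (L ^ 4 ≤ p → |E| ≤ M / p ^ 3) → L ≤ M * p → 0 ≤ W →
      W * Real.exp V ≤ M * Real.exp (-(c * L)) → W ≤ Real.exp (M * p) → -p - M ≤ V →
      W * |(|1 + (V + w0 / p + w1 / p ^ 2 + E) / p| ^ (p - 1) *
        (1 + (V + w0 / p + w1 / p ^ 2 + E) / p)) -
        Real.exp V * correctionFactor p V w0 w1| ≤ C / p ^ 3 := by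
  obtain ⟨Q, hQ0, hQ⟩ := exists_pow_mul_exp_le 16 hc
  have hM0 : 0 < M := by linarith
  -- The exponent `16` is `4 + 12`: four powers of `L` from the correction factor, and twelve from
  -- `p^3 ≤ L^12` in the far region.
  have hQL : ∀ n ≤ 16, ∀ L, 1 ≤ L → L ^ n * Real.exp (-(c * L)) ≤ Q := fun n hn L hL => by
    refine le_trans ?_ (hQ L (by linarith))
    gcongr
    calc L ^ n ≤ L ^ 16 := pow_le_pow_right₀ hL hn
      _ ≤ (1 + L) ^ 16 := by gcongr; linarith
  set B := M * M + M * M + M with hB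
  have hB0 : 0 < B := by positivity
  refine ⟨M * (10 ^ 9 * M ^ 6) * Q + (M * (8 * M ^ 4) * Q + Real.exp B * M * Q + 6),
    2 + (700 * M ^ 2) ^ 2 + (M + B) * Real.exp (M + 1), by positivity, ?_, ?_⟩
  · have : 0 ≤ (700 * M ^ 2) ^ 2 := by positivity
    have : 0 ≤ (M + B) * Real.exp (M + 1) := by positivity
    linarith
  intro p V w0 w1 E L W hp hL hV hw0 hw1 hE hE' hLp hW0 hWV hW hVp
  have a1 : 0 ≤ (700 * M ^ 2) ^ 2 := by positivity
  have a2 : 0 ≤ (M + B) * Real.exp (M + 1) := by positivity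
  have hp1 : 1 < p := by linarith
  have hp0 : 0 < p := by linarith
  have hp3 : 0 < p ^ 3 := by positivity
  have hML : 1 ≤ M * L := one_le_mul_of_one_le_of_one_le hM hL
  obtain ⟨X, hX⟩ : ∃ X, X = V + w0 / p + w1 / p ^ 2 + E := ⟨_, rfl⟩
  rw [← hX]
  have hWVn : ∀ n ≤ 16, W * Real.exp V * L ^ n ≤ M * Q := fun n hn => by
    calc W * Real.exp V * L ^ n ≤ M * Real.exp (-(c * L)) * L ^ n := by gcongr
      _ = M * (L ^ n * Real.exp (-(c * L))) := by ring
      _ ≤ M * Q := by gcongr; exact hQL n hn L hL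
  -- If `L^4 ≤ p`, then `p ≥ (700 M²)²` gives `700 (M L)² ≤ p` and the Taylor expansion applies.
  -- Otherwise both terms are bounded separately and powers of `L` are exchanged for powers of `p`.
  rcases le_or_gt (L ^ 4) p with hcase | hcase
  · have hA : 700 * (M * L) ^ 2 ≤ p := by
      have : (700 * (M * L) ^ 2) ^ 2 ≤ p ^ 2 := by
        calc (700 * (M * L) ^ 2) ^ 2 = (700 * M ^ 2) ^ 2 * L ^ 4 := by ring
          _ ≤ p * p := by gcongr; linarith
          _ = p ^ 2 := by ring
      exact (abs_le_of_sq_le_sq' this hp0.le).2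
    obtain ⟨hpos, hexp⟩ := rpow_expansion hp1.le hML hA hV hw0 hw1
      ((hE' hcase).trans (by gcongr; exact le_mul_of_one_le_right hM0.le hL))
    rw [← hX] at hpos hexp
    have e : |1 + X / p| ^ (p - 1) * (1 + X / p) = (1 + X / p) ^ p := by
      rw [abs_of_pos hpos, Real.rpow_sub_one hpos.ne', div_mul_cancel₀ _ hpos.ne']
    rw [e]
    calc _ ≤ W * (Real.exp V * (10 ^ 9 * (M * L) ^ 6 / p ^ 3)) := by gcongr
      _ = (W * Real.exp V * L ^ 6) * (10 ^ 9 * M ^ 6) / p ^ 3 := by ring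
      _ ≤ (M * Q) * (10 ^ 9 * M ^ 6) / p ^ 3 := by
        gcongr ?_ * _ / _; exact hWVn 6 (by norm_num)
      _ ≤ _ := by
        gcongr
        have : 0 ≤ M * (8 * M ^ 4) * Q + Real.exp B * M * Q + 6 := by positivity
        linarith
  · have hL12 : 1 ≤ L ^ 12 / p ^ 3 := by
      rw [one_le_div hp3]
      calc p ^ 3 ≤ (L ^ 4) ^ 3 := by gcongr
        _ = L ^ 12 := by ring
    have hXV : |X - V| ≤ B := by
      have d0 : |w0 / p| ≤ M * M := by
        rw [abs_div, abs_of_pos hp0, div_le_iff₀ hp0, mul_assoc]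
        exact hw0.trans (by gcongr)
      have d1 : |w1 / p ^ 2| ≤ M * M := by
        rw [abs_div, abs_of_pos (by positivity : 0 < p ^ 2), div_le_iff₀ (by positivity), mul_assoc]
        refine hw1.trans ?_
        gcongr
        refine hLp.trans ?_
        gcongr
        exact le_self_pow₀ hp1.le (by norm_num)
      have e : X - V = w0 / p + w1 / p ^ 2 + E := by rw [hX]; ring
      rw [e]
      calc _ ≤ |w0 / p + w1 / p ^ 2| + |E| := abs_add_le _ _
        _ ≤ |w0 / p| + |w1 / p ^ 2| + |E| := by gcongr; exact abs_add_le _ _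
        _ ≤ _ := by linarith
    have h1 := abs_one_add_div_rpow_le hp1 (by linarith) hXV hVp
    have h2 := abs_correctionFactor_le hp1.le hML hV hw0 hw1
    have h3 : p ^ 3 * Real.exp (-p) ≤ 6 := by
      have := Real.pow_div_factorial_le_exp p hp0.le 3
      rw [Real.exp_neg, ← div_eq_mul_inv, div_le_iff₀ (Real.exp_pos p)]
      norm_num [Nat.factorial] at this
      linarith
    have b1 : W * (Real.exp V * (8 * (M * L) ^ 4)) ≤ M * (8 * M ^ 4) * Q / p ^ 3 := by
      calc W * (Real.exp V * (8 * (M * L) ^ 4)) = (W * Real.exp V * L ^ 4) * (8 * M ^ 4) * 1 := by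
            ring
        _ ≤ (W * Real.exp V * L ^ 4) * (8 * M ^ 4) * (L ^ 12 / p ^ 3) := by gcongr
        _ = (W * Real.exp V * L ^ 16) * (8 * M ^ 4) / p ^ 3 := by ring
        _ ≤ (M * Q) * (8 * M ^ 4) / p ^ 3 := by
          gcongr ?_ * _ / _; exact hWVn 16 le_rfl
        _ = _ := by ring
    have b2 : W * (Real.exp B * Real.exp V) ≤ Real.exp B * M * Q / p ^ 3 := by
      calc W * (Real.exp B * Real.exp V) = Real.exp B * (W * Real.exp V) * 1 := by ring
        _ ≤ Real.exp B * (W * Real.exp V) * (L ^ 12 / p ^ 3) := by gcongr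
        _ = Real.exp B * (W * Real.exp V * L ^ 12) / p ^ 3 := by ring
        _ ≤ Real.exp B * (M * Q) / p ^ 3 := by
          gcongr _ * ?_ / _; exact hWVn 12 (by norm_num)
        _ = _ := by ring
    have b3 : W * Real.exp (-((M + 1) * p)) ≤ 6 / p ^ 3 := by
      calc W * Real.exp (-((M + 1) * p)) ≤ Real.exp (M * p) * Real.exp (-((M + 1) * p)) := by
            gcongr
        _ = Real.exp (-p) := by rw [← Real.exp_add]; congr 1; ring
        _ ≤ 6 / p ^ 3 := by rw [le_div_iff₀ hp3]; linarith
    have b0 : 0 ≤ M * (10 ^ 9 * M ^ 6) * Q / p ^ 3 := by positivity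
    have h4 : |(|1 + X / p| ^ (p - 1) * (1 + X / p)) - Real.exp V * correctionFactor p V w0 w1| ≤
        (Real.exp B * Real.exp V + Real.exp (-((M + 1) * p))) +
          Real.exp V * (8 * (M * L) ^ 4) := by
      refine (abs_sub _ _).trans ?_
      rw [abs_rpow_sub_one_mul hp1, abs_mul, abs_of_pos (Real.exp_pos V)]
      gcongr
    refine (mul_le_mul_of_nonneg_left h4 hW0).trans ?_
    rw [add_div, add_div, add_div, mul_add, mul_add]
    linarith

/-! ### The annuli in logarithmic coordinates -/

/-- Decay of a more concentrated bubble beyond its own annulus. -/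
lemma exponent_inner_le {c ε G s S a η : ℝ} (hc0 : 0 < c) (hc1 : c ≤ 1) (hε : 0 ≤ ε)
    (hεc : ε * (2 + c) ≤ 1) (hG : 0 ≤ G) (hs : -(ε * G) ≤ s) (hS : s + G ≤ S) (ha : 2 ≤ a)
    (hη0 : 0 ≤ η) (hη1 : η ≤ 1) :
    -2 * s - (a - c / 6) * |S| ≤ -(c / 2 * G) ∧ η * s - (a - c / 6) * |S| ≤ -(c / 2 * G) := by
  have hε2 : ε ≤ 1 / 2 := by nlinarith
  have hεG : ε * G ≤ 1 / 2 * G := by gcongr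
  have hSG : 0 ≤ s + G := by linarith
  -- The margin below `1/2` is indispensable: with `a = 2`, `S = s + G` and `s = -εG`, the first
  -- exponent without the `c/6` is `(4ε - 2) G`, which is not negative at `ε = 1/2`. The loss `c/6`
  -- will absorb polynomial factors.
  have hεc' : ε ≤ 1 / 2 - c / 6 := by nlinarith
  have hεG' : ε * G ≤ (1 / 2 - c / 6) * G := by gcongr
  have hcG : 0 ≤ c * G := by positivity
  have hcG1 : c * G ≤ G := by nlinarith
  have h1 : (2 - c / 6) * (s + G) ≤ (a - c / 6) * |S| := by
    have : s + G ≤ |S| := hS.trans (le_abs_self S)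
    apply mul_le_mul (by linarith) this hSG (by linarith)
  have hcs : c * (s + G) ≤ c * (s + G) := le_rfl
  have h2 : -(c * (ε * G)) ≤ c * s := by nlinarith
  have h3 : c * (ε * G) ≤ c * G := by gcongr; nlinarith
  constructor
  · nlinarith
  · rcases le_total 0 s with h | h
    · nlinarith [mul_nonneg h (sub_nonneg.2 hη1), mul_nonneg h hc0.le, mul_nonneg h (sub_nonneg.2 hc1)]
    · have h4 : η * s ≤ 0 := mul_nonpos_of_nonneg_of_nonpos hη0 h
      nlinarith [mul_nonneg hc0.le hSG, mul_nonneg (sub_nonneg.2 hc1) hSG]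

/-- Decay of a less concentrated bubble inside its own annulus. -/
lemma exponent_outer_le {c ε G s S a b η : ℝ} (hc0 : 0 < c) (hc1 : c ≤ 1) (hε : 0 ≤ ε)
    (hε2 : ε ≤ 1 / 2) (hG : 0 ≤ G) (hs : s ≤ (1 - ε) * G) (hS : S ≤ s - G) (ha : 5 ≤ a)
    (haε : 4 * (1 - ε) ≤ a * ε) (hb : a ≤ b) (hη0 : 0 ≤ η) (hη1 : η ≤ 1) :
    -2 * s - (b - c / 6) * |S| ≤ -(c / 2 * G) ∧ η * s - (b - c / 6) * |S| ≤ -(c / 2 * G) := by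
  have hcG : 0 ≤ c * G := by positivity
  have hcG1 : c * G ≤ G := by nlinarith
  have hεG : 0 ≤ ε * G := by positivity
  have hGs : 0 ≤ G - s := by linarith
  have h1 : (a - c / 6) * (G - s) ≤ (b - c / 6) * |S| := by
    have : G - s ≤ |S| := by linarith [neg_le_abs S]
    apply mul_le_mul (by linarith) this hGs (by linarith)
  constructor
  · have h2 : (a - c / 6 - 2) * s ≤ (a - c / 6 - 2) * G :=
      mul_le_mul_of_nonneg_left (by linarith) (by linarith)
    linarith
  · have h2 : (η + a - c / 6) * s ≤ (η + a - c / 6) * ((1 - ε) * G) :=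
      mul_le_mul_of_nonneg_left hs (by linarith)
    -- At the outer end `s = (1 - ε) G` the exponent is `(η (1 - ε) - a ε) G`, apart from the `c/6`,
    -- hence at most `-3 (1 - ε) G`.
    have h3 : 4 * (1 - ε) * G ≤ a * ε * G := by gcongr
    have h4 : η * ((1 - ε) * G) ≤ 1 * ((1 - ε) * G) := by
      gcongr
      exact mul_nonneg (by linarith) hG
    have h5 : ε * G ≤ 1 / 2 * G := by gcongr
    have h6 : c * (ε * G) ≤ 1 * (ε * G) := by gcongr
    linarith

namespace Tower

variable {T : Tower} {k : ℕ} {p M c : ℝ}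

/-- The scale `ln δ_i`. -/
def scale (T : Tower) (i : ℕ) : ℝ := Real.log (T.δ i)

/-- A logarithmic radius `l` in the range of the annulus `A_j`. -/
structure InRange (T : Tower) (k : ℕ) (R : ℝ) (j : ℕ) (l : ℝ) : Prop where
  lower : 1 < j → -(T.ε (j - 1) * (T.scale j - T.scale (j - 1))) ≤ l - T.scale j
  upper : j < k → l - T.scale j ≤ (1 - T.ε j) * (T.scale (j + 1) - T.scale j)
  top : l ≤ R

lemma log_radius {j : ℕ} (h1 : 0 < T.δ j) (h2 : 0 < T.δ (j + 1)) :
    Real.log (T.radius j) = T.ε j * T.scale j + (1 - T.ε j) * T.scale (j + 1) := by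
  unfold radius scale
  rw [Real.log_mul (Real.rpow_pos_of_pos h1 _).ne' (Real.rpow_pos_of_pos h2 _).ne',
    Real.log_rpow h1, Real.log_rpow h2]

lemma radius_pos {j : ℕ} (h1 : 0 < T.δ j) (h2 : 0 < T.δ (j + 1)) : 0 < T.radius j :=
  mul_pos (Real.rpow_pos_of_pos h1 _) (Real.rpow_pos_of_pos h2 _)

/-! ### Position of the annuli relative to the scales -/

namespace Spaced

variable (h : T.Spaced k p M c)
include h

lemma inRange {Ω : Set Plane} {R : ℝ} (hR : ∀ x ∈ Ω, x ≠ 0 → Real.log ‖x‖ ≤ R) {j : ℕ}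
    (hj : j ∈ Finset.Icc 1 k) {x : Plane} (hx : x ∈ T.annulus Ω k j) (hx0 : x ≠ 0) :
    T.InRange k R j (Real.log ‖x‖) := by
  obtain ⟨hj1, hjk⟩ := Finset.mem_Icc.1 hj
  have hpos := norm_pos_iff.2 hx0
  have hδj := h.delta_pos j hj
  refine ⟨fun h1 => ?_, fun h1 => ?_, hR x hx.1 hx0⟩
  · obtain ⟨m, rfl⟩ : ∃ m, j = m + 1 := ⟨j - 1, by omega⟩
    have hδm := h.delta_pos m (Finset.mem_Icc.2 ⟨by omega, by omega⟩)
    have h2 := Real.log_le_log (by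
      rw [Nat.add_sub_cancel]; exact radius_pos hδm hδj) (hx.2.1 h1)
    rw [Nat.add_sub_cancel] at h2 ⊢
    rw [log_radius hδm hδj] at h2
    linarith
  · have hδ' := h.delta_pos (j + 1) (Finset.mem_Icc.2 ⟨by omega, h1⟩)
    have h2 := Real.log_le_log hpos (hx.2.2 h1).le
    rw [log_radius hδj hδ'] at h2
    linarith

lemma eps_nonneg {j : ℕ} (hj : j ∈ Finset.Ico 1 k) : 0 ≤ T.ε j := by
  obtain ⟨h1, h2⟩ := Finset.mem_Ico.1 hj
  have t1 := h.tau_pos j (Finset.mem_Icc.2 ⟨h1, h2.le⟩)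
  have t2 := h.tau_pos (j + 1) (Finset.mem_Icc.2 ⟨by omega, h2⟩)
  unfold ε; positivity

/-- The factor `1 + c` between consecutive `τ`'s keeps `ε_j` below `1/2` by a margin independent of
`p`. -/
lemma eps_mul_le {j : ℕ} (hj : j ∈ Finset.Ico 1 k) : T.ε j * (2 + c) ≤ 1 := by
  obtain ⟨h1, h2⟩ := Finset.mem_Ico.1 hj
  have t1 := h.tau_pos j (Finset.mem_Icc.2 ⟨h1, h2.le⟩)
  have t2 := h.tau_pos (j + 1) (Finset.mem_Icc.2 ⟨by omega, h2⟩)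
  have t3 := h.tau_succ j hj
  unfold ε
  rw [div_mul_eq_mul_div, div_le_one (by positivity)]
  linarith

lemma one_sub_eps_eq {j : ℕ} (hj : j ∈ Finset.Ico 1 k) :
    1 - T.ε j = T.ε j * (T.τ j / T.τ (j + 1)) ∧ (1 - T.ε j) * (1 + T.τ (j + 1) / T.τ j) = 1 := by
  obtain ⟨h1, h2⟩ := Finset.mem_Ico.1 hj
  have t1 := h.tau_pos j (Finset.mem_Icc.2 ⟨h1, h2.le⟩)
  have t2 := h.tau_pos (j + 1) (Finset.mem_Icc.2 ⟨by omega, h2⟩)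
  have t3 : 0 < T.τ j + T.τ (j + 1) := by positivity
  unfold ε
  constructor
  · field_simp; ring
  · field_simp; ring

lemma scale_mono (hcp : 0 ≤ c * p) {i j : ℕ} (hi : 1 ≤ i) (hij : i ≤ j) (hj : j ≤ k) :
    T.scale i ≤ T.scale j := by
  refine monotone_of_lt_succ (fun i hi => ?_) hi hij hj
  have := h.gap i hi
  unfold scale; linarith

/-- The essential relation between `α_{j+1}` and the position of the radius. -/
lemma four_mul_le (hc : 0 ≤ c) (hp : 0 < p) (hMp : M ≤ p) {j : ℕ} (hj : j ∈ Finset.Ico 1 k) :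
    5 ≤ T.α (j + 1) ∧ 4 * (1 - T.ε j) ≤ T.α (j + 1) * T.ε j := by
  obtain ⟨h1, h2⟩ := Finset.mem_Ico.1 hj
  have hj' : j ∈ Finset.Icc 1 k := Finset.mem_Icc.2 ⟨h1, h2.le⟩
  have t2 := h.tau_pos (j + 1) (Finset.mem_Icc.2 ⟨by omega, h2⟩)
  have a1 := h.alpha_ge j hj'
  have a2 := (abs_le.1 (h.alpha_succ j hj)).1
  have a3 : M / p ≤ 1 := by rwa [div_le_one hp]
  have e1 := (h.one_sub_eps_eq hj).1
  have e2 := h.eps_nonneg hj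
  have r1 : 1 ≤ T.τ j / T.τ (j + 1) := by
    rw [one_le_div t2]
    have := h.tau_succ j hj
    have := mul_nonneg hc t2.le
    linarith
  have r2 : 4 * (T.τ j / T.τ (j + 1)) ≤ T.τ j / T.τ (j + 1) * (T.α j + 2) := by
    rw [mul_comm 4]
    exact mul_le_mul_of_nonneg_left (by linarith) (by linarith)
  -- `alpha_succ` gives `α_{j+1} ≥ 2 + 4 τ_j / τ_{j+1} - M/p`, and `M/p ≤ 1`. Multiplied by `ε_j`,
  -- the ratio becomes `1 - ε_j`.
  have r3 : 4 * (T.τ j / T.τ (j + 1)) + 1 ≤ T.α (j + 1) := by linarith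
  refine ⟨by linarith, ?_⟩
  have := mul_le_mul_of_nonneg_right r3 e2
  rw [e1]
  linarith

variable {R : ℝ} {j : ℕ} {l : ℝ}

/-- The other bubbles are negligible in `A_j`. -/
lemma exponent_le (hc0 : 0 < c) (hc1 : c ≤ 1) (hp : 0 < p) (hMp : M ≤ p)
    (hj : j ∈ Finset.Icc 1 k) (hl : T.InRange k R j l) {i : ℕ} (hi : i ∈ Finset.Icc 1 k)
    (hij : i ≠ j) {η : ℝ} (hη0 : 0 ≤ η) (hη1 : η ≤ 1) :
    -2 * (l - T.scale j) - (T.α i - c / 6) * |l - T.scale i| ≤ -(c / 2 * (c * p)) ∧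
      η * (l - T.scale j) - (T.α i - c / 6) * |l - T.scale i| ≤ -(c / 2 * (c * p)) := by
  obtain ⟨hj1, hjk⟩ := Finset.mem_Icc.1 hj
  obtain ⟨hi1, hik⟩ := Finset.mem_Icc.1 hi
  have hcp : 0 ≤ c * p := by positivity
  rcases lt_or_gt_of_ne hij with hlt | hgt
  · obtain ⟨m, rfl⟩ : ∃ m, j = m + 1 := ⟨j - 1, by omega⟩
    have hm : m ∈ Finset.Ico 1 k := Finset.mem_Ico.2 ⟨by omega, by omega⟩
    have hg : c * p ≤ T.scale (m + 1) - T.scale m := h.gap m hm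
    have hlow := hl.lower (by omega)
    rw [Nat.add_sub_cancel] at hlow
    have hmono := h.scale_mono hcp hi1 (by omega : i ≤ m) (by omega)
    obtain ⟨q1, q2⟩ := exponent_inner_le hc0 hc1 (h.eps_nonneg hm) (h.eps_mul_le hm)
      (hcp.trans hg) hlow (S := l - T.scale i) (by linarith) (h.alpha_ge i hi) hη0 hη1
    have : c / 2 * (c * p) ≤ c / 2 * (T.scale (m + 1) - T.scale m) := by gcongr
    constructor <;> linarith
  · have hm : j ∈ Finset.Ico 1 k := Finset.mem_Ico.2 ⟨hj1, by omega⟩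
    have hg : c * p ≤ T.scale (j + 1) - T.scale j := h.gap j hm
    have hmono := h.scale_mono hcp (by omega : 1 ≤ j + 1) (by omega : j + 1 ≤ i) hik
    obtain ⟨f1, f2⟩ := h.four_mul_le hc0.le hp hMp hm
    have he := h.eps_mul_le hm
    have he0 := h.eps_nonneg hm
    have hec : 0 ≤ T.ε j * c := by positivity
    obtain ⟨q1, q2⟩ := exponent_outer_le hc0 hc1 he0 (by linarith)
      (hcp.trans hg) (hl.upper (by omega)) (S := l - T.scale i) (by linarith) f1 f2
      (h.alpha_mono (j + 1) i (by omega) (by omega) hik) hη0 hη1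
    have : c / 2 * (c * p) ≤ c / 2 * (T.scale (j + 1) - T.scale j) := by gcongr
    constructor <;> linarith

/-- Position of `x ∈ A_j` relative to a more concentrated bubble. -/
lemma position_inner (hc0 : 0 < c) (hp : 0 < p) (hj : j ∈ Finset.Icc 1 k)
    (hl : T.InRange k R j l) {i : ℕ} (hi : 1 ≤ i) (hij : i < j) :
    0 ≤ l - T.scale i ∧ l - T.scale j + c * p ≤ l - T.scale i := by
  obtain ⟨hj1, hjk⟩ := Finset.mem_Icc.1 hj
  have hcp : 0 ≤ c * p := by positivity
  obtain ⟨m, rfl⟩ : ∃ m, j = m + 1 := ⟨j - 1, by omega⟩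
  have hm : m ∈ Finset.Ico 1 k := Finset.mem_Ico.2 ⟨by omega, by omega⟩
  have hg : c * p ≤ T.scale (m + 1) - T.scale m := h.gap m hm
  have hlow := hl.lower (by omega)
  rw [Nat.add_sub_cancel] at hlow
  have hmono := h.scale_mono hcp hi (by omega : i ≤ m) (by omega)
  have he := h.eps_mul_le hm
  have he0 := h.eps_nonneg hm
  have hec : 0 ≤ T.ε m * c := by positivity
  have : T.ε m * (T.scale (m + 1) - T.scale m) ≤ 1 * (T.scale (m + 1) - T.scale m) :=
    mul_le_mul_of_nonneg_right (by linarith) (by linarith)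
  constructor <;> linarith

/-- Position of `x ∈ A_j` relative to a less concentrated bubble. -/
lemma position_outer (hc0 : 0 < c) (hp : 0 < p) (hj : j ∈ Finset.Icc 1 k)
    (hl : T.InRange k R j l) {i : ℕ} (hi : i ≤ k) (hij : j < i) :
    l - T.scale i ≤ 0 ∧ l - T.scale i ≤ l - T.scale j - c * p := by
  obtain ⟨hj1, hjk⟩ := Finset.mem_Icc.1 hj
  have hcp : 0 ≤ c * p := by positivity
  have hm : j ∈ Finset.Ico 1 k := Finset.mem_Ico.2 ⟨hj1, by omega⟩
  have hg : c * p ≤ T.scale (j + 1) - T.scale j := h.gap j hm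
  have hup := hl.upper (by omega)
  have hmono := h.scale_mono hcp (by omega : 1 ≤ j + 1) (by omega : j + 1 ≤ i) hi
  have he0 := h.eps_nonneg hm
  have : 0 ≤ T.ε j * (T.scale (j + 1) - T.scale j) := mul_nonneg he0 (by linarith)
  constructor <;> linarith

lemma scale_mem {i : ℕ} (hi : i ∈ Finset.Icc 1 k) :
    -(M * p) ≤ T.scale i ∧ T.scale i ≤ -(c * p) := ⟨h.log_ge i hi, h.log_le i hi⟩

lemma s_le (hj : j ∈ Finset.Icc 1 k) (hl : T.InRange k R j l) : l - T.scale j ≤ R + M * p := by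
  linarith [hl.top, (h.scale_mem hj).1]

lemma neg_s_le (hc0 : 0 < c) (hp : 0 < p) (hj : j ∈ Finset.Icc 1 k) (hj1 : 1 < j)
    (hl : T.InRange k R j l) : -(M * p) ≤ l - T.scale j := by
  obtain ⟨-, hjk⟩ := Finset.mem_Icc.1 hj
  have hcp : 0 ≤ c * p := by positivity
  obtain ⟨m, rfl⟩ : ∃ m, j = m + 1 := ⟨j - 1, by omega⟩
  have hm : m ∈ Finset.Ico 1 k := Finset.mem_Ico.2 ⟨by omega, by omega⟩
  have hg : c * p ≤ T.scale (m + 1) - T.scale m := h.gap m hm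
  have hlow := hl.lower (by omega)
  rw [Nat.add_sub_cancel] at hlow
  have he := h.eps_mul_le hm
  have he0 := h.eps_nonneg hm
  have hec : 0 ≤ T.ε m * c := by positivity
  have h1 : T.ε m * (T.scale (m + 1) - T.scale m) ≤ 1 * (T.scale (m + 1) - T.scale m) :=
    mul_le_mul_of_nonneg_right (by linarith) (by linarith)
  have h2 := (h.scale_mem (i := m) (Finset.mem_Icc.2 ⟨by omega, by omega⟩)).1
  have h3 := (h.scale_mem hj).2
  linarith

/-- The leading-order value of the approximate solution stays nonnegative in `A_j`, up to a
bounded error: outer side. -/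
lemma slope_upper (hc0 : 0 < c) (hR : 0 ≤ R) (hM : 0 ≤ M)
    (hj : j ∈ Finset.Icc 1 k) (hl : T.InRange k R j l) :
    (T.α j + 2) * (l - T.scale j) ≤ p + M + (M + 2) * R := by
  obtain ⟨hj1, hjk⟩ := Finset.mem_Icc.1 hj
  have ha := h.alpha_ge j hj
  have ha' := h.alpha_le j hj
  have hMR : 0 ≤ (M + 2) * R := by positivity
  rcases eq_or_lt_of_le hjk with rfl | hlt
  · have h1 := (abs_le.1 h.slope_last).1
    have h2 : (T.α j + 2) * l ≤ (M + 2) * R := by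
      calc (T.α j + 2) * l ≤ (T.α j + 2) * R := mul_le_mul_of_nonneg_left hl.top (by linarith)
        _ ≤ _ := by gcongr
    unfold scale
    linarith
  · have hm : j ∈ Finset.Ico 1 k := Finset.mem_Ico.2 ⟨hj1, hlt⟩
    have h1 := (abs_le.1 (h.slope j hm)).2
    have h2 := mul_le_mul_of_nonneg_left (hl.upper hlt) (by linarith : 0 ≤ T.α j + 2)
    have he := h.eps_mul_le hm
    have he0 := h.eps_nonneg hm
    have hec : 0 ≤ T.ε j * c := by positivity
    have h3 := mul_le_mul_of_nonneg_left h1 (by linarith : 0 ≤ 1 - T.ε j)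
    have h4 := (h.one_sub_eps_eq hm).2
    have h5 : T.ε j * M ≥ 0 := by positivity
    unfold scale at *
    -- The factor `1 - ε_j` is the reciprocal of `1 + τ_{j+1} / τ_j`, so the slope relation
    -- evaluated at the separating radius returns exactly `p`: to leading order `p + 𝒱` vanishes
    -- there.
    have h6 : (1 - T.ε j) * (p * (1 + T.τ (j + 1) / T.τ j)) = p := by
      linear_combination p * h4
    linarith

/-- The same on the inner side. -/
lemma slope_lower (hc0 : 0 < c) (hp : 0 < p) (hM : 0 ≤ M)
    (hj : j ∈ Finset.Icc 1 k) (hl : T.InRange k R j l) (hs : l - T.scale j ≤ 0) :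
    -p - M - M * M ≤ (T.α j - 2) * (l - T.scale j) := by
  obtain ⟨hj1, hjk⟩ := Finset.mem_Icc.1 hj
  rcases eq_or_lt_of_le hj1 with rfl | hlt
  · rw [h.alpha_one, sub_self, zero_mul]
    have : 0 ≤ M * M := by positivity
    linarith
  obtain ⟨m, rfl⟩ : ∃ m, j = m + 1 := ⟨j - 1, by omega⟩
  have hm : m ∈ Finset.Ico 1 k := Finset.mem_Ico.2 ⟨by omega, by omega⟩
  have hcp : 0 ≤ c * p := by positivity
  have hg : c * p ≤ T.scale (m + 1) - T.scale m := h.gap m hm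
  have ha := h.alpha_ge (m + 1) hj
  have hlow := mul_le_mul_of_nonneg_left (hl.lower (by omega)) (by linarith : 0 ≤ T.α (m + 1) - 2)
  rw [Nat.add_sub_cancel] at hlow
  have h1 := (abs_le.1 (h.slope m hm)).2
  have h2 := (abs_le.1 (h.alpha_succ m hm)).2
  have he := h.eps_mul_le hm
  have he0 := h.eps_nonneg hm
  have hec : 0 ≤ T.ε m * c := by positivity
  obtain ⟨e1, e2⟩ := h.one_sub_eps_eq hm
  have hG : T.scale (m + 1) - T.scale m ≤ M * p := by
    have h2 := (h.scale_mem (i := m) (Finset.mem_Icc.2 ⟨by omega, by omega⟩)).1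
    have h3 := (h.scale_mem hj).2
    linarith
  unfold scale at *
  set G := Real.log (T.δ (m + 1)) - Real.log (T.δ m)
  have hG0 : 0 ≤ T.ε m * G := mul_nonneg he0 (by linarith)
  have h3 := mul_le_mul_of_nonneg_right h2 hG0
  have h4 := mul_le_mul_of_nonneg_left h1 (by linarith : 0 ≤ 1 - T.ε m)
  have h5 : (1 - T.ε m) * (p * (1 + T.τ (m + 1) / T.τ m)) = p := by
    linear_combination p * e2
  have h6 : M / p * (T.ε m * G) ≤ M * M := by
    calc M / p * (T.ε m * G) ≤ M / p * (1 * (M * p)) := by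
          have : T.ε m * G ≤ 1 * (M * p) := mul_le_mul (by linarith) hG (by linarith) zero_le_one
          gcongr
      _ = M * M := by field_simp
  -- The inner slope of bubble `m + 1` and the outer slope of bubble `m` describe the same radius,
  -- so the bound at the inner edge reduces to the computation at the outer edge of the preceding
  -- annulus.
  have h7 : T.τ m / T.τ (m + 1) * (T.α m + 2) * (T.ε m * G) = (1 - T.ε m) * ((T.α m + 2) * G) := by
    linear_combination (-(T.α m + 2) * G) * e1
  have h8 : 0 ≤ T.ε m * M := by positivity
  linarith

end Spaced
end Tower

/-! ### Expansion of the approximate solution in an annulus -/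

lemma mass_eq {α : ℝ} (hα : 0 < α) {y : Plane} (hy : y ≠ 0) :
    mass α y = 2 * α ^ 2 * (Real.exp (-2 * Real.log ‖y‖) * kern (α * Real.log ‖y‖)) := by
  have h1 := norm_sq_mul_mass hα hy
  rw [norm_sq_eq_exp hy] at h1
  have h2 : Real.exp (-2 * Real.log ‖y‖) * Real.exp (2 * Real.log ‖y‖) = 1 := by
    rw [← Real.exp_add]; simp
  linear_combination Real.exp (-2 * Real.log ‖y‖) * h1 - mass α y * h2

lemma mass_le {α : ℝ} (hα : 0 < α) {y : Plane} (hy : y ≠ 0) :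
    mass α y ≤ 2 * α ^ 2 * Real.exp (-2 * Real.log ‖y‖ - α * |Real.log ‖y‖|) := by
  have h := kern_le (α * Real.log ‖y‖)
  rw [abs_mul, abs_of_pos hα] at h
  rw [mass_eq hα hy, sub_eq_add_neg, Real.exp_add]
  gcongr

lemma bigV_ge {α : ℝ} (hα : 2 ≤ α) {y : Plane} (hy : y ≠ 0) :
    (0 ≤ Real.log ‖y‖ → -((α + 2) * Real.log ‖y‖) - 2 ≤ bigV α y) ∧
      (Real.log ‖y‖ ≤ 0 → (α - 2) * Real.log ‖y‖ - 2 ≤ bigV α y) := by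
  have h1 := (abs_le.1 (abs_log_one_add_exp_le (α * Real.log ‖y‖))).2
  have h2 : 0 ≤ Real.log (2 * α ^ 2) := Real.log_nonneg (by nlinarith)
  have h3 := Real.log_two_lt_d9
  unfold bigV
  rw [bubbleOne_eq (by linarith) hy]
  constructor
  · intro hs
    rw [max_eq_left (mul_nonneg (by linarith) hs)] at h1
    linarith
  · intro hs
    rw [max_eq_right (mul_nonpos_of_nonneg_of_nonpos (by linarith) hs)] at h1
    linarith

/-- The size of the logarithmic terms at `|y| = e^s`; near the first bubble nothing is singular at
`y = 0`. -/
def logSize (j : ℕ) (s : ℝ) : ℝ := if j = 1 then 1 + max s 0 else 1 + |s|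

lemma one_add_max_le_logSize (j : ℕ) (s : ℝ) : 1 + max s 0 ≤ logSize j s := by
  unfold logSize
  split_ifs
  · exact le_rfl
  · gcongr
    exact max_le (le_abs_self s) (abs_nonneg s)

lemma one_le_logSize (j : ℕ) (s : ℝ) : 1 ≤ logSize j s :=
  le_trans (by linarith [le_max_right s 0]) (one_add_max_le_logSize j s)

/-- The interaction of the `i`-th bubble with points of `A_j`. -/
def cross (T : Tower) (i j : ℕ) (l : ℝ) : ℝ :=
  if i < j then Real.exp (-(l - T.scale i)) else
    if j < i then Real.exp (l - T.scale i) else 0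

namespace Tower

variable {T : Tower} {k : ℕ} {p M c R : ℝ} {j : ℕ}

lemma sum_Icc_split {j k : ℕ} (hj : j ∈ Finset.Icc 1 k) (f : ℕ → ℝ) :
    ∑ i ∈ Finset.Icc 1 k, f i =
      ∑ i ∈ Finset.Ico 1 j, f i + f j + ∑ i ∈ Finset.Ioc j k, f i := by
  obtain ⟨h1, h2⟩ := Finset.mem_Icc.1 hj
  rw [← Finset.sum_Ico_succ_top h1]
  have e1 : Finset.Icc 1 k = Finset.Ico 1 (k + 1) := by ext i; simp
  have e2 : Finset.Ioc j k = Finset.Ico (j + 1) (k + 1) := by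
    ext i; simp only [Finset.mem_Ioc, Finset.mem_Ico]; omega
  rw [e1, e2, Finset.sum_Ico_consecutive _ (by omega) (by omega)]

/-- Leading part of the `i`-th projected bubble in `A_j`, at logarithmic radius `l`; `q` stands for
the value of the `j`-th profile. -/
def leading (T : Tower) (p : ℝ) (j : ℕ) (l q : ℝ) (i : ℕ) : ℝ :=
  if i < j then -(2 * T.αw p i * l) else
    if j < i then -(2 * T.αw p i * T.scale i) + (T.w0 i 0 / p + T.w1 i 0 / p ^ 2) else
      q - (T.α j - 2) * (l - T.scale j) - Real.log (2 * T.α j ^ 2) - 2 * T.αw p j * T.scale j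

/-- The system is equivalent to the matching of the leading parts. -/
lemma SolvesSystem.sum_leading {h0 : ℝ} (hS : T.SolvesSystem k h0 p) (hj : j ∈ Finset.Icc 1 k)
    (hτ : T.τ j ≠ 0) (l q : ℝ) :
    ∑ i ∈ Finset.Icc 1 k, (-1) ^ (i + j) * (T.τ i / T.τ j) *
      (T.leading p j l q i + 4 * Real.pi * T.αw p i * h0) = p + q := by
  have h1 := hS.delta_eq hj
  have h2 := hS.sum_lt hj
  have h3 := two_mul_aw T p j
  have e0 : ∑ i ∈ Finset.Icc 1 k, (-1) ^ (i + j) * (T.τ i / T.τ j) *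
      (T.leading p j l q i + 4 * Real.pi * T.αw p i * h0) =
      ∑ i ∈ Finset.Icc 1 k, (-1) ^ (i + j) * (T.τ i / T.τ j) * T.leading p j l q i +
      4 * Real.pi * h0 * ∑ i ∈ Finset.Icc 1 k,
        (-1) ^ (i + j) * (T.τ i / T.τ j) * T.αw p i := by
    rw [Finset.mul_sum, ← Finset.sum_add_distrib]
    exact Finset.sum_congr rfl fun i _ => by ring
  -- The more concentrated bubbles contribute `(α_j - 2) l`, which cancels the `l`-dependence of the
  -- `j`-th leading part. The remaining constants match by `delta_eq`.
  have e1 : ∑ i ∈ Finset.Ico 1 j, (-1) ^ (i + j) * (T.τ i / T.τ j) * T.leading p j l q i =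
      -l * (2 - T.α j) := by
    rw [← h2, Finset.mul_sum]
    refine Finset.sum_congr rfl fun i hi => ?_
    unfold leading
    rw [if_pos (Finset.mem_Ico.1 hi).2]
    ring
  have e2 : ∑ i ∈ Finset.Ioc j k, (-1) ^ (i + j) * (T.τ i / T.τ j) * T.leading p j l q i =
      -(2 * ∑ i ∈ Finset.Ioc j k, (-1) ^ (i + j) * (T.τ i / T.τ j) * T.αw p i *
        Real.log (T.δ i)) + ∑ i ∈ Finset.Ioc j k, (-1) ^ (i + j) * (T.τ i / T.τ j) *
        (T.w0 i 0 / p + T.w1 i 0 / p ^ 2) := by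
    rw [Finset.mul_sum, ← Finset.sum_neg_distrib, ← Finset.sum_add_distrib]
    refine Finset.sum_congr rfl fun i hi => ?_
    have hi' := (Finset.mem_Ioc.1 hi).1
    unfold leading scale
    rw [if_neg (by omega), if_pos hi']
    ring
  have e3 : ((-1 : ℝ)) ^ (j + j) * (T.τ j / T.τ j) = 1 := by
    rw [div_self hτ, ← two_mul, pow_mul]; simp
  rw [e0, sum_Icc_split hj fun i => (-1) ^ (i + j) * (T.τ i / T.τ j) * T.leading p j l q i,
    e1, e2, e3]
  unfold c at h1
  unfold leading scale
  rw [if_neg (lt_irrefl j), if_neg (lt_irrefl j)]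
  linear_combination h1 - Real.log (T.δ j) * h3

section Bubble

variable {Mw : ℝ} {i : ℕ} {x : Plane}

lemma log_one_add_exp_neg (t : ℝ) :
    Real.log (1 + Real.exp t) - t = Real.log (1 + Real.exp (-t)) := by
  have : 1 + Real.exp t = Real.exp t * (1 + Real.exp (-t)) := by
    rw [mul_add, ← Real.exp_add]; simp; ring
  rw [this, Real.log_mul (Real.exp_ne_zero _) (by positivity), Real.log_exp]
  ring

lemma abs_log_one_add_exp_le_exp {α t : ℝ} (hα : 1 ≤ α) (ht : t ≤ 0) :
    |Real.log (1 + Real.exp (α * t))| ≤ Real.exp t := by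
  have h0 : 0 ≤ Real.log (1 + Real.exp (α * t)) :=
    Real.log_nonneg (by linarith [Real.exp_pos (α * t)])
  have h1 := Real.log_le_sub_one_of_pos (x := 1 + Real.exp (α * t)) (by positivity)
  have h2 : Real.exp (α * t) ≤ Real.exp t := Real.exp_le_exp.2 (by nlinarith)
  rw [abs_of_nonneg h0]
  linarith

/-- Comparison of a corrected bubble with its leading part in `A_j`. -/
lemma abs_corrected_sub_leading_le (h : T.Spaced k p M c) (hc0 : 0 < c) (hp : 1 ≤ p)
    (hj : j ∈ Finset.Icc 1 k) (hi : i ∈ Finset.Icc 1 k)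
    (hb0 : ProfileBounds Mw (T.w0 i) (T.C0 i)) (hb1 : ProfileBounds Mw (T.w1 i) (T.C1 i))
    (hx0 : x ≠ 0) (hl : T.InRange k R j (Real.log ‖x‖)) :
    |T.corrected p i x - Real.log (2 * T.α i ^ 2) - T.α i * T.scale i + T.rate p i * T.scale i -
      T.leading p j (Real.log ‖x‖) (bigV (T.α j) ((T.δ j)⁻¹ • x) + T.w0 j ((T.δ j)⁻¹ • x) / p +
        T.w1 j ((T.δ j)⁻¹ • x) / p ^ 2) i| ≤ (2 + 2 * Mw) * cross T i j (Real.log ‖x‖) := by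
  obtain ⟨hi1, hik⟩ := Finset.mem_Icc.1 hi
  have hδ := h.delta_pos i hi
  have hα := h.alpha_ge i hi
  have hα0 : 0 < T.α i := by linarith
  have hMw : 0 ≤ Mw := (abs_nonneg _).trans hb0.rate
  have hp0 : 0 < p := by linarith
  have hp2 : 1 ≤ p ^ 2 := one_le_pow₀ hp
  have hy0 : (T.δ i)⁻¹ • x ≠ 0 := smul_ne_zero (inv_ne_zero hδ.ne') hx0
  have hylog : Real.log ‖(T.δ i)⁻¹ • x‖ = Real.log ‖x‖ - T.scale i := log_norm_inv_smul hδ hx0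
  have hynorm : ‖(T.δ i)⁻¹ • x‖ = Real.exp (Real.log ‖x‖ - T.scale i) := by
    rw [← hylog, Real.exp_log (norm_pos_iff.2 hy0)]
  have haw := two_mul_aw T p i
  have hbub := bubble_eq hα0 hδ hx0
  have hcor : T.corrected p i x = bubble (T.α i) (T.δ i) x + T.w0 i ((T.δ i)⁻¹ • x) / p +
    T.w1 i ((T.δ i)⁻¹ • x) / p ^ 2 := rfl
  have hdiv : ∀ z B : ℝ, |z| ≤ B → |z / p| ≤ B ∧ |z / p ^ 2| ≤ B := fun z B hz => by
    rw [abs_div, abs_div, abs_of_pos hp0, abs_of_pos (by positivity : 0 < p ^ 2)]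
    exact ⟨(div_le_self (abs_nonneg _) hp).trans hz, (div_le_self (abs_nonneg _) hp2).trans hz⟩
  rw [hcor, hbub]
  unfold leading cross
  change |_ - T.α i * T.scale i - 2 * Real.log (1 + Real.exp (T.α i * (Real.log ‖x‖ - T.scale i))) +
    _ + _ - _ - _ + _ - _| ≤ _
  obtain ⟨l, hl'⟩ : ∃ l, l = Real.log ‖x‖ := ⟨_, rfl⟩
  rw [← hl'] at hl hylog hynorm ⊢
  rcases lt_trichotomy i j with hij | hij | hij
  · rw [if_pos hij, if_pos hij]
    have hs := (h.position_inner hc0 hp0 hj hl hi1 hij).1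
    have hge : 1 ≤ ‖(T.δ i)⁻¹ • x‖ := by rw [hynorm]; exact Real.one_le_exp hs
    have t0 := (hdiv _ _ (hb0.far _ hge)).1
    have t1 := (hdiv _ _ (hb1.far _ hge)).2
    have t2 := abs_log_one_add_exp_le_exp (α := T.α i) (by linarith)
      (neg_nonpos.2 hs)
    rw [mul_neg, ← log_one_add_exp_neg] at t2
    rw [hynorm, ← Real.exp_neg, Real.log_exp] at t0 t1
    set s := l - T.scale i with hs'
    set X := Real.exp (-s)
    have e : ∀ Lg W0 W1 : ℝ, Real.log (2 * T.α i ^ 2) - T.α i * T.scale i - 2 * Lg + W0 / p +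
        W1 / p ^ 2 - Real.log (2 * T.α i ^ 2) - T.α i * T.scale i + T.rate p i * T.scale i -
        -(2 * T.αw p i * l) = -2 * (Lg - T.α i * s) + (W0 - T.C0 i * s) / p +
          (W1 - T.C1 i * s) / p ^ 2 := fun Lg W0 W1 => by
      rw [haw, hs']
      unfold rate
      ring
    rw [e]
    rw [abs_le] at *
    constructor <;> linarith [t0.1, t0.2, t1.1, t1.2, t2.1, t2.2]
  -- For `i = j` the leading part is the corrected bubble itself, with no error; accordingly `cross`
  -- is zero.
  · subst hij
    rw [if_neg (lt_irrefl i), if_neg (lt_irrefl i), if_neg (lt_irrefl i), if_neg (lt_irrefl i)]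
    have hV : bigV (T.α i) ((T.δ i)⁻¹ • x) = Real.log (2 * T.α i ^ 2) -
        2 * Real.log (1 + Real.exp (T.α i * (l - T.scale i))) +
        (T.α i - 2) * (l - T.scale i) := by
      unfold bigV
      rw [bubbleOne_eq hα0 hy0, hylog]
    rw [hV, mul_zero]
    refine le_of_eq (abs_eq_zero.2 ?_)
    linear_combination T.scale i * haw
  · rw [if_neg (by omega), if_pos hij, if_neg (by omega), if_pos hij]
    have hs := (h.position_outer hc0 hp0 hj hl hik hij).1
    have hle : ‖(T.δ i)⁻¹ • x‖ ≤ 1 := by rw [hynorm]; exact Real.exp_le_one_iff.2 hs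
    have t0 := (hdiv _ _ (hb0.near _ hy0 hle)).1
    have t1 := (hdiv _ _ (hb1.near _ hy0 hle)).2
    have t2 := abs_log_one_add_exp_le_exp (α := T.α i) (by linarith) hs
    rw [hynorm] at t0 t1
    set s := l - T.scale i with hs'
    set X := Real.exp s
    have e : ∀ Lg W0 W1 : ℝ, Real.log (2 * T.α i ^ 2) - T.α i * T.scale i - 2 * Lg + W0 / p +
        W1 / p ^ 2 - Real.log (2 * T.α i ^ 2) - T.α i * T.scale i + T.rate p i * T.scale i -
        (-(2 * T.αw p i * T.scale i) + (T.w0 i 0 / p + T.w1 i 0 / p ^ 2)) =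
        -2 * Lg + (W0 - T.w0 i 0) / p + (W1 - T.w1 i 0) / p ^ 2 := fun Lg W0 W1 => by
      rw [haw]
      ring
    rw [e]
    rw [abs_le] at *
    constructor <;> linarith [t0.1, t0.2, t1.1, t1.2, t2.1, t2.2]

end Bubble

/-- Expansion of the approximate solution in `A_j`. -/
lemma exists_expansion {Mw B h0 : ℝ} {Hx : ℝ} {x : Plane} {PU : ℕ → ℝ} (h : T.Spaced k p M c)
    (hS : T.SolvesSystem k h0 p) (hc0 : 0 < c) (hp : 1 ≤ p) (hj : j ∈ Finset.Icc 1 k)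
    (hb : ∀ i ∈ Finset.Icc 1 k,
      ProfileBounds Mw (T.w0 i) (T.C0 i) ∧ ProfileBounds Mw (T.w1 i) (T.C1 i))
    (hM : 0 ≤ M) (hx0 : x ≠ 0) (hl : T.InRange k R j (Real.log ‖x‖))
    (hH : |Hx - h0| ≤ B * ‖x‖)
    (hPU : ∀ i ∈ Finset.Icc 1 k, |PU i - (T.corrected p i x - Real.log (2 * T.α i ^ 2) -
      T.α i * Real.log (T.δ i) + (T.C0 i / p + T.C1 i / p ^ 2) * Real.log (T.δ i) +
      2 * Real.pi * (2 * T.α i - T.C0 i / p - T.C1 i / p ^ 2) * Hx)| ≤ B * T.δ i) :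
    ∃ E, ∑ i ∈ Finset.Icc 1 k, (-1) ^ (i - 1) * T.τ i * PU i =
      (-1) ^ (j - 1) * T.τ j * (p + (bigV (T.α j) ((T.δ j)⁻¹ • x) +
        T.w0 j ((T.δ j)⁻¹ • x) / p + T.w1 j ((T.δ j)⁻¹ • x) / p ^ 2 + E)) ∧
      |E| ≤ ∑ i ∈ Finset.Icc 1 k, M * (B * T.δ i + 4 * Real.pi * M * (B * ‖x‖) +
        (2 + 2 * Mw) * cross T i j (Real.log ‖x‖)) := by
  set q := bigV (T.α j) ((T.δ j)⁻¹ • x) + T.w0 j ((T.δ j)⁻¹ • x) / p +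
    T.w1 j ((T.δ j)⁻¹ • x) / p ^ 2 with hq
  have hτ := (h.tau_pos j hj)
  have hpi := Real.pi_pos
  -- `E` is the weighted sum of the deviations of the projections from their leading parts;
  -- `sum_leading` evaluates the leading parts to `p + q`.
  refine ⟨∑ i ∈ Finset.Icc 1 k, (-1) ^ (i + j) * (T.τ i / T.τ j) * (PU i -
    (T.leading p j (Real.log ‖x‖) q i + 4 * Real.pi * T.αw p i * h0)), ?_, ?_⟩
  · have h1 := hS.sum_leading hj hτ.ne' (Real.log ‖x‖) q
    have h2 : ∑ i ∈ Finset.Icc 1 k, (-1) ^ (i + j) * (T.τ i / T.τ j) * (PU i -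
        (T.leading p j (Real.log ‖x‖) q i + 4 * Real.pi * T.αw p i * h0)) =
        ∑ i ∈ Finset.Icc 1 k, (-1) ^ (i + j) * (T.τ i / T.τ j) * PU i - (p + q) := by
      rw [← h1, ← Finset.sum_sub_distrib]
      exact Finset.sum_congr rfl fun i _ => by ring
    rw [h2, show p + (q + (∑ i ∈ Finset.Icc 1 k, (-1) ^ (i + j) * (T.τ i / T.τ j) * PU i -
      (p + q))) = ∑ i ∈ Finset.Icc 1 k, (-1) ^ (i + j) * (T.τ i / T.τ j) * PU i by ring,
      Finset.mul_sum]
    refine Finset.sum_congr rfl fun i hi => ?_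
    -- The exponents `i - 1` and `j - 1` use truncated subtraction; indices start at `1`, so the
    -- shift makes them exact.
    obtain ⟨a, rfl⟩ : ∃ a, i = a + 1 := ⟨i - 1, by have := (Finset.mem_Icc.1 hi).1; omega⟩
    obtain ⟨b, rfl⟩ : ∃ b, j = b + 1 := ⟨j - 1, by have := (Finset.mem_Icc.1 hj).1; omega⟩
    have e1 : ((-1 : ℝ)) ^ (a + 1 + (b + 1)) = (-1) ^ a * (-1) ^ b := by
      rw [show a + 1 + (b + 1) = a + b + 2 by ring, pow_add, pow_add]; ring
    have e2 : ((-1 : ℝ)) ^ b * (-1) ^ b = 1 := by rw [← mul_pow]; simp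
    have e4 : T.τ (b + 1) * (T.τ (a + 1) / T.τ (b + 1)) = T.τ (a + 1) := by
      field_simp
    rw [e1, Nat.add_sub_cancel, Nat.add_sub_cancel]
    linear_combination (-(-1) ^ a * T.τ (a + 1) * PU (a + 1)) * e2 -
      ((-1) ^ a * PU (a + 1) * ((-1) ^ b * (-1) ^ b)) * e4
  · refine (Finset.abs_sum_le_sum_abs _ _).trans (Finset.sum_le_sum fun i hi => ?_)
    rw [mul_assoc, abs_neg_one_pow_mul, abs_mul, abs_of_pos (div_pos (h.tau_pos i hi) hτ)]
    refine mul_le_mul (h.tau_ratio i hi j hj) ?_ (abs_nonneg _) hM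
    have t1 := hPU i hi
    have t2 := abs_corrected_sub_leading_le h hc0 hp hj hi (hb i hi).1 (hb i hi).2 hx0 hl
    rw [← hq] at t2
    have t3 : |4 * Real.pi * T.αw p i * (Hx - h0)| ≤ 4 * Real.pi * M * (B * ‖x‖) := by
      rw [abs_mul, abs_mul, abs_of_pos (by positivity : 0 < 4 * Real.pi)]
      have := h.aw_le i hi
      gcongr
    have haw := two_mul_aw T p i
    have e : PU i - (T.leading p j (Real.log ‖x‖) q i + 4 * Real.pi * T.αw p i * h0) =
        (PU i - (T.corrected p i x - Real.log (2 * T.α i ^ 2) -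
          T.α i * Real.log (T.δ i) + (T.C0 i / p + T.C1 i / p ^ 2) * Real.log (T.δ i) +
          2 * Real.pi * (2 * T.α i - T.C0 i / p - T.C1 i / p ^ 2) * Hx)) +
        (T.corrected p i x - Real.log (2 * T.α i ^ 2) - T.α i * T.scale i +
          T.rate p i * T.scale i - T.leading p j (Real.log ‖x‖) q i) +
        4 * Real.pi * T.αw p i * (Hx - h0) := by
      unfold rate at haw ⊢
      unfold scale
      linear_combination (-2 * Real.pi * Hx) * haw
    rw [e]
    exact (abs_add_le _ _).trans ((add_le_add (abs_add_le _ _) le_rfl).trans (by linarith))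

end Tower

/-! ### Uniform estimates in the annuli -/

namespace Tower

variable {T : Tower} {k : ℕ} {p M c R : ℝ} {j : ℕ}

section Own

variable {x : Plane}

/-- For `j = 1` the singular term disappears because `α_1 = 2`, so the positive part of the
logarithm suffices and the bound stays finite up to the origin, which `A_1` reaches. -/
lemma Spaced.abs_bigV_le_logSize (h : T.Spaced k p M c) (hj : j ∈ Finset.Icc 1 k) {y : Plane}
    (hy : y ≠ 0) :
    |bigV (T.α j) y| ≤ (Real.log (2 * M ^ 2) + 2 + 3 * M) * logSize j (Real.log ‖y‖) := by
  have hα := h.alpha_ge j hj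
  have hαM := h.alpha_le j hj
  have h1 := abs_bigV_le hα hαM hy
  have h0 : 0 ≤ Real.log (2 * M ^ 2) := Real.log_nonneg (by nlinarith)
  have hM : 0 ≤ M := by linarith
  obtain ⟨s, hs⟩ : ∃ s, s = Real.log ‖y‖ := ⟨_, rfl⟩
  rw [← hs] at h1 ⊢
  have hm0 := le_max_right s 0
  have h2 : 2 * T.α j * max s 0 ≤ 2 * M * max s 0 := by gcongr
  have h3 : 0 ≤ Real.log (2 * M ^ 2) * max s 0 := by positivity
  have h5 : 0 ≤ M * max s 0 := by positivity
  unfold logSize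
  split_ifs with hj1
  · have : T.α j - 2 = 0 := by rw [hj1, h.alpha_one]; ring
    rw [this, zero_mul, add_zero] at h1
    linarith
  · have hms : max s 0 ≤ |s| := max_le (le_abs_self s) (abs_nonneg s)
    have h4 : (T.α j - 2) * |s| ≤ M * |s| := by gcongr; linarith
    have h6 : 2 * M * max s 0 ≤ 2 * M * |s| := by gcongr
    have h7 : 0 ≤ Real.log (2 * M ^ 2) * |s| := by positivity
    linarith [abs_nonneg s]

/-- The product is governed by the exponents `-2s - α|s|` and `ηs - α|s|`. For `j = 1` one has `α =
2` and decay is needed only for `s > 0`; for `j > 1` the bound `α ≥ 5` gives decay on both sides. -/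
lemma Spaced.weight_mul_mass_le (h : T.Spaced k p M c) (hc : 0 ≤ c) (hp : 0 < p) (hMp : M ≤ p)
    (hj : j ∈ Finset.Icc 1 k) {η : ℝ} (hη0 : 0 ≤ η) (hη1 : η ≤ 1) {y : Plane} (hy : y ≠ 0) :
    (1 + Real.exp ((2 + η) * Real.log ‖y‖)) * mass (T.α j) y ≤
      4 * M ^ 2 * Real.exp 1 * Real.exp (-(1 * logSize j (Real.log ‖y‖))) := by
  have hα := h.alpha_ge j hj
  have hαM := h.alpha_le j hj
  have h1 := mass_le (by linarith : 0 < T.α j) hy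
  obtain ⟨s, hs⟩ : ∃ s, s = Real.log ‖y‖ := ⟨_, rfl⟩
  rw [← hs] at h1 ⊢
  have key : -2 * s - T.α j * |s| ≤ 1 - logSize j s ∧ η * s - T.α j * |s| ≤ 1 - logSize j s := by
    unfold logSize
    have hηs : η * s ≤ |s| := by
      calc η * s ≤ η * |s| := mul_le_mul_of_nonneg_left (le_abs_self s) hη0
        _ ≤ 1 * |s| := by gcongr
        _ = |s| := one_mul _
    have hns := neg_le_abs s
    have h0 := abs_nonneg s
    split_ifs with hj1
    · have hα2 : T.α j = 2 := by rw [hj1, h.alpha_one]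
      rw [hα2]
      rcases le_total 0 s with h2 | h2
      · rw [max_eq_left h2, abs_of_nonneg h2] at *
        constructor <;> linarith
      · rw [max_eq_right h2]
        constructor <;> linarith
    · obtain ⟨hj1', hjk⟩ := Finset.mem_Icc.1 hj
      obtain ⟨m, rfl⟩ : ∃ m, j = m + 1 := ⟨j - 1, by omega⟩
      have h5 := (h.four_mul_le hc hp hMp (Finset.mem_Ico.2 ⟨by omega, by omega⟩ :
        m ∈ Finset.Ico 1 k)).1
      have h6 : 5 * |s| ≤ T.α (m + 1) * |s| := by gcongr
      constructor <;> linarith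
  calc (1 + Real.exp ((2 + η) * s)) * mass (T.α j) y
      ≤ (1 + Real.exp ((2 + η) * s)) * (2 * T.α j ^ 2 * Real.exp (-2 * s - T.α j * |s|)) := by
        gcongr
    _ = 2 * T.α j ^ 2 * (Real.exp (-2 * s - T.α j * |s|) + Real.exp (η * s - T.α j * |s|)) := by
        have : Real.exp (η * s - T.α j * |s|) =
            Real.exp ((2 + η) * s) * Real.exp (-2 * s - T.α j * |s|) := by
          rw [← Real.exp_add]; ring_nf
        rw [this]; ring
    _ ≤ 2 * M ^ 2 * (Real.exp (1 - logSize j s) + Real.exp (1 - logSize j s)) := by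
        have e1 := Real.exp_le_exp.2 key.1
        have e2 := Real.exp_le_exp.2 key.2
        exact mul_le_mul (by gcongr) (add_le_add e1 e2) (by positivity) (by positivity)
    _ = 4 * M ^ 2 * Real.exp 1 * Real.exp (-(1 * logSize j s)) := by
        rw [sub_eq_add_neg, Real.exp_add, one_mul]; ring

/-- This keeps `1 + X/p` above `-O(1/p)` throughout `A_j`, so where the base is negative its `p`-th
power is smaller than any fixed exponential in `p`. -/
lemma Spaced.bigV_lower (h : T.Spaced k p M c) (hc : 0 < c) (hp : 0 < p) (hR : 0 ≤ R) (hM : 0 ≤ M)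
    (hj : j ∈ Finset.Icc 1 k) (hx0 : x ≠ 0) (hl : T.InRange k R j (Real.log ‖x‖)) :
    -p - (2 + M + (M + 2) * R + M * M) ≤ bigV (T.α j) ((T.δ j)⁻¹ • x) := by
  have hδ := h.delta_pos j hj
  have hy : (T.δ j)⁻¹ • x ≠ 0 := smul_ne_zero (inv_ne_zero hδ.ne') hx0
  obtain ⟨b1, b2⟩ := bigV_ge (h.alpha_ge j hj) hy
  have hylog : Real.log ‖(T.δ j)⁻¹ • x‖ = Real.log ‖x‖ - T.scale j := log_norm_inv_smul hδ hx0
  rw [hylog] at b1 b2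
  have q1 : 0 ≤ (M + 2) * R := by positivity
  have q2 : 0 ≤ M * M := by positivity
  rcases le_total 0 (Real.log ‖x‖ - T.scale j) with hs | hs
  · linarith [b1 hs, h.slope_upper hc hR hM hj hl]
  · linarith [b2 hs, h.slope_lower hc hp hM hj hl hs]

lemma Spaced.logSize_le (h : T.Spaced k p M c) (hc : 0 < c) (hp : 1 ≤ p) (hR : 0 ≤ R) (hM : 0 ≤ M)
    (hj : j ∈ Finset.Icc 1 k) {l : ℝ} (hl : T.InRange k R j l) :
    logSize j (l - T.scale j) ≤ (1 + R + M) * p := by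
  have h1 := h.s_le hj hl
  have hp0 : 0 < p := by linarith
  have hRp : R ≤ R * p := le_mul_of_one_le_right hR hp
  have hMp : 0 ≤ M * p := by positivity
  unfold logSize
  split_ifs with hj1
  · have : max (l - T.scale j) 0 ≤ R + M * p := max_le h1 (by linarith)
    linarith
  · have := h.neg_s_le hc hp0 hj (by have := (Finset.mem_Icc.1 hj).1; omega) hl
    have : |l - T.scale j| ≤ R + M * p := abs_le.2 ⟨by linarith, h1⟩
    linarith

lemma Spaced.cross_le (h : T.Spaced k p M c) (hc : 0 < c) (hp : 0 < p)
    (hj : j ∈ Finset.Icc 1 k) {l : ℝ} (hl : T.InRange k R j l) {i : ℕ} (hi : i ∈ Finset.Icc 1 k) :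
    cross T i j l ≤ 1 ∧ cross T i j l ≤ Real.exp (logSize j (l - T.scale j) - c * p) := by
  obtain ⟨hi1, hik⟩ := Finset.mem_Icc.1 hi
  have hL := one_add_max_le_logSize j (l - T.scale j)
  have hm := le_max_left (l - T.scale j) 0
  unfold cross
  split_ifs with h1 h2
  · obtain ⟨a, b⟩ := h.position_inner hc hp hj hl hi1 h1
    refine ⟨Real.exp_le_one_iff.2 (by linarith), Real.exp_le_exp.2 ?_⟩
    have hj1 : j ≠ 1 := by omega
    unfold logSize
    rw [if_neg hj1]
    linarith [neg_le_abs (l - T.scale j)]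
  · obtain ⟨a, b⟩ := h.position_outer hc hp hj hl hik h2
    exact ⟨Real.exp_le_one_iff.2 a, Real.exp_le_exp.2 (by linarith)⟩
  · exact ⟨zero_le_one, (Real.exp_pos _).le⟩

/-- The error term of the expansion is bounded, and tiny close to the `j`-th bubble. -/
lemma exists_error_bound (k : ℕ) {M c R B Mw : ℝ} (hM : 0 ≤ M) (hc : 0 < c) (hR : 0 ≤ R)
    (hB : 0 ≤ B) (hMw : 0 ≤ Mw) : ∃ M' p₀ : ℝ, 0 ≤ M' ∧ ∀ p : ℝ, p₀ ≤ p → 1 ≤ p →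
    ∀ (T : Tower) (j : ℕ) (x : Plane) (E : ℝ), T.Spaced k p M c → j ∈ Finset.Icc 1 k → x ≠ 0 →
    T.InRange k R j (Real.log ‖x‖) →
    |E| ≤ ∑ i ∈ Finset.Icc 1 k, M * (B * T.δ i + 4 * Real.pi * M * (B * ‖x‖) +
        (2 + 2 * Mw) * cross T i j (Real.log ‖x‖)) →
    |E| ≤ M' ∧ (logSize j (Real.log ‖x‖ - T.scale j) ^ 4 ≤ p → |E| ≤ M' / p ^ 3) := by
  obtain ⟨Q, hQ0, hQ⟩ := exists_pow_mul_exp_le 3 (b := c / 2) (by positivity)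
  have hpi := Real.pi_pos
  set M1 := k * (M * (B + 4 * Real.pi * M * B + (2 + 2 * Mw))) with hM1
  have hM10 : 0 ≤ M1 := by positivity
  refine ⟨M1 * (Real.exp R + Q), 4 / c ^ 2, by positivity, ?_⟩
  intro p hp0 hp1 T j x E h hj hx0 hl hE
  have hp : 0 < p := by linarith
  have hcp : 0 ≤ c * p := by positivity
  set l := Real.log ‖x‖ with hl'
  have hxe : ‖x‖ = Real.exp l := by rw [hl', Real.exp_log (norm_pos_iff.2 hx0)]
  set L := logSize j (l - T.scale j) with hL
  have hL1 : 1 ≤ L := one_le_logSize _ _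
  have hLs : l - T.scale j ≤ L := by
    have := one_add_max_le_logSize j (l - T.scale j)
    linarith [le_max_left (l - T.scale j) 0]
  have hsum : ∀ z : ℝ, (∀ i ∈ Finset.Icc 1 k, T.δ i ≤ z ∧ ‖x‖ ≤ z ∧ cross T i j l ≤ z) →
      |E| ≤ M1 * z := fun z hz => by
    refine hE.trans ((Finset.sum_le_card_nsmul _ _
      (M * (B + 4 * Real.pi * M * B + (2 + 2 * Mw)) * z) fun i hi => ?_).trans ?_)
    · obtain ⟨z1, z2, z3⟩ := hz i hi
      have e : M * (B + 4 * Real.pi * M * B + (2 + 2 * Mw)) * z =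
        M * (B * z + 4 * Real.pi * M * (B * z) + (2 + 2 * Mw) * z) := by ring
      rw [e]
      gcongr
    · rw [nsmul_eq_mul, Nat.card_Icc, Nat.add_sub_cancel, hM1]
      exact le_of_eq (by ring)
  have hδe : ∀ i ∈ Finset.Icc 1 k, T.δ i ≤ Real.exp (-(c * p)) := fun i hi => by
    rw [← Real.exp_log (h.delta_pos i hi)]
    exact Real.exp_le_exp.2 (h.log_le i hi)
  constructor
  · refine (hsum (Real.exp R) fun i hi => ⟨?_, ?_, ?_⟩).trans ?_
    · exact (hδe i hi).trans (Real.exp_le_exp.2 (by linarith))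
    · rw [hxe]; exact Real.exp_le_exp.2 hl.top
    · exact (h.cross_le hc hp hj hl hi).1.trans (Real.one_le_exp hR)
    · gcongr; linarith
  · intro hL4
    -- From `L² ≤ L^4 ≤ p` and `4 ≤ p c²`. Half of the decay `exp (-(c p))` then survives the factor
    -- `exp L`.
    have hLc : L ≤ c / 2 * p := by
      have h1 : L ^ 2 ≤ (c / 2 * p) ^ 2 := by
        have h2 : L ^ 2 ≤ L ^ 4 := pow_le_pow_right₀ hL1 (by norm_num)
        have h3 : 4 ≤ p * c ^ 2 := by rwa [div_le_iff₀ (by positivity)] at hp0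
        nlinarith
      exact (abs_le_of_sq_le_sq' h1 (by positivity)).2
    have h1 : |E| ≤ M1 * Real.exp (-(c / 2 * p)) := by
      refine hsum _ fun i hi => ⟨?_, ?_, ?_⟩
      · exact (hδe i hi).trans (Real.exp_le_exp.2 (by linarith))
      · rw [hxe]
        have := (h.scale_mem hj).2
        exact Real.exp_le_exp.2 (by linarith)
      · exact (h.cross_le hc hp hj hl hi).2.trans (Real.exp_le_exp.2 (by linarith))
    have h2 : Real.exp (-(c / 2 * p)) ≤ (Real.exp R + Q) / p ^ 3 := by
      rw [le_div_iff₀ (by positivity)]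
      have h3 : p ^ 3 * Real.exp (-(c / 2 * p)) ≤ (1 + p) ^ 3 * Real.exp (-(c / 2 * p)) := by
        gcongr; linarith
      linarith [hQ p hp.le, Real.exp_pos R]
    calc |E| ≤ M1 * ((Real.exp R + Q) / p ^ 3) := h1.trans (by gcongr)
      _ = _ := by ring

/-- The contribution of the `j`-th bubble to the error in `A_j`. -/
lemma exists_own_bound (k : ℕ) {M c R B Mw η : ℝ} (hM : 1 ≤ M) (hc : 0 < c) (hR : 0 ≤ R)
    (hB : 0 ≤ B) (hMw : 0 ≤ Mw) (hη0 : 0 ≤ η) (hη1 : η ≤ 1) : ∃ C p₀ : ℝ, 0 < C ∧ 1 < p₀ ∧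
    ∀ p : ℝ, p₀ ≤ p → ∀ (T : Tower) (j : ℕ) (x : Plane) (E : ℝ), T.Spaced k p M c →
    j ∈ Finset.Icc 1 k → x ≠ 0 → T.InRange k R j (Real.log ‖x‖) →
    ProfileBounds Mw (T.w0 j) (T.C0 j) → ProfileBounds Mw (T.w1 j) (T.C1 j) →
    |E| ≤ ∑ i ∈ Finset.Icc 1 k, M * (B * T.δ i + 4 * Real.pi * M * (B * ‖x‖) +
        (2 + 2 * Mw) * cross T i j (Real.log ‖x‖)) →
    ∀ y, y = (T.δ j)⁻¹ • x → ∀ t, t = 1 + (bigV (T.α j) y + T.w0 j y / p + T.w1 j y / p ^ 2 + E) / p →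
    (1 + Real.exp ((2 + η) * (Real.log ‖x‖ - T.scale j))) * |(|t| ^ (p - 1) * t) -
      mass (T.α j) y * correctionFactor p (bigV (T.α j) y) (T.w0 j y) (T.w1 j y)| ≤ C / p ^ 3 := by
  have hM0 : 0 ≤ M := by linarith
  obtain ⟨ME, p1, hME, hE'⟩ := exists_error_bound k hM0 hc hR hB hMw
  have hlog : 0 ≤ Real.log (2 * M ^ 2) := Real.log_nonneg (by nlinarith)
  -- One constant meets all hypotheses of `exists_own_term_bound`: the summands control `𝒱`, the
  -- profiles, `E`, the growth of `L` and of the log-weight relative to `p`, the weighted mass, and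
  -- the lower bound for `𝒱`.
  set A := (Real.log (2 * M ^ 2) + 2 + 3 * M) + 2 * Mw + ME + (1 + 3 * R + 3 * M) +
    4 * M ^ 2 * Real.exp 1 + (2 + M + (M + 2) * R + M * M) with hA
  have q1 : 0 ≤ 4 * M ^ 2 * Real.exp 1 := by positivity
  have q2 : 0 ≤ (M + 2) * R := by positivity
  have q3 : 0 ≤ M * M := by positivity
  obtain ⟨C, p2, hC, hp2, hown⟩ := exists_own_term_bound (M := A) (c := 1) (by linarith) one_pos
  refine ⟨C, p2 + |p1| + M, hC, by linarith [abs_nonneg p1], ?_⟩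
  intro p hp T j x E h hj hx0 hl hb0 hb1 hE y hy t ht
  have hpp1 : p1 ≤ p := by linarith [le_abs_self p1]
  have hpp2 : p2 ≤ p := by linarith [abs_nonneg p1]
  have hp1 : 1 ≤ p := by linarith
  have hp0 : 0 < p := by linarith
  have hMp : M ≤ p := by linarith [abs_nonneg p1]
  have hδ := h.delta_pos j hj
  have hy0 : y ≠ 0 := by rw [hy]; exact smul_ne_zero (inv_ne_zero hδ.ne') hx0
  have hylog : Real.log ‖y‖ = Real.log ‖x‖ - T.scale j := by
    rw [hy]; exact log_norm_inv_smul hδ hx0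
  obtain ⟨e1, e2⟩ := hE' p hpp1 hp1 T j x E h hj hx0 hl hE
  have hL1 := one_le_logSize j (Real.log ‖y‖)
  have hLm := one_add_max_le_logSize j (Real.log ‖y‖)
  have hwb : ∀ w c', ProfileBounds Mw w c' → |w y| ≤ A * logSize j (Real.log ‖y‖) :=
    fun w c' hw => by
      refine (hw.abs_le hy0).trans ?_
      gcongr
      linarith
  rw [← hylog] at e2 ⊢
  rw [ht, ← exp_bigV hy0]
  refine hown p _ _ _ _ (logSize j (Real.log ‖y‖)) _ hpp2 hL1 ?_ (hwb _ _ hb0) (hwb _ _ hb1)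
    (e1.trans (by linarith)) (fun h4 => (e2 h4).trans (by gcongr; linarith)) ?_ (by positivity)
    ?_ ?_ ?_
  · refine (h.abs_bigV_le_logSize hj hy0).trans ?_
    gcongr
    linarith
  · rw [hylog]
    refine (h.logSize_le hc hp1 hR hM0 hj hl).trans ?_
    gcongr
    linarith
  · rw [exp_bigV hy0]
    refine (h.weight_mul_mass_le hc.le hp0 hMp hj hη0 hη1 hy0).trans ?_
    gcongr
    linarith
  · have h1 : (2 + η) * Real.log ‖y‖ ≤ 3 * (R + M * p) := by
      have h2 : Real.log ‖y‖ ≤ R + M * p := by rw [hylog]; exact h.s_le hj hl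
      have h3 : 0 ≤ R + M * p := by positivity
      calc (2 + η) * Real.log ‖y‖ ≤ (2 + η) * (R + M * p) := by gcongr
        _ ≤ 3 * (R + M * p) := by gcongr; linarith
    have h4 : R ≤ R * p := le_mul_of_one_le_right hR hp1
    have h5 : 1 ≤ Real.exp (3 * (R + M * p)) := Real.one_le_exp (by positivity)
    have h6 := Real.exp_le_exp.2 h1
    have h7 : (2 : ℝ) ≤ Real.exp 1 := by linarith [Real.add_one_le_exp (1 : ℝ)]
    calc 1 + Real.exp ((2 + η) * Real.log ‖y‖) ≤ 2 * Real.exp (3 * (R + M * p)) := by linarith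
      _ ≤ Real.exp 1 * Real.exp (3 * (R + M * p)) := by gcongr
      _ = Real.exp (1 + 3 * (R + M * p)) := by rw [← Real.exp_add]
      _ ≤ Real.exp ((1 + 3 * R + 3 * M) * p) := Real.exp_le_exp.2 (by linarith)
      _ ≤ Real.exp (A * p) := by
        apply Real.exp_le_exp.2
        gcongr
        linarith
  · rw [hy]
    have := h.bigV_lower hc hp0 hR hM0 hj hx0 hl
    linarith

end Own

/-- The contribution of the other bubbles to the error in `A_j`. -/
lemma exists_other_bound (k : ℕ) {M c R Mw η : ℝ} (hM : 1 ≤ M) (hc : 0 < c) (hc1 : c ≤ 1)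
    (hMw : 0 ≤ Mw) (hη0 : 0 ≤ η) (hη1 : η ≤ 1) : ∃ C : ℝ, 0 < C ∧
    ∀ p : ℝ, M ≤ p → ∀ (T : Tower) (i j : ℕ) (x : Plane), T.Spaced k p M c →
    j ∈ Finset.Icc 1 k → i ∈ Finset.Icc 1 k → i ≠ j → x ≠ 0 →
    T.InRange k R j (Real.log ‖x‖) →
    ProfileBounds Mw (T.w0 i) (T.C0 i) → ProfileBounds Mw (T.w1 i) (T.C1 i) →
    ∀ y, y = (T.δ i)⁻¹ • x →
    (Real.exp (-2 * (Real.log ‖x‖ - T.scale j)) + Real.exp (η * (Real.log ‖x‖ - T.scale j))) *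
      |2 * T.α i ^ 2 * kern (T.α i * (Real.log ‖x‖ - T.scale i)) *
        correctionFactor p (bigV (T.α i) y) (T.w0 i y) (T.w1 i y)| ≤ C / p ^ 3 := by
  -- The fourth power comes from the correction factor, and the rate `c/6` is the loss allowed for
  -- in `exponent_le`.
  obtain ⟨Q, hQ0, hQ⟩ := exists_pow_mul_exp_le 4 (b := c / 6) (by positivity)
  obtain ⟨Q3, hQ30, hQ3⟩ := exists_pow_mul_exp_le 3 (b := c / 2 * c) (by positivity)
  have hlog : 0 ≤ Real.log (2 * M ^ 2) := Real.log_nonneg (by nlinarith)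
  set A := (Real.log (2 * M ^ 2) + 2 + 3 * M) + 2 * Mw with hA
  have hA1 : 1 ≤ A := by linarith
  refine ⟨32 * M ^ 2 * A ^ 4 * Q * Q3, by positivity, ?_⟩
  intro p hMp T i j x h hj hi hij hx0 hl hb0 hb1 y hy
  have hp1 : 1 ≤ p := by linarith
  have hp0 : 0 < p := by linarith
  have hδ := h.delta_pos i hi
  have hα := h.alpha_ge i hi
  have hαM := h.alpha_le i hi
  have hα0 : 0 < T.α i := by linarith
  have hy0 : y ≠ 0 := by rw [hy]; exact smul_ne_zero (inv_ne_zero hδ.ne') hx0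
  have hylog : Real.log ‖y‖ = Real.log ‖x‖ - T.scale i := by
    rw [hy]; exact log_norm_inv_smul hδ hx0
  obtain ⟨k1, k2⟩ := h.exponent_le hc hc1 hp0 hMp hj hl hi hij hη0 hη1
  obtain ⟨s, hs⟩ : ∃ s, s = Real.log ‖x‖ - T.scale j := ⟨_, rfl⟩
  obtain ⟨S, hS⟩ : ∃ S, S = Real.log ‖x‖ - T.scale i := ⟨_, rfl⟩
  rw [← hS] at k1 k2 hylog ⊢
  rw [← hs] at k1 k2 ⊢
  have hS0 := abs_nonneg S
  have hB1 : 1 ≤ A * (1 + |S|) := one_le_mul_of_one_le_of_one_le hA1 (by linarith)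
  have hV : |bigV (T.α i) y| ≤ A * (1 + |S|) := by
    have h1 := abs_bigV_le_log hα hαM hy0
    rw [hylog] at h1
    refine h1.trans ?_
    gcongr
    linarith
  have hwb : ∀ w c', ProfileBounds Mw w c' → |w y| ≤ A * (1 + |S|) := fun w c' hw => by
    refine (hw.abs_le hy0).trans ?_
    rw [hylog]
    gcongr
    · linarith
    · exact max_le (le_abs_self S) hS0
  have hcf := abs_correctionFactor_le hp1 hB1 hV (hwb _ _ hb0) (hwb _ _ hb1)
  have hk := kern_le (T.α i * S)
  rw [abs_mul, abs_of_pos hα0] at hk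
  have hq : (1 + |S|) ^ 4 ≤ Q * Real.exp (c / 6 * |S|) := by
    have h1 := hQ |S| hS0
    rwa [Real.exp_neg, ← div_eq_mul_inv, div_le_iff₀ (Real.exp_pos _)] at h1
  have hX : |2 * T.α i ^ 2 * kern (T.α i * S) *
      correctionFactor p (bigV (T.α i) y) (T.w0 i y) (T.w1 i y)| ≤
      16 * M ^ 2 * A ^ 4 * Q * Real.exp (-((T.α i - c / 6) * |S|)) := by
    rw [abs_mul, abs_of_nonneg (by have := (kern_pos (T.α i * S)).le; positivity)]
    calc _ ≤ 2 * M ^ 2 * Real.exp (-(T.α i * |S|)) *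
          (8 * (A ^ 4 * (Q * Real.exp (c / 6 * |S|)))) := by
          refine mul_le_mul ?_ (hcf.trans ?_) (abs_nonneg _) (by positivity)
          · have hk0 := (kern_pos (T.α i * S)).le
            gcongr
          · rw [mul_pow]; gcongr
      _ = 16 * M ^ 2 * A ^ 4 * Q * (Real.exp (-(T.α i * |S|)) * Real.exp (c / 6 * |S|)) := by ring
      _ = _ := by rw [← Real.exp_add]; ring_nf
  have hfin : Real.exp (-(c / 2 * (c * p))) ≤ Q3 / p ^ 3 := by
    rw [le_div_iff₀ (by positivity)]
    have h3 : p ^ 3 * Real.exp (-(c / 2 * c * p)) ≤ (1 + p) ^ 3 * Real.exp (-(c / 2 * c * p)) := by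
      gcongr; linarith
    rw [← mul_assoc]
    linarith [hQ3 p hp0.le]
  have hsum : (Real.exp (-2 * s) + Real.exp (η * s)) * Real.exp (-((T.α i - c / 6) * |S|)) ≤
      2 * Real.exp (-(c / 2 * (c * p))) := by
    rw [add_mul, ← Real.exp_add, ← Real.exp_add]
    have h1 := Real.exp_le_exp.2 k1
    have h2 := Real.exp_le_exp.2 k2
    rw [sub_eq_add_neg] at h1 h2
    linarith
  calc _ ≤ (Real.exp (-2 * s) + Real.exp (η * s)) *
        (16 * M ^ 2 * A ^ 4 * Q * Real.exp (-((T.α i - c / 6) * |S|))) := by gcongr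
    _ = 16 * M ^ 2 * A ^ 4 * Q * ((Real.exp (-2 * s) + Real.exp (η * s)) *
        Real.exp (-((T.α i - c / 6) * |S|))) := by ring
    _ ≤ 16 * M ^ 2 * A ^ 4 * Q * (2 * (Q3 / p ^ 3)) := by
        exact mul_le_mul_of_nonneg_left (hsum.trans (by linarith)) (by positivity)
    _ = _ := by ring

end Tower

/-! ### The error estimate -/

/-- The Lipschitz bound at the origin comes from differentiability of the harmonic function `H(·,
0)` close to `0` and from its boundedness elsewhere. -/
lemma exists_domain_constants {Ω : Set Plane} (hΩ : IsSymmetricSmoothDomain Ω)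
    {H : Plane → Plane → ℝ} (hH : IsGreenRegularPart Ω H) :
    ∃ d R B : ℝ, 0 < d ∧ 0 ≤ R ∧ 0 ≤ B ∧ (∀ x ∈ frontier Ω, d ≤ ‖x‖) ∧
      (∀ x ∈ Ω, x ≠ 0 → Real.log ‖x‖ ≤ R) ∧ ∀ x ∈ Ω, |H x 0 - H 0 0| ≤ B * ‖x‖ := by
  obtain ⟨hharm, hcont, -⟩ := hH 0 hΩ.zero_mem
  obtain ⟨d, hd, hball⟩ := Metric.isOpen_iff.1 hΩ.isOpen 0 hΩ.zero_mem
  obtain ⟨r, hr⟩ := hΩ.isBounded.exists_norm_le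
  have hcomp : IsCompact (closure Ω) := hΩ.isBounded.isCompact_closure
  obtain ⟨b, hb⟩ := hcomp.exists_bound_of_continuousOn hcont
  have hb0 : 0 ≤ b := (norm_nonneg _).trans (hb 0 (subset_closure hΩ.zero_mem))
  have hdiff : DifferentiableAt ℝ (fun x => H x 0) 0 :=
    (hharm 0 hΩ.zero_mem).1.differentiableAt (by norm_num)
  obtain ⟨c, hc0, hc⟩ := hdiff.isBigO_sub.exists_nonneg
  obtain ⟨e, he, hce⟩ := Metric.eventually_nhds_iff.1 hc.bound
  refine ⟨d, |r|, c + 2 * b / e, hd, abs_nonneg _, by positivity, ?_, ?_, ?_⟩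
  · intro x hx
    by_contra! hlt
    have hxΩ : x ∈ Ω := hball (by simpa using hlt)
    rw [hΩ.isOpen.frontier_eq] at hx
    exact hx.2 hxΩ
  · intro x hx hx0
    have h1 := Real.log_le_sub_one_of_pos (norm_pos_iff.2 hx0)
    linarith [hr x hx, le_abs_self r]
  · intro x hx
    rw [add_mul]
    rcases lt_or_ge ‖x‖ e with hxe | hxe
    · have h1 := hce (y := x) (by simpa using hxe)
      simp only [Real.norm_eq_abs, sub_zero] at h1
      have : 0 ≤ 2 * b / e * ‖x‖ := by positivity
      linarith
    · have h1 := hb x (subset_closure hx)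
      have h2 := hb 0 (subset_closure hΩ.zero_mem)
      rw [Real.norm_eq_abs] at h1 h2
      have h3 : 2 * b / e * e ≤ 2 * b / e * ‖x‖ := by gcongr
      rw [div_mul_cancel₀ _ he.ne'] at h3
      have : 0 ≤ c * ‖x‖ := by positivity
      linarith [abs_sub (H x 0) (H 0 0)]

lemma g_sign_mul (p : ℝ) (n : ℕ) {a : ℝ} (ha : 0 < a) (t : ℝ) :
    g p ((-1) ^ n * a * t) = (-1) ^ n * a ^ p * (|t| ^ (p - 1) * t) := by
  unfold g
  rw [abs_mul, abs_mul, abs_pow, abs_neg, abs_one, one_pow, one_mul, abs_of_pos ha,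
    Real.mul_rpow ha.le (abs_nonneg t), Real.rpow_sub_one ha.ne']
  field_simp

namespace Tower

variable {T : Tower} {k : ℕ} {p M c : ℝ} {j : ℕ}

/-- The equation for `τ_j` makes the prefactor `(τ_j p)^p` of the nonlinearity equal to the
prefactor `τ_j / δ_j²` of the Laplacian. -/
lemma SolvesSystem.rpow_mul_sq {h0 : ℝ} (h : T.SolvesSystem k h0 p) (hp : 0 < p)
    (hj : j ∈ Finset.Icc 1 k) (hτ : 0 < T.τ j) : (T.τ j * p) ^ p * T.δ j ^ 2 = T.τ j := by
  have h1 := h.tau j hj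
  rw [Real.rpow_sub_one hτ.ne'] at h1
  rw [Real.mul_rpow hτ.le hp.le]
  field_simp at h1
  linarith

/-- The form with `δ²` matches the rescaled equation of the bubble that owns the annulus; the form
with `‖x‖²` matches the logarithmic coordinates used for all the others. -/
lemma weight_term_eq {η δ l : ℝ} (hδ : 0 < δ) {x : Plane} (hx : x ≠ 0) (hl : l = Real.log ‖x‖) :
    (δ ^ (2 + η) + ‖x‖ ^ (2 + η)) / δ ^ η =
      δ ^ 2 * (1 + Real.exp ((2 + η) * (l - Real.log δ))) ∧
    (δ ^ (2 + η) + ‖x‖ ^ (2 + η)) / δ ^ η =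
      ‖x‖ ^ 2 * (Real.exp (-2 * (l - Real.log δ)) + Real.exp (η * (l - Real.log δ))) := by
  have h1 : ∀ a : ℝ, δ ^ a = Real.exp (a * Real.log δ) := fun a => by
    rw [Real.rpow_def_of_pos hδ, mul_comm]
  have h2 : δ ^ 2 = Real.exp (2 * Real.log δ) := by rw [← h1, Real.rpow_two]
  rw [norm_rpow_eq_exp hx, norm_sq_eq_exp hx, h2, h1, h1, ← hl, div_eq_mul_inv, ← Real.exp_neg,
    add_mul, mul_add, mul_add, mul_one]
  simp only [← Real.exp_add]
  constructor <;> ring_nf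

/-- The weighted error at a point of the annulus `A_j`, from bounds for the contributions of the
single bubbles. -/
lemma weighted_error_le {Ω : Set Plane} {η h0 C₁ C₂ t : ℝ} {U : Plane → ℝ} {x : Plane}
    (hO : IsOpen Ω) (h : T.Spaced k p M c) (hS : T.SolvesSystem k h0 p)
    (hT : T.HasCorrections k) (hU : T.IsApproxSolution Ω k p U) (hp : 0 < p)
    (hC₂ : 0 ≤ C₂)
    (hj : j ∈ Finset.Icc 1 k) (hx : x ∈ Ω) (hx0 : x ≠ 0)
    (ht : U x = (-1) ^ (j - 1) * (T.τ j * p) * t)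
    (hown : (1 + Real.exp ((2 + η) * (Real.log ‖x‖ - T.scale j))) * |(|t| ^ (p - 1) * t) -
      mass (T.α j) ((T.δ j)⁻¹ • x) * correctionFactor p (bigV (T.α j) ((T.δ j)⁻¹ • x))
        (T.w0 j ((T.δ j)⁻¹ • x)) (T.w1 j ((T.δ j)⁻¹ • x))| ≤ C₁ / p ^ 3)
    (hother : ∀ i ∈ Finset.Icc 1 k, i ≠ j →
      (Real.exp (-2 * (Real.log ‖x‖ - T.scale j)) + Real.exp (η * (Real.log ‖x‖ - T.scale j))) *
      |2 * T.α i ^ 2 * kern (T.α i * (Real.log ‖x‖ - T.scale i)) *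
        correctionFactor p (bigV (T.α i) ((T.δ i)⁻¹ • x)) (T.w0 i ((T.δ i)⁻¹ • x))
          (T.w1 i ((T.δ i)⁻¹ • x))| ≤ C₂ / p ^ 3) :
    (T.δ j ^ (2 + η) + ‖x‖ ^ (2 + η)) / T.δ j ^ η * |errorOf p U x| ≤
      M * (C₁ + k * C₂) / p ^ 4 := by
  obtain ⟨PU, hPU, rfl⟩ := hU
  have hτ := h.tau_pos j hj
  have hδ := h.delta_pos j hj
  have hM : 0 ≤ M := (zero_le_two.trans (h.alpha_ge j hj)).trans (h.alpha_le j hj)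
  obtain ⟨W1, W2⟩ := weight_term_eq (η := η) hδ hx0 rfl
  set W := (T.δ j ^ (2 + η) + ‖x‖ ^ (2 + η)) / T.δ j ^ η
  have hW0 : 0 ≤ W := by positivity
  have hxn : 0 < ‖x‖ := norm_pos_iff.2 hx0
  set X : ℕ → ℝ := fun i => 2 * T.α i ^ 2 * kern (T.α i * (Real.log ‖x‖ - T.scale i)) *
    correctionFactor p (bigV (T.α i) ((T.δ i)⁻¹ • x)) (T.w0 i ((T.δ i)⁻¹ • x))
      (T.w1 i ((T.δ i)⁻¹ • x)) with hX
  have hlapi : ∀ i ∈ Finset.Icc 1 k, lap (PU i) x = -(X i / ‖x‖ ^ 2) := fun i hi => by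
    have h1 := norm_sq_mul_lap_correctedBubble (p := p)
      (by linarith [h.alpha_ge i hi] : 0 < T.α i) (h.delta_pos i hi) (hT i hi).1 (hT i hi).2 hx0
    rw [(hPU i hi).lap_eq x hx, ← neg_div, eq_div_iff (by positivity), mul_comm]
    exact h1
  have hc : ∀ i ∈ Finset.Icc 1 k, ContDiffAt ℝ 2 (PU i) x := fun i hi =>
    (hPU i hi).contDiffOn.contDiffAt (hO.mem_nhds hx)
  have hlap : lap (fun x => ∑ i ∈ Finset.Icc 1 k, (-1) ^ (i - 1) * T.τ i * PU i x) x =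
      ∑ i ∈ Finset.Icc 1 k, (-1) ^ (i - 1) * T.τ i * -(X i / ‖x‖ ^ 2) := by
    rw [lap_sum _ fun i hi => contDiffAt_const.mul (hc i hi)]
    exact Finset.sum_congr rfl fun i hi => by rw [lap_const_mul _ (hc i hi), hlapi i hi]
  have hXj : X j / ‖x‖ ^ 2 = mass (T.α j) ((T.δ j)⁻¹ • x) *
      correctionFactor p (bigV (T.α j) ((T.δ j)⁻¹ • x)) (T.w0 j ((T.δ j)⁻¹ • x))
        (T.w1 j ((T.δ j)⁻¹ • x)) / T.δ j ^ 2 := by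
    have hy : (T.δ j)⁻¹ • x ≠ 0 := smul_ne_zero (inv_ne_zero hδ.ne') hx0
    have h1 := norm_sq_mul_mass (by linarith [h.alpha_ge j hj] : 0 < T.α j) hy
    have h2 : Real.log ‖(T.δ j)⁻¹ • x‖ = Real.log ‖x‖ - T.scale j := log_norm_inv_smul hδ hx0
    rw [h2, norm_smul, norm_inv, Real.norm_of_nonneg hδ.le] at h1
    rw [hX]
    simp only
    rw [← h1]
    field_simp
  set Y := mass (T.α j) ((T.δ j)⁻¹ • x) *
      correctionFactor p (bigV (T.α j) ((T.δ j)⁻¹ • x)) (T.w0 j ((T.δ j)⁻¹ • x))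
        (T.w1 j ((T.δ j)⁻¹ • x))
  have hg : g p (∑ i ∈ Finset.Icc 1 k, (-1) ^ (i - 1) * T.τ i * PU i x) =
      (-1) ^ (j - 1) * (T.τ j / T.δ j ^ 2) * (|t| ^ (p - 1) * t) := by
    have h1 : (T.τ j * p) ^ p = T.τ j / T.δ j ^ 2 := by
      rw [eq_div_iff (by positivity)]
      exact hS.rpow_mul_sq hp hj hτ
    rw [← h1, ← g_sign_mul p _ (by positivity)]
    exact congrArg (g p) ht
  have herr : errorOf p (fun x => ∑ i ∈ Finset.Icc 1 k, (-1) ^ (i - 1) * T.τ i * PU i x) x =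
      (-1) ^ (j - 1) * (T.τ j / T.δ j ^ 2) * (|t| ^ (p - 1) * t - Y) +
        ∑ i ∈ (Finset.Icc 1 k).erase j, (-1) ^ (i - 1) * T.τ i * -(X i / ‖x‖ ^ 2) := by
    unfold errorOf
    rw [hlap, hg, ← Finset.add_sum_erase _ _ hj, hXj]
    ring
  have hτM : ∀ i ∈ Finset.Icc 1 k, T.τ i ≤ M / p := h.tau_le
  -- The `δ_j²` in the weight cancels `δ_j⁻²`, and the remaining `τ_j ≤ M/p` raises the order from
  -- `p⁻³` to `p⁻⁴`.
  have hmain : W * |(-1) ^ (j - 1) * (T.τ j / T.δ j ^ 2) * (|t| ^ (p - 1) * t - Y)| ≤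
      M / p * (C₁ / p ^ 3) := by
    rw [abs_mul, abs_mul, abs_pow, abs_neg, abs_one, one_pow, one_mul,
      abs_of_nonneg (by positivity), W1]
    calc _ = T.τ j * ((1 + Real.exp ((2 + η) * (Real.log ‖x‖ - Real.log (T.δ j)))) *
          |(|t| ^ (p - 1) * t) - Y|) := by field_simp
      _ ≤ _ := mul_le_mul (hτM j hj) hown (by positivity) (by positivity)
  have hrest : ∀ i ∈ (Finset.Icc 1 k).erase j,
      W * |(-1) ^ (i - 1) * T.τ i * -(X i / ‖x‖ ^ 2)| ≤ M / p * (C₂ / p ^ 3) := fun i hi => by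
    obtain ⟨hij, hi⟩ := Finset.mem_erase.1 hi
    have hτi := h.tau_pos i hi
    rw [abs_mul, abs_mul, abs_pow, abs_neg, abs_one, one_pow, one_mul,
      abs_of_pos hτi, W2, abs_neg, abs_div, abs_of_nonneg (by positivity : 0 ≤ ‖x‖ ^ 2)]
    calc _ = T.τ i * ((Real.exp (-2 * (Real.log ‖x‖ - Real.log (T.δ j))) +
          Real.exp (η * (Real.log ‖x‖ - Real.log (T.δ j)))) * |X i|) := by field_simp
      _ ≤ _ := mul_le_mul (hτM i hi) (hother i hi hij) (by positivity) (by positivity)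
  have hcard : (((Finset.Icc 1 k).erase j).card : ℝ) ≤ k := by
    have := Finset.card_erase_le (s := Finset.Icc 1 k) (a := j)
    rw [Nat.card_Icc, Nat.add_sub_cancel] at this
    exact_mod_cast this
  rw [herr]
  calc _ ≤ W * (|(-1) ^ (j - 1) * (T.τ j / T.δ j ^ 2) * (|t| ^ (p - 1) * t - Y)| +
        ∑ i ∈ (Finset.Icc 1 k).erase j, |(-1) ^ (i - 1) * T.τ i * -(X i / ‖x‖ ^ 2)|) := by
        refine mul_le_mul_of_nonneg_left ((abs_add_le _ _).trans ?_) hW0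
        exact add_le_add le_rfl (Finset.abs_sum_le_sum_abs _ _)
    _ ≤ M / p * (C₁ / p ^ 3) + ∑ i ∈ (Finset.Icc 1 k).erase j, M / p * (C₂ / p ^ 3) := by
        rw [mul_add, Finset.mul_sum]
        exact add_le_add hmain (Finset.sum_le_sum hrest)
    _ ≤ M / p * (C₁ / p ^ 3) + k * (M / p * (C₂ / p ^ 3)) := by
        rw [Finset.sum_const, nsmul_eq_mul]
        gcongr
    _ = _ := by field_simp

/-- The origin is a null set, so the essential supremum ignores it. Bounding each of the `k`
summands of the weight separately costs a factor `k` and requires no disjointness of the annuli. -/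
lemma weightedNorm_le {Ω : Set Plane} (hO : IsOpen Ω) {η : ℝ} {f : Plane → ℝ} {A : ℝ}
    (hA : 0 ≤ A) (hδ : ∀ j ∈ Finset.Icc 1 k, 0 < T.δ j)
    (hf : ∀ j ∈ Finset.Icc 1 k, ∀ x ∈ T.annulus Ω k j, x ≠ 0 →
      (T.δ j ^ (2 + η) + ‖x‖ ^ (2 + η)) / T.δ j ^ η * |f x| ≤ A) :
    T.weightedNorm Ω k η f ≤ ENNReal.ofReal (k * A) := by
  unfold weightedNorm
  rw [eLpNorm_exponent_top]
  refine eLpNormEssSup_le_of_ae_bound ?_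
  have h0 : ∀ᵐ x ∂(volume.restrict Ω), x ≠ (0 : Plane) :=
    ae_restrict_of_ae (Measure.ae_ne volume 0)
  filter_upwards [h0, ae_restrict_mem hO.measurableSet] with x hx0 _
  have hpos : ∀ j ∈ Finset.Icc 1 k, 0 ≤ (T.δ j ^ (2 + η) + ‖x‖ ^ (2 + η)) / T.δ j ^ η :=
    fun j hj => by have := (hδ j hj).le; positivity
  have hw : 0 ≤ T.weight Ω k η x :=
    Finset.sum_nonneg fun j hj => indicator_apply_nonneg fun _ => hpos j hj
  rw [Real.norm_eq_abs, abs_mul, abs_of_nonneg hw]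
  unfold weight
  rw [Finset.sum_mul]
  refine (Finset.sum_le_card_nsmul _ _ A fun j hj => ?_).trans (le_of_eq ?_)
  · by_cases hx : x ∈ T.annulus Ω k j
    · rw [indicator_of_mem hx]
      exact hf j hj x hx hx0
    · rw [indicator_of_notMem hx, zero_mul]
      exact hA
  · rw [nsmul_eq_mul, Nat.card_Icc, Nat.add_sub_cancel]

end Tower

end LaneEmdenTower

end

/-! ### Assembly of the uniform estimates -/

open LaneEmdenTower Tower in
theorem proposition3p1 (Ω : Set LaneEmdenTower.Plane)
    (hΩ : LaneEmdenTower.IsSymmetricSmoothDomain Ω)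
    (H : LaneEmdenTower.Plane → LaneEmdenTower.Plane → ℝ)
    (hH : LaneEmdenTower.IsGreenRegularPart Ω H)
    (k : ℕ) (hk : 1 ≤ k) (η : ℝ) (hη0 : 0 < η) (hη1 : η < 1) (K : ℝ) (hK : 0 < K) :
    ∃ C p₀ : ℝ, 0 < C ∧ 1 < p₀ ∧ ∀ p : ℝ, p₀ ≤ p →
      ∀ T : LaneEmdenTower.Tower, T.HasCorrections k →
        T.SolvesSystem k (LaneEmdenTower.robin H 0) p → T.Admissible k K p →
        ∀ U : LaneEmdenTower.Plane → ℝ, T.IsApproxSolution Ω k p U →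
          T.weightedNorm Ω k η (LaneEmdenTower.errorOf p U) ≤ ENNReal.ofReal (C / p ^ 4) := by
  obtain ⟨d, R, B₀, hd, hR, hB₀, hdΩ, hRΩ, hBΩ⟩ := exists_domain_constants hΩ hH
  obtain ⟨Mw, hMw, hprof⟩ := exists_profileBounds K
  obtain ⟨M, c, p₁, hM, hc, hc1, hp₁, hspaced⟩ := exists_spaced k hk (robin H 0) K Mw hMw
  have hMw0 : 0 ≤ Mw := by linarith
  -- A common constant for the variation of `H(·, 0)` and for the error of the projections.
  set B := max B₀ ((2 + 2 * Mw) / d) with hBdef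
  have hB : 0 ≤ B := hB₀.trans (le_max_left _ _)
  obtain ⟨C₁, p₂, hC₁, hp₂, hown⟩ :=
    exists_own_bound k hM hc hR hB hMw0 hη0.le hη1.le
  obtain ⟨C₂, hC₂, hother⟩ :=
    exists_other_bound k (R := R) hM hc hc1 hMw0 hη0.le hη1.le
  have hk0 : (0 : ℝ) < k := by exact_mod_cast hk
  have hdc : 0 ≤ |Real.log d| / c := by positivity
  -- The summand `|log d| / c` in the threshold ensures `δ_i ≤ d`, so that the frontier lies in the
  -- far region of every rescaled profile.
  refine ⟨k * (M * (C₁ + k * C₂)), p₁ + p₂ + M + |Real.log d| / c, by positivity, by linarith, ?_⟩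
  intro p hp T hT hS hA U hU
  have hp1 : 1 ≤ p := by linarith
  have hp0 : 0 < p := by linarith
  have hα : ∀ i ∈ Finset.Icc 1 k, 2 ≤ T.α i ∧ T.α i ≤ K := fun i hi => by
    obtain ⟨hi1, hik⟩ := Finset.mem_Icc.1 hi
    have hmono := fun i hi => (hA.alpha_lt i hi).le
    exact ⟨hA.alpha_one.ge.trans (monotone_of_lt_succ hmono le_rfl hi1 hik),
      (monotone_of_lt_succ hmono hi1 hik le_rfl).trans hA.alpha_le⟩
  have hb : ∀ i ∈ Finset.Icc 1 k,
      ProfileBounds Mw (T.w0 i) (T.C0 i) ∧ ProfileBounds Mw (T.w1 i) (T.C1 i) := fun i hi =>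
    hprof _ _ _ _ _ (hα i hi).1 (hα i hi).2 (hT i hi).1 (hT i hi).2
  have h : T.Spaced k p M c := hspaced p (by linarith) T
    (fun i hi => ⟨(hb i hi).1.rate, (hb i hi).2.rate, (hb i hi).1.zero, (hb i hi).2.zero⟩) hS hA
  have hδd : ∀ i ∈ Finset.Icc 1 k, T.δ i ≤ d := fun i hi => by
    rw [← Real.log_le_log_iff (h.delta_pos i hi) hd]
    have h1 : |Real.log d| / c ≤ p := by linarith
    rw [div_le_iff₀ hc] at h1
    linarith [h.log_le i hi, neg_abs_le (Real.log d)]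
  have key : ∀ j ∈ Finset.Icc 1 k, ∀ x ∈ T.annulus Ω k j, x ≠ 0 →
      (T.δ j ^ (2 + η) + ‖x‖ ^ (2 + η)) / T.δ j ^ η * |errorOf p U x| ≤
        M * (C₁ + k * C₂) / p ^ 4 := by
    intro j hj x hxj hx0
    have hx : x ∈ Ω := hxj.1
    have hl := h.inRange hRΩ hj hxj hx0
    obtain ⟨PU, hPU, hUeq⟩ := hU
    obtain ⟨E, hE, hEb⟩ := exists_expansion (Mw := Mw) (B := B) (Hx := H x 0) (x := x)
      (PU := fun i => PU i x) h hS hc hp1 hj hb (by linarith) hx0 hl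
      ((hBΩ x hx).trans (by gcongr; exact le_max_left _ _)) fun i hi =>
      (projection_expansion hΩ.isOpen hΩ.isBounded hΩ.zero_mem hH hd hdΩ (hα i hi).1
        (h.delta_pos i hi) (hδd i hi) hp1 (hT i hi).1 (hT i hi).2 (hb i hi).1 (hb i hi).2
        (hPU i hi) hx hx0).trans
        (mul_le_mul_of_nonneg_right (le_max_right _ _) (h.delta_pos i hi).le)
    refine weighted_error_le hΩ.isOpen h hS hT ⟨PU, hPU, hUeq⟩ hp0 hC₂.le hj hx hx0
      (t := 1 + (bigV (T.α j) ((T.δ j)⁻¹ • x) + T.w0 j ((T.δ j)⁻¹ • x) / p +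
        T.w1 j ((T.δ j)⁻¹ • x) / p ^ 2 + E) / p) ?_
      (hown p (by linarith) T j x E h hj hx0 hl (hb j hj).1 (hb j hj).2 hEb _ rfl _ rfl)
      fun i hi hij => hother p (by linarith) T i j x h hj hi hij hx0 hl (hb i hi).1 (hb i hi).2 _ rfl
    rw [hUeq]
    refine hE.trans ?_
    field_simp
  refine (weightedNorm_le hΩ.isOpen (by positivity) h.delta_pos key).trans (le_of_eq ?_)
  rw [mul_div_assoc (k : ℝ)]
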